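/- Let $w\ge 2$. For a field $k$ and $m\ge 0$ let $N_m=N_m(k)=k[x]/(x^m)$, and let $$\Lambda_{2,w}(k)=\begin{bmatrix} k[x]/(x^2)&k[x]/(x^2)\\ 0&k[x]/(x^w)\end{bmatrix}$$ be the algebra of upper triangular matrices with the indicated entries, where $k[x]/(x^w)$ acts on the upper right entries from the right through the canonical surjection $k[x]/(x^w)\to k[x]/(x^2)$. A triple $(V',V'',f)$ of $k[x]$-modules with $x^2V'=0$ and $x^wV''=0$ and a $k[x]$-linear map $f:V'\to V''$ is regarded as the right $\Lambda_{2,w}(k)$-module $V'\oplus V''$ with $(v',v'')\begin{bmatrix}\alpha&\beta\\0&\gamma\end{bmatrix}=(v'\alpha,\,f(v'\beta)+v''\gamma)$. Let $I_{2,w}$ be the finite set, independent of $k$, of the symbols $P_0^m,\ P_1^m,\ Z_2^m$ $(1\le m\le w)$, $P_2^m$ $(2\le m\le w)$, $B_2^{m',m}$ $(3\le m+2\le m'\le w)$, $P_1^0$, $P_2^0$, and for $X\in I_{2,w}$ let $X(k)$ be the following right $\Lambda_{2,w}(k)$-module: - $P_0^m(k)=(0,N_m,0)$; - $P_1^m(k)=(N_1,N_m,\iota)$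 with $\iota(1)=x^{m-1}$; - $P_2^m(k)=(N_2,N_m,\iota)$ with $\iota(1)=x^{m-2}$; - $B_2^{m',m}(k)=(N_2,N_{m'}\oplus N_m,\iota)$ with $\iota(1)=(x^{m'-2},x^{m-1})$; - $P_1^0(k)=(N_1,0,0)$ and $P_2^0(k)=(N_2,0,0)$; - $Z_2^m(k)=(N_2,N_m,\kappa)$ with $\kappa(1)=x^{m-1}$. For a function $a:I_{2,w}\to\mathbb{N}_0$ put $a(k)=\bigoplus_{X\in I_{2,w}}X(k)^{a(X)}$. **Theorem 2.3.** For all functions $a,b,c:I_{2,w}\to\mathbb{N}_0$ there is a polynomial $\varphi^b_{a,c}\in\mathbb{Z}[t]$ such that, for every finite field $k$ with $q=|k|$ elements, the number of $\Lambda_{2,w}(k)$-submodules $U$ of $b(k)$ with $U\cong a(k)$ and $b(k)/U\cong c(k)$ equals $\varphi^b_{a,c}(q)$. -/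

import Mathlib

open Polynomial

noncomputable section

namespace HallPoly

universe u

/-- `N k m = k[x]/(x^m)`, a commutative ring and a `k[x]`-module; `N k 0` is the zero module. -/
abbrev N (k : Type u) [Field k] (m : ℕ) : Type u := k[X] ⧸ Ideal.span {(X : k[X]) ^ m}

/-- The canonical surjection `k[x]/(x^w) → k[x]/(x^r)` for `r ≤ w`. -/
def proj (k : Type u) [Field k] {r w : ℕ} (h : r ≤ w) : N k w →+* N k r :=
  Ideal.Quotient.factor
    (Ideal.span_singleton_le_span_singleton.mpr (pow_dvd_pow (X : k[X]) h))

/-- The algebra `Λ_{r,w}(k)`, `r ≤ w`, of upper triangular matrices with entries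
`e₁₁, e₁₂ ∈ k[x]/(x^r)` and `e₂₂ ∈ k[x]/(x^w)`; the `(1,2)` entries form a
`k[x]/(x^r)`-`k[x]/(x^w)`-bimodule, the right action being through `proj`. -/
@[ext]
structure Lam (k : Type u) [Field k] (r w : ℕ) (h : r ≤ w) : Type u where
  /-- The upper left entry. -/
  e₁₁ : N k r
  /-- The upper right entry. -/
  e₁₂ : N k r
  /-- The lower right entry. -/
  e₂₂ : N k w

namespace Lam

variable {k : Type u} [Field k] {r w : ℕ} {h : r ≤ w}

instance : Zero (Lam k r w h) := ⟨⟨0, 0, 0⟩⟩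
instance : One (Lam k r w h) := ⟨⟨1, 0, 1⟩⟩
instance : Add (Lam k r w h) := ⟨fun a b => ⟨a.e₁₁ + b.e₁₁, a.e₁₂ + b.e₁₂, a.e₂₂ + b.e₂₂⟩⟩
instance : Neg (Lam k r w h) := ⟨fun a => ⟨-a.e₁₁, -a.e₁₂, -a.e₂₂⟩⟩

/-- Multiplication of upper triangular matrices. -/
instance : Mul (Lam k r w h) :=
  ⟨fun a b => ⟨a.e₁₁ * b.e₁₁, a.e₁₁ * b.e₁₂ + a.e₁₂ * proj k h b.e₂₂, a.e₂₂ * b.e₂₂⟩⟩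

@[simp] theorem zero_e₁₁ : (0 : Lam k r w h).e₁₁ = 0 := rfl
@[simp] theorem zero_e₁₂ : (0 : Lam k r w h).e₁₂ = 0 := rfl
@[simp] theorem zero_e₂₂ : (0 : Lam k r w h).e₂₂ = 0 := rfl
@[simp] theorem one_e₁₁ : (1 : Lam k r w h).e₁₁ = 1 := rfl
@[simp] theorem one_e₁₂ : (1 : Lam k r w h).e₁₂ = 0 := rfl
@[simp] theorem one_e₂₂ : (1 : Lam k r w h).e₂₂ = 1 := rfl
@[simp] theorem add_e₁₁ (a b : Lam k r w h) : (a + b).e₁₁ = a.e₁₁ + b.e₁₁ := rfl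
@[simp] theorem add_e₁₂ (a b : Lam k r w h) : (a + b).e₁₂ = a.e₁₂ + b.e₁₂ := rfl
@[simp] theorem add_e₂₂ (a b : Lam k r w h) : (a + b).e₂₂ = a.e₂₂ + b.e₂₂ := rfl
@[simp] theorem neg_e₁₁ (a : Lam k r w h) : (-a).e₁₁ = -a.e₁₁ := rfl
@[simp] theorem neg_e₁₂ (a : Lam k r w h) : (-a).e₁₂ = -a.e₁₂ := rfl
@[simp] theorem neg_e₂₂ (a : Lam k r w h) : (-a).e₂₂ = -a.e₂₂ := rfl
@[simp] theorem mul_e₁₁ (a b : Lam k r w h) : (a * b).e₁₁ = a.e₁₁ * b.e₁₁ := rfl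
@[simp] theorem mul_e₁₂ (a b : Lam k r w h) :
    (a * b).e₁₂ = a.e₁₁ * b.e₁₂ + a.e₁₂ * proj k h b.e₂₂ := rfl
@[simp] theorem mul_e₂₂ (a b : Lam k r w h) : (a * b).e₂₂ = a.e₂₂ * b.e₂₂ := rfl

instance : Ring (Lam k r w h) where
  add_assoc a b c := by ext <;> simp [add_assoc]
  zero_add a := by ext <;> simp
  add_zero a := by ext <;> simp
  add_comm a b := by ext <;> simp [add_comm]
  neg_add_cancel a := by ext <;> simp
  mul_assoc a b c := by ext <;> simp only [mul_e₁₁, mul_e₁₂, mul_e₂₂, map_mul] <;> ring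
  one_mul a := by ext <;> simp
  mul_one a := by ext <;> simp
  zero_mul a := by ext <;> simp
  mul_zero a := by ext <;> simp
  left_distrib a b c := by
    ext <;> simp only [mul_e₁₁, mul_e₁₂, mul_e₂₂, add_e₁₁, add_e₁₂, add_e₂₂, map_add] <;> ring
  right_distrib a b c := by
    ext <;> simp only [mul_e₁₁, mul_e₁₂, mul_e₂₂, add_e₁₁, add_e₁₂, add_e₂₂] <;> ring
  nsmul := nsmulRec
  zsmul := zsmulRec

end Lam

/-- The action of `k[x]/(x^m)` on a `k[x]`-module that is annihilated by `x^m`. -/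
def truncAct {k : Type u} [Field k] {V : Type u} [AddCommGroup V] [Module k[X] V] {m : ℕ}
    (hV : ∀ v : V, (X : k[X]) ^ m • v = 0) : N k m →+* Module.End k[X] V :=
  Ideal.Quotient.lift _ (algebraMap k[X] (Module.End k[X] V)) (by
    intro a ha
    obtain ⟨b, rfl⟩ := Ideal.mem_span_singleton.mp ha
    ext v
    change ((X : k[X]) ^ m * b) • v = 0
    rw [mul_comm, mul_smul, hV, smul_zero])

@[simp] theorem truncAct_mk {k : Type u} [Field k] {V : Type u} [AddCommGroup V] [Module k[X] V]
    {m : ℕ} (hV : ∀ v : V, (X : k[X]) ^ m • v = 0) (p : k[X]) (v : V) :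
    truncAct hV (Ideal.Quotient.mk _ p) v = p • v := rfl

/-- A triple `(V₁, V₂, f)`: two `k[x]`-modules with `x^r V₁ = 0` and `x^w V₂ = 0`, and a
`k[x]`-linear map `f : V₁ → V₂`. -/
structure Triple (k : Type u) [Field k] (r w : ℕ) where
  /-- The first module. -/
  V₁ : Type u
  /-- The second module. -/
  V₂ : Type u
  [acg₁ : AddCommGroup V₁]
  [acg₂ : AddCommGroup V₂]
  [mod₁ : Module k[X] V₁]
  [mod₂ : Module k[X] V₂]
  /-- The structure map. -/
  f : V₁ →ₗ[k[X]] V₂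
  h₁ : ∀ v : V₁, (X : k[X]) ^ r • v = 0
  h₂ : ∀ v : V₂, (X : k[X]) ^ w • v = 0

attribute [instance] Triple.acg₁ Triple.acg₂ Triple.mod₁ Triple.mod₂

namespace Triple

variable {k : Type u} [Field k] {r w : ℕ}

theorem f_truncAct (T : Triple k r w) (h : r ≤ w) (c : N k w) (v : T.V₁) :
    T.f (truncAct T.h₁ (proj k h c) v) = truncAct T.h₂ c (T.f v) := by
  obtain ⟨p, rfl⟩ := Ideal.Quotient.mk_surjective c
  exact T.f.map_smul p v

/-- The underlying additive group `V₁ ⊕ V₂` of the right `Λ_{r,w}(k)`-module of a triple. -/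
def Carrier (T : Triple k r w) : Type u := T.V₁ × T.V₂

instance (T : Triple k r w) : AddCommGroup T.Carrier :=
  inferInstanceAs (AddCommGroup (T.V₁ × T.V₂))

/-- The right `Λ_{r,w}(k)`-module of a triple, a right module being a module over the opposite
ring: `(v₁, v₂) · (a b; 0 c) = (v₁ a, f (v₁ b) + v₂ c)`. -/
instance (T : Triple k r w) (h : r ≤ w) : Module (Lam k r w h)ᵐᵒᵖ T.Carrier where
  smul l v := (truncAct T.h₁ l.unop.e₁₁ v.1,
    T.f (truncAct T.h₁ l.unop.e₁₂ v.1) + truncAct T.h₂ l.unop.e₂₂ v.2)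
  one_smul v := by
    refine Prod.ext ?_ ?_
    · change truncAct T.h₁ 1 v.1 = v.1
      simp
    · change T.f (truncAct T.h₁ 0 v.1) + truncAct T.h₂ 1 v.2 = v.2
      simp
  mul_smul l m v := by
    refine Prod.ext ?_ ?_
    · change truncAct T.h₁ (m.unop.e₁₁ * l.unop.e₁₁) v.1 =
        truncAct T.h₁ l.unop.e₁₁ (truncAct T.h₁ m.unop.e₁₁ v.1)
      rw [mul_comm, map_mul]; rfl
    · change T.f (truncAct T.h₁ (m.unop.e₁₁ * l.unop.e₁₂ + m.unop.e₁₂ * proj k h l.unop.e₂₂) v.1)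
          + truncAct T.h₂ (m.unop.e₂₂ * l.unop.e₂₂) v.2 =
        T.f (truncAct T.h₁ l.unop.e₁₂ (truncAct T.h₁ m.unop.e₁₁ v.1)) +
          truncAct T.h₂ l.unop.e₂₂ (T.f (truncAct T.h₁ m.unop.e₁₂ v.1) +
            truncAct T.h₂ m.unop.e₂₂ v.2)
      rw [mul_comm m.unop.e₁₁, mul_comm m.unop.e₁₂, mul_comm m.unop.e₂₂]
      simp only [map_add, map_mul, LinearMap.add_apply, Module.End.mul_apply, f_truncAct]
      abel
  smul_zero l := by
    refine Prod.ext ?_ ?_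
    · change truncAct T.h₁ l.unop.e₁₁ 0 = 0
      simp
    · change T.f (truncAct T.h₁ l.unop.e₁₂ 0) + truncAct T.h₂ l.unop.e₂₂ 0 = 0
      simp
  smul_add l v v' := by
    refine Prod.ext ?_ ?_
    · change truncAct T.h₁ l.unop.e₁₁ (v.1 + v'.1) = truncAct T.h₁ l.unop.e₁₁ v.1 + truncAct T.h₁ l.unop.e₁₁ v'.1
      simp
    · change T.f (truncAct T.h₁ l.unop.e₁₂ (v.1 + v'.1)) + truncAct T.h₂ l.unop.e₂₂ (v.2 + v'.2) =
        (T.f (truncAct T.h₁ l.unop.e₁₂ v.1) + truncAct T.h₂ l.unop.e₂₂ v.2) +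
        (T.f (truncAct T.h₁ l.unop.e₁₂ v'.1) + truncAct T.h₂ l.unop.e₂₂ v'.2)
      simp only [map_add]
      abel
  add_smul l m v := by
    refine Prod.ext ?_ ?_
    · change truncAct T.h₁ (l.unop.e₁₁ + m.unop.e₁₁) v.1 = truncAct T.h₁ l.unop.e₁₁ v.1 + truncAct T.h₁ m.unop.e₁₁ v.1
      simp
    · change T.f (truncAct T.h₁ (l.unop.e₁₂ + m.unop.e₁₂) v.1) +
          truncAct T.h₂ (l.unop.e₂₂ + m.unop.e₂₂) v.2 =
        (T.f (truncAct T.h₁ l.unop.e₁₂ v.1) + truncAct T.h₂ l.unop.e₂₂ v.2) +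
        (T.f (truncAct T.h₁ m.unop.e₁₂ v.1) + truncAct T.h₂ m.unop.e₂₂ v.2)
      simp only [map_add, LinearMap.add_apply]
      abel
  zero_smul v := by
    refine Prod.ext ?_ ?_
    · change truncAct T.h₁ 0 v.1 = 0
      simp
    · change T.f (truncAct T.h₁ 0 v.1) + truncAct T.h₂ 0 v.2 = 0
      simp

end Triple

/-- The class of `x^j` in `k[x]/(x^m)`. -/
def xpow (k : Type u) [Field k] (m j : ℕ) : N k m := Ideal.Quotient.mk _ ((X : k[X]) ^ j)

theorem pow_smul_xpow {k : Type u} [Field k] {m i j : ℕ} (h : m ≤ i + j) :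
    (X : k[X]) ^ i • xpow k m j = 0 := by
  change Ideal.Quotient.mk (Ideal.span {(X : k[X]) ^ m}) (X ^ i * X ^ j) = 0
  rw [Ideal.Quotient.eq_zero_iff_mem, Ideal.mem_span_singleton, ← pow_add]
  exact pow_dvd_pow _ h

theorem pow_smul_N {k : Type u} [Field k] {m i : ℕ} (h : m ≤ i) (v : N k m) :
    (X : k[X]) ^ i • v = 0 := by
  obtain ⟨p, rfl⟩ := Ideal.Quotient.mk_surjective v
  change Ideal.Quotient.mk (Ideal.span {(X : k[X]) ^ m}) (X ^ i * p) = 0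
  rw [Ideal.Quotient.eq_zero_iff_mem, Ideal.mem_span_singleton]
  exact (pow_dvd_pow _ h).mul_right p

/-- The `k[x]`-linear map `k[x]/(x^r) → V` that sends `1` to `v`, where `x^r v = 0`. -/
def homOfElt {k : Type u} [Field k] {V : Type u} [AddCommGroup V] [Module k[X] V] {r : ℕ}
    (v : V) (hv : (X : k[X]) ^ r • v = 0) : N k r →ₗ[k[X]] V :=
  Submodule.liftQ (Ideal.span {(X : k[X]) ^ r}) (LinearMap.toSpanSingleton k[X] V v) (by
    intro a ha
    obtain ⟨b, rfl⟩ := Ideal.mem_span_singleton.mp ha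
    simp [mul_comm _ b, mul_smul, hv])

/-- The finite, field-independent index set `I_{2,w}` of the indecomposables
(`P_2^1 = Z_2^1` is listed once, as `Z_2^1`). -/
inductive Idx (w : ℕ) : Type
  /-- `P_0^m`, `1 ≤ m ≤ w` -/
  | P0 (m : ℕ) (h1 : 1 ≤ m) (h2 : m ≤ w) : Idx w
  /-- `P_1^m`, `1 ≤ m ≤ w` -/
  | P1 (m : ℕ) (h1 : 1 ≤ m) (h2 : m ≤ w) : Idx w
  /-- `P_2^m`, `2 ≤ m ≤ w` -/
  | P2 (m : ℕ) (h1 : 2 ≤ m) (h2 : m ≤ w) : Idx w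
  /-- `B_2^{m',m}`, `3 ≤ m + 2 ≤ m' ≤ w` -/
  | B (m' m : ℕ) (h1 : 3 ≤ m + 2) (h2 : m + 2 ≤ m') (h3 : m' ≤ w) : Idx w
  /-- `P_1^0` -/
  | P10 : Idx w
  /-- `P_2^0` -/
  | P20 : Idx w
  /-- `Z_2^m`, `1 ≤ m ≤ w` -/
  | Z (m : ℕ) (h1 : 1 ≤ m) (h2 : m ≤ w) : Idx w

/-- The triple of the indecomposable `X(k)`, for `X ∈ I_{2,w}`:
* `P_0^m(k) = (0, k[x]/(x^m), 0)`,
* `P_1^m(k) = (k[x]/(x), k[x]/(x^m), ι)` with `ι(1) = x^(m-1)`,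
* `P_2^m(k) = (k[x]/(x^2), k[x]/(x^m), ι)` with `ι(1) = x^(m-2)`,
* `B_2^{m',m}(k) = (k[x]/(x^2), k[x]/(x^m') ⊕ k[x]/(x^m), ι)` with
  `ι(1) = (x^(m'-2), x^(m-1))`,
* `P_1^0(k) = (k[x]/(x), 0, 0)` and `P_2^0(k) = (k[x]/(x^2), 0, 0)`,
* `Z_2^m(k) = (k[x]/(x^2), k[x]/(x^m), κ)` with `κ(1) = x^(m-1)`. -/
def indec (k : Type u) [Field k] {w : ℕ} : Idx w → Triple k 2 w
  | .P0 m _ h2 =>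
    { V₁ := PUnit, V₂ := N k m, f := 0
      h₁ := fun _ => rfl
      h₂ := pow_smul_N h2 }
  | .P1 m h1 h2 =>
    { V₁ := N k 1, V₂ := N k m
      f := homOfElt (xpow k m (m - 1)) (pow_smul_xpow (by omega))
      h₁ := pow_smul_N (by omega)
      h₂ := pow_smul_N h2 }
  | .P2 m h1 h2 =>
    { V₁ := N k 2, V₂ := N k m
      f := homOfElt (xpow k m (m - 2)) (pow_smul_xpow (by omega))
      h₁ := pow_smul_N le_rfl
      h₂ := pow_smul_N h2 }
  | .B m' m h1 h2 h3 =>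
    { V₁ := N k 2, V₂ := N k m' × N k m
      f := homOfElt (xpow k m' (m' - 2), xpow k m (m - 1))
        (Prod.ext (pow_smul_xpow (by omega)) (pow_smul_xpow (by omega)))
      h₁ := pow_smul_N le_rfl
      h₂ := fun v => Prod.ext (pow_smul_N h3 v.1) (pow_smul_N (by omega) v.2) }
  | .P10 =>
    { V₁ := N k 1, V₂ := PUnit, f := 0
      h₁ := pow_smul_N (by omega)
      h₂ := fun _ => rfl }
  | .P20 =>
    { V₁ := N k 2, V₂ := PUnit, f := 0
      h₁ := pow_smul_N le_rfl
      h₂ := fun _ => rfl }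
  | .Z m h1 h2 =>
    { V₁ := N k 2, V₂ := N k m
      f := homOfElt (xpow k m (m - 1)) (pow_smul_xpow (by omega))
      h₁ := pow_smul_N le_rfl
      h₂ := pow_smul_N h2 }

/-- The index set is finite. -/
instance (w : ℕ) : Finite (Idx w) := by
  let g : Idx w → Fin 7 × Fin (w + 1) × Fin (w + 1)
    | .P0 m _ h2 => (0, ⟨m, by omega⟩, 0)
    | .P1 m _ h2 => (1, ⟨m, by omega⟩, 0)
    | .P2 m _ h2 => (2, ⟨m, by omega⟩, 0)
    | .B m' m h1 h2 h3 => (3, ⟨m', by omega⟩, ⟨m, by omega⟩)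
    | .P10 => (4, 0, 0)
    | .P20 => (5, 0, 0)
    | .Z m _ h2 => (6, ⟨m, by omega⟩, 0)
  refine Finite.of_injective g ?_
  intro a b hab
  cases a <;> cases b <;> simp_all [g]

/-- The right `Λ_{2,w}(k)`-module `a(k) = ⨁_{X ∈ I_{2,w}} X(k)^{a(X)}` of a multiplicity function
`a : I_{2,w} → ℕ`. The index set is finite, so that the direct sum is the product. -/
abbrev DSum (k : Type u) [Field k] {w : ℕ} (a : Idx w → ℕ) : Type u :=
  ∀ I : Idx w, Fin (a I) → (indec k I).Carrier

/-- `F_{A,C}^B` for right modules `A`, `B`, `C` over a ring `R`: the number of submodules `U` of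
`B` with `U ≅ A` and `B/U ≅ C`. -/
def hallNumber (R : Type*) [Ring R] (A B C : Type*)
    [AddCommGroup A] [Module Rᵐᵒᵖ A] [AddCommGroup B] [Module Rᵐᵒᵖ B]
    [AddCommGroup C] [Module Rᵐᵒᵖ C] : ℕ :=
  Set.ncard {U : Submodule Rᵐᵒᵖ B |
    Nonempty (U ≃ₗ[Rᵐᵒᵖ] A) ∧ Nonempty ((B ⧸ U) ≃ₗ[Rᵐᵒᵖ] C)}

end HallPoly

end

open Polynomial

noncomputable section

namespace HallPoly

universe u

/-! Call an isomorphism type a good if, for all b and c, the Hall number F^b_{a,c} is a quotient of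
two integer polynomials in q = |k| whose denominator is monic and has no zero at the order of a
finite field. Goodness suffices: after division with remainder by the denominator, the remainder
term is an integer for every q and tends to 0, so it vanishes and a polynomial is left
(`exists_polynomial_of_mem_ratFn`).

Some counts are rational for formal reasons. The axioms `Sys` describe a finite list of
indecomposables with Hom spaces of order q^h, where h does not depend on the field, and with local
endomorphism rings of residue field of order q. They imply Krull–Schmidt uniqueness. They also show
that the orders of automorphism groups, and hence the Hall numbers of split extensions, are
quotients of monic polynomials. Counting homomorphisms by their images then gives the numbers of
submodules, and of quotients, of a given type. Counting pairs v ∈ U gives the number of elements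
with a prescribed quotient by the submodule that they generate. A cyclic indecomposable that is
determined among cyclic modules by its dimension vector is therefore good (`FamSys.good_of_cyclic`).

The remaining types are reached in the Hall algebra. By associativity, if a and c are good then Σ_m
F^m_{a,c} F^b_{m,d} is rational for all b and d. If all middle terms m but one are good, and the
coefficient of the last one is a quotient of monic polynomials, then the last one is good too
(`FamSys.good_of_relation`). The direct sum a ⊕ c has a strictly larger endomorphism ring than any
other middle term, so everything is good once the indecomposables are (`FamSys.good_of_single`).

For Λ_{2,w} all indecomposables have the form G(p) = (N_r, N_{m₁} ⊕ N_{m₂}, 1 ↦ (x^{i₁}, x^{i₂})).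
Homomorphisms from G(p) to T are triples (v, u₁, u₂) with f(v) = x^{i₁}u₁ + x^{i₂}u₂, which gives
the exponents h. Maps from T to G(p) come from linear functionals on T, and a choice of elements and
functionals by heights shows that every nonzero module has a summand in the list (`exists_split`).

The indecomposables are good in the order P_0^n, P_1^0, P_2^0 (cyclic), P_1^n, P_2^n, Z_2^n,
B_2^{l,b}. Each noncyclic one is a middle term of an extension in which all other possible middle
terms are already good. The other candidates are excluded by inequalities between Hom dimensions.
For B_2^{l,b} the extension has the submodule P_2^{b+1} and the quotient P_0^{l-1}, with Hall number
q^{b-1}, and the induction is on b. -/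

/-- A finite field, bundled. -/
structure FinField : Type (u + 1) where
  /-- The underlying type. -/
  K : Type u
  [fld : Field K]
  [fin : Finite K]

attribute [instance] FinField.fld FinField.fin

/-- The number of elements of a finite field. -/
def FinField.q (F : FinField.{u}) : ℤ := Nat.card F.K

theorem FinField.exists_large (n : ℕ) : ∃ F : FinField.{u}, (n : ℤ) ≤ F.q := by
  obtain ⟨p, hp, hp'⟩ := Nat.exists_infinite_primes n
  have : Fact p.Prime := ⟨hp'⟩
  refine ⟨⟨ULift.{u} (ZMod p)⟩, ?_⟩
  simpa [FinField.q] using hp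

theorem FinField.one_lt_card (F : FinField.{u}) : 1 < Nat.card F.K := Finite.one_lt_card

theorem FinField.one_lt_q (F : FinField.{u}) : 1 < F.q := by
  have := F.one_lt_card
  unfold FinField.q
  exact_mod_cast this

/-! ### Rational functions of q with monic denominators -/

/-- The functions of a finite field that are rational in the number of elements, with a monic
integer polynomial as denominator. -/
def RatFn : Subring (FinField.{u} → ℚ) where
  carrier := {f | ∃ P Q : ℤ[X], Q.Monic ∧ ∀ F : FinField.{u},
    Q.eval F.q ≠ 0 ∧ f F * (Q.eval F.q : ℤ) = (P.eval F.q : ℤ)}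
  mul_mem' := by
    rintro f g ⟨P, Q, hQ, h⟩ ⟨P', Q', hQ', h'⟩
    refine ⟨P * P', Q * Q', hQ.mul hQ', fun F => ⟨?_, ?_⟩⟩
    · rw [eval_mul]; exact mul_ne_zero (h F).1 (h' F).1
    · rw [eval_mul, eval_mul]; push_cast
      rw [← (h F).2, ← (h' F).2, Pi.mul_apply]; ring
  one_mem' := ⟨1, 1, monic_one, fun F => by simp⟩
  add_mem' := by
    rintro f g ⟨P, Q, hQ, h⟩ ⟨P', Q', hQ', h'⟩
    refine ⟨P * Q' + P' * Q, Q * Q', hQ.mul hQ', fun F => ⟨?_, ?_⟩⟩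
    · rw [eval_mul]; exact mul_ne_zero (h F).1 (h' F).1
    · rw [eval_mul, eval_add, eval_mul, eval_mul]; push_cast
      rw [← (h F).2, ← (h' F).2, Pi.add_apply]; ring
  zero_mem' := ⟨0, 1, monic_one, fun F => by simp⟩
  neg_mem' := by
    rintro f ⟨P, Q, hQ, h⟩
    refine ⟨-P, Q, hQ, fun F => ⟨(h F).1, ?_⟩⟩
    rw [eval_neg]; push_cast; rw [← (h F).2, Pi.neg_apply]; ring

/-- The functions of a finite field that are nowhere zero and a quotient of two monic integer
polynomials in the number of elements. -/
def MonicFn (f : FinField.{u} → ℚ) : Prop :=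
  ∃ P Q : ℤ[X], P.Monic ∧ Q.Monic ∧ ∀ F : FinField.{u},
    P.eval F.q ≠ 0 ∧ Q.eval F.q ≠ 0 ∧ f F * (Q.eval F.q : ℤ) = (P.eval F.q : ℤ)

theorem MonicFn.mem {f : FinField.{u} → ℚ} (h : MonicFn f) : f ∈ RatFn := by
  obtain ⟨P, Q, -, hQ, h⟩ := h
  exact ⟨P, Q, hQ, fun F => (h F).2⟩

theorem MonicFn.ne_zero {f : FinField.{u} → ℚ} (h : MonicFn f) (F : FinField.{u}) : f F ≠ 0 := by
  obtain ⟨P, Q, -, hQ, h⟩ := h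
  intro h0
  have := (h F).2.2
  rw [h0, zero_mul] at this
  exact (h F).1 (by exact_mod_cast this.symm)

theorem MonicFn.mul {f g : FinField.{u} → ℚ} (hf : MonicFn f) (hg : MonicFn g) :
    MonicFn (fun F => f F * g F) := by
  obtain ⟨P, Q, hP, hQ, h⟩ := hf
  obtain ⟨P', Q', hP', hQ', h'⟩ := hg
  refine ⟨P * P', Q * Q', hP.mul hP', hQ.mul hQ', fun F => ⟨?_, ?_, ?_⟩⟩
  · rw [eval_mul]; exact mul_ne_zero (h F).1 (h' F).1
  · rw [eval_mul]; exact mul_ne_zero (h F).2.1 (h' F).2.1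
  · rw [eval_mul, eval_mul]; push_cast
    rw [← (h F).2.2, ← (h' F).2.2]; ring

theorem MonicFn.inv {f : FinField.{u} → ℚ} (hf : MonicFn f) : MonicFn (fun F => (f F)⁻¹) := by
  have h0 := hf.ne_zero
  obtain ⟨P, Q, hP, hQ, h⟩ := hf
  refine ⟨Q, P, hQ, hP, fun F => ⟨(h F).2.1, (h F).1, ?_⟩⟩
  rw [← (h F).2.2, inv_mul_cancel_left₀ (h0 F)]

theorem MonicFn.mem_of_mul_mem {f g : FinField.{u} → ℚ} (hf : MonicFn f)
    (h : (fun F => f F * g F) ∈ RatFn) : g ∈ RatFn := by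
  have := RatFn.mul_mem hf.inv.mem h
  convert this using 1
  funext F
  simp [hf.ne_zero F]

theorem MonicFn.of_eval {P : ℤ[X]} (hP : P.Monic) (h : ∀ F : FinField.{u}, P.eval F.q ≠ 0) :
    MonicFn (fun F : FinField.{u} => ((P.eval F.q : ℤ) : ℚ)) :=
  ⟨P, 1, hP, monic_one, fun F => ⟨h F, by simp, by simp⟩⟩

theorem MonicFn.pow (n : ℕ) : MonicFn (fun F : FinField.{u} => (F.q : ℚ) ^ n) := by
  have := MonicFn.of_eval.{u} (P := X ^ n) (monic_X_pow n)
    (fun F => by simpa using fun h => absurd h (by have := F.one_lt_q; omega))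
  simpa using this

theorem MonicFn.pow_sub_pow {m n : ℕ} (h : m < n) :
    MonicFn (fun F : FinField.{u} => (F.q : ℚ) ^ n - (F.q : ℚ) ^ m) := by
  have := MonicFn.of_eval.{u} (P := X ^ n - X ^ m)
    ((monic_X_pow n).sub_of_left (by simpa using h))
    (fun F => by
      simp only [eval_sub, eval_pow, eval_X]
      have := pow_lt_pow_right₀ F.one_lt_q h
      omega)
  simpa using this

/-- Division by the monic denominator Q leaves a term R(q)/Q(q) with deg R < deg Q that is still an
integer for every q. It tends to 0 and there are arbitrarily large finite fields, so R has a zero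
beyond all its roots unless R = 0. -/
theorem exists_polynomial_of_mem_ratFn {f : FinField.{u} → ℚ} (hf : f ∈ RatFn)
    (hint : ∀ F, ∃ n : ℤ, f F = n) : ∃ φ : ℤ[X], ∀ F : FinField.{u}, f F = (φ.eval F.q : ℤ) := by
  obtain ⟨P, Q, hQ, h⟩ := hf
  set R := P %ₘ Q
  set D := P /ₘ Q
  have hdiv : R + Q * D = P := modByMonic_add_div P Q
  have key : ∀ F : FinField.{u}, ∃ n : ℤ, R.eval F.q = n * Q.eval F.q ∧ f F = n + (D.eval F.q : ℤ) := by
    intro F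
    obtain ⟨n, hn⟩ := hint F
    have h2 := (h F).2
    rw [hn] at h2
    have h3 : n * Q.eval F.q = P.eval F.q := by exact_mod_cast h2
    refine ⟨n - D.eval F.q, ?_, ?_⟩
    · rw [← hdiv, eval_add, eval_mul] at h3
      linear_combination -h3
    · rw [hn]; push_cast; ring
  have hR : R = 0 := by
    by_contra hR0
    have hlt : R.degree < Q.degree := degree_modByMonic_lt P hQ
    have hinj : Function.Injective (Int.castRingHom ℝ) := Int.cast_injective
    have ht := Polynomial.div_tendsto_atTop_zero_of_degree_lt (R.map (Int.castRingHom ℝ))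
      (Q.map (Int.castRingHom ℝ)) (by
        rw [degree_map_eq_of_injective hinj, degree_map_eq_of_injective hinj]; exact hlt)
    have hev := (ht.eventually (Metric.ball_mem_nhds (0 : ℝ) one_pos))
    obtain ⟨B, hB⟩ := Filter.eventually_atTop.mp hev
    obtain ⟨C, hC⟩ := R.roots.toFinset.bddAbove
    -- From B on, |R/Q| < 1, and C bounds the roots of R. As C may be negative, `toNat` is used.
    obtain ⟨F, hF⟩ := FinField.exists_large.{u} (max ⌈B⌉₊ (C.toNat + 1))
    have hF1 : B ≤ (F.q : ℝ) := by
      have h1 : (⌈B⌉₊ : ℤ) ≤ F.q := le_trans (by exact_mod_cast le_max_left _ _) hF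
      exact (Nat.le_ceil B).trans (by exact_mod_cast h1)
    have hF2 : C < F.q := by
      have h1 : ((C.toNat + 1 : ℕ) : ℤ) ≤ F.q := le_trans (by exact_mod_cast le_max_right _ _) hF
      omega
    obtain ⟨n, hn, -⟩ := key F
    have hlt1 := hB _ hF1
    have e1 : ∀ T : ℤ[X], (T.map (Int.castRingHom ℝ)).eval (F.q : ℝ) = (T.eval F.q : ℤ) := by
      intro T
      rw [eval_intCast_map]
      simp
    simp only [e1, dist_zero_right, hn, Int.cast_mul] at hlt1
    rw [mul_div_cancel_right₀ _ (by exact_mod_cast (h F).1)] at hlt1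
    have hn0 : n = 0 := by
      have : |(n : ℝ)| < 1 := hlt1
      have h2 : |n| < 1 := by exact_mod_cast this
      exact Int.abs_lt_one_iff.mp h2
    rw [hn0, zero_mul] at hn
    have := hC (show F.q ∈ R.roots.toFinset by simp [hR0, hn])
    omega
  refine ⟨D, fun F => ?_⟩
  obtain ⟨n, hn, hf⟩ := key F
  rw [hR, eval_zero] at hn
  have : n = 0 := by
    rcases mul_eq_zero.mp hn.symm with h0 | h0
    · exact h0
    · exact absurd h0 (h F).1
  rw [hf, this]; simp

/-! ### Orders of groups and of disjoint unions -/

section Card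

theorem card_le_mul_of_addMonoidHom {G H K : Type*} [AddGroup G] [AddGroup H] [Finite G] [Finite H]
    [Finite K] (f : G →+ H) (e : f.ker → K) (he : Function.Injective e) :
    Nat.card G ≤ Nat.card K * Nat.card H := by
  rw [← AddSubgroup.card_mul_index f.ker, AddSubgroup.index_ker]
  exact Nat.mul_le_mul (Nat.card_le_card_of_injective e he) (AddSubgroup.card_le_card_addGroup _)

/-- In |G| = |ker f|·|im f| the first factor is at most |K|, so |K|·|H| ≤ |G| leaves no room for a
proper image. This turns equalities of Hom dimensions into the existence of extensions. -/
theorem surjective_of_card_le_mul {G H K : Type*} [AddGroup G] [AddGroup H] [Finite G] [Finite H]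
    [Finite K] (f : G →+ H) (e : f.ker → K) (he : Function.Injective e)
    (h : Nat.card K * Nat.card H ≤ Nat.card G) (hK : 0 < Nat.card K) :
    Function.Surjective f := by
  rw [← AddSubgroup.card_mul_index f.ker, AddSubgroup.index_ker] at h
  have h1 : Nat.card f.ker ≤ Nat.card K := Nat.card_le_card_of_injective e he
  have h2 : Nat.card K * Nat.card H ≤ Nat.card K * Nat.card f.range :=
    h.trans (Nat.mul_le_mul_right _ h1)
  have h3 := Nat.le_of_mul_le_mul_left h2 hK
  rw [← AddMonoidHom.range_eq_top]
  exact AddSubgroup.eq_top_of_le_card _ h3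

theorem card_sigma_const {α : Type*} {β : α → Type*} (n : ℕ) [Finite α] [∀ a, Finite (β a)]
    (h : ∀ a, Nat.card (β a) = n) : Nat.card (Sigma β) = Nat.card α * n := by
  have := Fintype.ofFinite α
  rw [Nat.card_sigma]
  simp [h, Nat.card_eq_fintype_card]

end Card

/-! ### Counting homomorphisms, embeddings and automorphisms of finite modules -/

section Modules

variable (S : Type*) [Ring S]

/-- The number of automorphisms of a module. -/
def autCard (A : Type*) [AddCommGroup A] [Module S A] : ℕ := Nat.card (A ≃ₗ[S] A)

/-- The number of submodules of `M` that are isomorphic to `A` with quotient isomorphic to `C`. -/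
def hallCard (A M C : Type*) [AddCommGroup A] [Module S A] [AddCommGroup M] [Module S M]
    [AddCommGroup C] [Module S C] : ℕ :=
  Nat.card {U : Submodule S M // Nonempty (U ≃ₗ[S] A) ∧ Nonempty ((M ⧸ U) ≃ₗ[S] C)}

variable {S}

theorem finite_hom {A B : Type*} [AddCommGroup A] [Module S A] [AddCommGroup B] [Module S B]
    [Finite A] [Finite B] : Finite (A →ₗ[S] B) :=
  Finite.of_injective (fun f : A →ₗ[S] B => (f : A → B)) DFunLike.coe_injective

theorem finite_equiv {A B : Type*} [AddCommGroup A] [Module S A] [AddCommGroup B] [Module S B]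
    [Finite A] [Finite B] : Finite (A ≃ₗ[S] B) :=
  Finite.of_injective (fun f : A ≃ₗ[S] B => (f : A → B)) DFunLike.coe_injective

theorem finite_quotient {A : Type*} [AddCommGroup A] [Module S A] [Finite A] (U : Submodule S A) :
    Finite (A ⧸ U) :=
  Finite.of_surjective U.mkQ U.mkQ_surjective

attribute [local instance] finite_hom finite_equiv finite_quotient

variable {A A' B C C' M M' T : Type*} [AddCommGroup A] [Module S A] [AddCommGroup B] [Module S B]
  [AddCommGroup C] [Module S C] [AddCommGroup M] [Module S M] [AddCommGroup T] [Module S T]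
  [AddCommGroup A'] [Module S A'] [AddCommGroup C'] [Module S C'] [AddCommGroup M'] [Module S M']

theorem autCard_pos [Finite A] : 0 < autCard S A :=
  haveI : Nonempty (A ≃ₗ[S] A) := ⟨LinearEquiv.refl S A⟩
  Nat.card_pos

theorem homCard_congr (e : A ≃ₗ[S] A') (e' : C ≃ₗ[S] C') :
    Nat.card (A →ₗ[S] C) = Nat.card (A' →ₗ[S] C') :=
  Nat.card_congr
    { toFun := fun f => e'.toLinearMap ∘ₗ f ∘ₗ e.symm.toLinearMap
      invFun := fun f => e'.symm.toLinearMap ∘ₗ f ∘ₗ e.toLinearMap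
      left_inv := fun f => by ext; simp
      right_inv := fun f => by ext; simp }

theorem equivCard_congr (e : A ≃ₗ[S] A') (e' : C ≃ₗ[S] C') :
    Nat.card (A ≃ₗ[S] C) = Nat.card (A' ≃ₗ[S] C') :=
  Nat.card_congr
    { toFun := fun f => e.symm ≪≫ₗ f ≪≫ₗ e'
      invFun := fun f => e ≪≫ₗ f ≪≫ₗ e'.symm
      left_inv := fun f => by ext; simp
      right_inv := fun f => by ext; simp }

theorem autCard_congr (e : A ≃ₗ[S] A') : autCard S A = autCard S A' := equivCard_congr e e

/-- The quotient isomorphism induced by an isomorphism of the ambient modules. -/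
theorem nonempty_quot_map_equiv (e : M ≃ₗ[S] M') (U : Submodule S M) :
    Nonempty ((M ⧸ U) ≃ₗ[S] (M' ⧸ U.map e.toLinearMap)) :=
  ⟨Submodule.Quotient.equiv U (U.map e.toLinearMap) e rfl⟩

theorem hallCard_congr (e : M ≃ₗ[S] M') (eA : A ≃ₗ[S] A') (eC : C ≃ₗ[S] C') :
    hallCard S A M C = hallCard S A' M' C' := by
  refine Nat.card_congr ((Submodule.orderIsoMapComap e).toEquiv.subtypeEquiv fun U => ?_)
  have e1 : U ≃ₗ[S] U.map e.toLinearMap := e.submoduleMap U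
  obtain ⟨e2⟩ := nonempty_quot_map_equiv e U
  change _ ↔ Nonempty ((U.map e.toLinearMap) ≃ₗ[S] A') ∧
    Nonempty ((M' ⧸ U.map e.toLinearMap) ≃ₗ[S] C')
  constructor
  · rintro ⟨⟨f⟩, ⟨g⟩⟩
    exact ⟨⟨e1.symm ≪≫ₗ f ≪≫ₗ eA⟩, ⟨e2.symm ≪≫ₗ g ≪≫ₗ eC⟩⟩
  · rintro ⟨⟨f⟩, ⟨g⟩⟩
    exact ⟨⟨e1 ≪≫ₗ f ≪≫ₗ eA.symm⟩, ⟨e2 ≪≫ₗ g ≪≫ₗ eC.symm⟩⟩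

theorem card_submodule_mul_quotient (U : Submodule S M) :
    Nat.card M = Nat.card U * Nat.card (M ⧸ U) := by
  exact U.card_eq_card_quotient_mul_card

/-! ### Inequalities for the number of homomorphisms -/

section Hom

variable [Finite M] [Finite T]

/-- Left exactness of Hom(T, -): a map that dies in M/U takes values in U. -/
theorem hom_le_mul (U : Submodule S M) :
    Nat.card (T →ₗ[S] M) ≤ Nat.card (T →ₗ[S] U) * Nat.card (T →ₗ[S] (M ⧸ U)) := by
  let f : (T →ₗ[S] M) →+ (T →ₗ[S] (M ⧸ U)) :=
    { toFun := fun g => U.mkQ ∘ₗ g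
      map_zero' := by ext; simp
      map_add' := fun a b => by ext; simp }
  have hk : ∀ g : f.ker, ∀ t, g.1 t ∈ U := fun g t => by
    have := DFunLike.congr_fun (show U.mkQ ∘ₗ g.1 = 0 from g.2) t
    simpa using this
  refine card_le_mul_of_addMonoidHom f (fun g => LinearMap.codRestrict U g.1 (hk g)) ?_
  intro a b hab
  ext t
  exact congrArg Subtype.val (DFunLike.congr_fun hab t)

theorem hom_submodule_le (U : Submodule S M) :
    Nat.card (T →ₗ[S] U) ≤ Nat.card (T →ₗ[S] M) :=
  Nat.card_le_card_of_injective (fun g => U.subtype ∘ₗ g) fun a b hab => by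
    ext t; exact DFunLike.congr_fun hab t

theorem quotient_hom_le (U : Submodule S M) :
    Nat.card ((M ⧸ U) →ₗ[S] T) ≤ Nat.card (M →ₗ[S] T) :=
  Nat.card_le_card_of_injective (fun g => g ∘ₗ U.mkQ) fun a b hab => by
    ext t; exact DFunLike.congr_fun hab t

/-- Restriction of homomorphisms to a submodule. -/
def restrictHom (U : Submodule S M) (T : Type*) [AddCommGroup T] [Module S T] :
    (M →ₗ[S] T) →+ (U →ₗ[S] T) where
  toFun g := g ∘ₗ U.subtype
  map_zero' := by ext; simp
  map_add' a b := by ext; simp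

theorem exists_ker_restrictHom (U : Submodule S M) :
    ∃ e : (restrictHom U T).ker → ((M ⧸ U) →ₗ[S] T), Function.Injective e := by
  have hk : ∀ g : (restrictHom U T).ker, U ≤ LinearMap.ker g.1 := fun g t ht => by
    have := DFunLike.congr_fun (show g.1 ∘ₗ U.subtype = 0 from g.2) ⟨t, ht⟩
    simpa using this
  refine ⟨fun g => U.liftQ g.1 (hk g), fun a b hab => ?_⟩
  ext t
  simpa using DFunLike.congr_fun hab (U.mkQ t)

theorem hom_le_mul' (U : Submodule S M) :
    Nat.card (M →ₗ[S] T) ≤ Nat.card ((M ⧸ U) →ₗ[S] T) * Nat.card (U →ₗ[S] T) := by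
  obtain ⟨e, he⟩ := exists_ker_restrictHom (T := T) U
  exact card_le_mul_of_addMonoidHom _ e he

/-- The sequence 0 → Hom(M/U, T) → Hom(M, T) → Hom(U, T) is exact, and the assumed bound on the
orders makes the last map onto: every map from U extends to M. -/
theorem restrictHom_surjective (U : Submodule S M)
    (h : Nat.card ((M ⧸ U) →ₗ[S] T) * Nat.card (U →ₗ[S] T) ≤ Nat.card (M →ₗ[S] T)) :
    Function.Surjective (restrictHom U T) := by
  obtain ⟨e, he⟩ := exists_ker_restrictHom (T := T) U
  exact surjective_of_card_le_mul _ e he h Nat.card_pos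

/-- Maps to `U` extend along a surjection's factorization as soon as they do for maps to `M`. -/
theorem hom_eq_of_surjective [Finite A] [Finite C] {p : A →ₗ[S] C} (hp : Function.Surjective p)
    (h : Nat.card (A →ₗ[S] M) = Nat.card (C →ₗ[S] M)) (U : Submodule S M) :
    Nat.card (A →ₗ[S] U) = Nat.card (C →ₗ[S] U) := by
  have hinj : ∀ N : Type _, ∀ [AddCommGroup N], ∀ [Module S N],
      Function.Injective (fun g : C →ₗ[S] N => g ∘ₗ p) := fun N _ _ a b hab => by
    ext t; obtain ⟨s, rfl⟩ := hp t; exact DFunLike.congr_fun hab s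
  -- Equal finite orders make the injection g ↦ g ∘ p bijective, so every map from A to M factors
  -- through p. The factor of a map with values in U has values in U, since p is onto.
  have hb : Function.Bijective (fun g : C →ₗ[S] M => g ∘ₗ p) :=
    (Nat.bijective_iff_injective_and_card _).2 ⟨hinj M, h.symm⟩
  refine (Nat.card_congr (Equiv.ofBijective (fun g : C →ₗ[S] U => g ∘ₗ p) ⟨?_, ?_⟩)).symm
  · intro a b hab
    ext t; obtain ⟨s, rfl⟩ := hp t; exact congrArg Subtype.val (DFunLike.congr_fun hab s)
  · intro g
    obtain ⟨g', hg'⟩ := hb.2 (U.subtype ∘ₗ g)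
    have h1 : ∀ s, g' (p s) = g s := fun s => DFunLike.congr_fun hg' s
    refine ⟨LinearMap.codRestrict U g' fun c => ?_, ?_⟩
    · obtain ⟨s, rfl⟩ := hp c
      rw [h1]; exact (g s).2
    · ext s; exact h1 s

end Hom

/-! ### Split submodules -/

/-- By left exactness |End M| ≤ |Hom(M, U)|·|Hom(M, M/U)|, and each factor is at most its value with
U ⊕ M/U as source. If |End M| reaches |End(U ⊕ M/U)| these bounds are sharp, so Hom(M, U) → Hom(U,
U) is onto, and a preimage of the identity is a retraction. -/
theorem exists_retraction_of_card_le [Finite M] (U : Submodule S M)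
    (h : Nat.card ((U × (M ⧸ U)) →ₗ[S] (U × (M ⧸ U))) ≤ Nat.card (M →ₗ[S] M)) :
    ∃ r : M →ₗ[S] U, ∀ x : U, r x = x := by
  have e1 : Nat.card ((U × (M ⧸ U)) →ₗ[S] (U × (M ⧸ U))) =
      (Nat.card (U →ₗ[S] U) * Nat.card (U →ₗ[S] (M ⧸ U))) *
      (Nat.card ((M ⧸ U) →ₗ[S] U) * Nat.card ((M ⧸ U) →ₗ[S] (M ⧸ U))) := by
    rw [← Nat.card_prod, ← Nat.card_prod, ← Nat.card_prod]
    refine Nat.card_congr ?_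
    refine (LinearMap.coprodEquiv ℕ).symm.toEquiv.trans ?_
    exact Equiv.prodCongr (LinearMap.prodEquiv ℕ).symm.toEquiv (LinearMap.prodEquiv ℕ).symm.toEquiv
  have h1 := hom_le_mul (T := M) U
  have h2 := hom_le_mul' (T := M ⧸ U) U
  have h3 : Nat.card ((M ⧸ U) →ₗ[S] U) * Nat.card (U →ₗ[S] U) ≤ Nat.card (M →ₗ[S] U) := by
    have hpos : 0 < Nat.card (U →ₗ[S] (M ⧸ U)) * Nat.card ((M ⧸ U) →ₗ[S] (M ⧸ U)) :=
      Nat.mul_pos Nat.card_pos Nat.card_pos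
    refine Nat.le_of_mul_le_mul_right ?_ hpos
    rw [e1] at h
    nlinarith [Nat.mul_le_mul_left (Nat.card (M →ₗ[S] U)) h2]
  obtain ⟨r, hr⟩ := restrictHom_surjective U h3 LinearMap.id
  exact ⟨r, fun x => DFunLike.congr_fun hr x⟩

/-- A submodule with a retraction is a direct summand. -/
theorem nonempty_prod_equiv_of_retraction (U : Submodule S M) (r : M →ₗ[S] U)
    (hr : ∀ x : U, r x = x) : ∃ e : (U × (M ⧸ U)) ≃ₗ[S] M, ∀ x : U, e (x, 0) = x := by
  let f : M →ₗ[S] (U × (M ⧸ U)) := r.prod U.mkQ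
  have hb : Function.Bijective f := by
    constructor
    · rw [← LinearMap.ker_eq_bot, LinearMap.ker_eq_bot']
      intro m hm
      have h1 : r m = 0 := congrArg Prod.fst hm
      have h2 : U.mkQ m = 0 := congrArg Prod.snd hm
      have h3 : m ∈ U := by simpa using h2
      have := hr ⟨m, h3⟩
      simp only [h1] at this
      exact (congrArg Subtype.val this).symm
    · rintro ⟨x, y⟩
      obtain ⟨m, rfl⟩ := U.mkQ_surjective y
      refine ⟨m - r m + x, ?_⟩
      refine Prod.ext ?_ ?_
      · change r (m - r m + x) = x
        rw [map_add, map_sub, hr, hr]; simp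
      · change U.mkQ (m - r m + x) = U.mkQ m
        rw [← sub_eq_zero, ← map_sub, Submodule.mkQ_apply, Submodule.Quotient.mk_eq_zero]
        have : m - (r m : M) + x - m = x - r m := by abel
        rw [this]
        exact U.sub_mem x.2 (r m).2
  refine ⟨(LinearEquiv.ofBijective f hb).symm, fun x => ?_⟩
  rw [LinearEquiv.symm_apply_eq]
  refine Prod.ext (hr x).symm ?_
  change 0 = U.mkQ x
  exact ((Submodule.Quotient.mk_eq_zero U).2 x.2).symm

/-! ### Counting injections and surjections -/

/-- Injections with cokernel `C`. -/
abbrev InjWith (S : Type*) [Ring S] (A M C : Type*) [AddCommGroup A] [Module S A] [AddCommGroup M]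
    [Module S M] [AddCommGroup C] [Module S C] : Type _ :=
  {i : A →ₗ[S] M // Function.Injective i ∧ Nonempty ((M ⧸ LinearMap.range i) ≃ₗ[S] C)}

/-- An injection amounts to its image and an isomorphism onto the image. -/
def injEquiv (P : Submodule S M → Prop) :
    {i : A →ₗ[S] M // Function.Injective i ∧ P (LinearMap.range i)} ≃
      Σ U : {U : Submodule S M // Nonempty (U ≃ₗ[S] A) ∧ P U}, (A ≃ₗ[S] U.1) where
  toFun i := ⟨⟨LinearMap.range i.1, ⟨(LinearEquiv.ofInjective i.1 i.2.1).symm⟩, i.2.2⟩,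
    LinearEquiv.ofInjective i.1 i.2.1⟩
  invFun x := ⟨x.1.1.subtype ∘ₗ x.2.toLinearMap, by
    simpa using x.2.injective, by
    rw [LinearMap.range_comp, LinearEquiv.range, Submodule.map_top, Submodule.range_subtype]
    exact x.1.2.2⟩
  left_inv i := by ext; rfl
  right_inv := by
    rintro ⟨⟨U, hU, hP⟩, e⟩
    have h : LinearMap.range (U.subtype ∘ₗ e.toLinearMap) = U := by
      rw [LinearMap.range_comp, LinearEquiv.range, Submodule.map_top, Submodule.range_subtype]
    refine Sigma.ext (Subtype.ext h) ?_
    have key : ∀ (V : Submodule S M) (hV : V = U) (e' : A ≃ₗ[S] V)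
        (_ : ∀ a, (e' a : M) = e a), e' ≍ e := by
      rintro V rfl e' he
      refine heq_of_eq ?_
      ext a; exact he a
    exact key _ h _ fun a => rfl

theorem card_injWith [Finite A] [Finite M] (P : Submodule S M → Prop) :
    Nat.card {i : A →ₗ[S] M // Function.Injective i ∧ P (LinearMap.range i)} =
      Nat.card {U : Submodule S M // Nonempty (U ≃ₗ[S] A) ∧ P U} * autCard S A := by
  rw [Nat.card_congr (injEquiv P)]
  refine card_sigma_const _ fun U => ?_
  obtain ⟨e⟩ := U.2.1
  exact equivCard_congr (LinearEquiv.refl S A) e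

/-- A surjection amounts to its kernel and an isomorphism from the quotient. -/
def surjEquiv (P : Submodule S M → Prop) :
    {p : M →ₗ[S] C // Function.Surjective p ∧ P (LinearMap.ker p)} ≃
      Σ U : {U : Submodule S M // Nonempty ((M ⧸ U) ≃ₗ[S] C) ∧ P U}, ((M ⧸ U.1) ≃ₗ[S] C) where
  toFun p := ⟨⟨LinearMap.ker p.1, ⟨p.1.quotKerEquivOfSurjective p.2.1⟩, p.2.2⟩,
    p.1.quotKerEquivOfSurjective p.2.1⟩
  invFun x := ⟨x.2.toLinearMap ∘ₗ x.1.1.mkQ, by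
    rw [LinearMap.coe_comp]
    exact x.2.surjective.comp x.1.1.mkQ_surjective, by
    rw [LinearEquiv.ker_comp, Submodule.ker_mkQ]
    exact x.1.2.2⟩
  left_inv p := by ext; rfl
  right_inv := by
    rintro ⟨⟨U, hU, hP⟩, e⟩
    have h : LinearMap.ker (e.toLinearMap ∘ₗ U.mkQ) = U := by
      rw [LinearEquiv.ker_comp, Submodule.ker_mkQ]
    refine Sigma.ext (Subtype.ext h) ?_
    have key : ∀ (V : Submodule S M) (hV : V = U) (e' : (M ⧸ V) ≃ₗ[S] C)
        (_ : ∀ a, e' (V.mkQ a) = e (U.mkQ a)), e' ≍ e := by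
      rintro V rfl e' he
      refine heq_of_eq ?_
      ext a
      obtain ⟨a, rfl⟩ := V.mkQ_surjective a
      exact he a
    exact key _ h _ fun a => rfl

theorem card_surjWith [Finite C] [Finite M] (P : Submodule S M → Prop) :
    Nat.card {p : M →ₗ[S] C // Function.Surjective p ∧ P (LinearMap.ker p)} =
      Nat.card {U : Submodule S M // Nonempty ((M ⧸ U) ≃ₗ[S] C) ∧ P U} * autCard S C := by
  rw [Nat.card_congr (surjEquiv P)]
  refine card_sigma_const _ fun U => ?_
  obtain ⟨e⟩ := U.2.1
  exact equivCard_congr e (LinearEquiv.refl S C)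

/-- The automorphisms of `A × C` that fix `A` pointwise. -/
def fixEquiv : {θ : (A × C) ≃ₗ[S] (A × C) // ∀ a, θ (a, 0) = (a, 0)} ≃
    (C →ₗ[S] A) × (C ≃ₗ[S] C) where
  toFun θ := ⟨LinearMap.fst S A C ∘ₗ θ.1.toLinearMap ∘ₗ LinearMap.inr S A C,
    LinearEquiv.ofLinearMap (LinearMap.snd S A C ∘ₗ θ.1.toLinearMap ∘ₗ LinearMap.inr S A C)
      (LinearMap.snd S A C ∘ₗ θ.1.symm.toLinearMap ∘ₗ LinearMap.inr S A C)
      (by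
        ext c
        have h1 : ((θ.1.symm (0, c)).1, (θ.1.symm (0, c)).2) = θ.1.symm (0, c) := rfl
        have h2 : θ.1 (0, (θ.1.symm (0, c)).2) = (0, c) - ((θ.1.symm (0, c)).1, 0) := by
          rw [← θ.2, eq_sub_iff_add_eq, ← map_add]; simp
        simp [h2])
      (by
        ext c
        have h2 : ∀ a, θ.1.symm (a, 0) = (a, 0) := fun a => by
          rw [LinearEquiv.symm_apply_eq, θ.2]
        have h3 : θ.1.symm (0, (θ.1 (0, c)).2) = (0, c) - ((θ.1 (0, c)).1, 0) := by
          rw [← h2, eq_sub_iff_add_eq, ← map_add]; simp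
        simp [h3])⟩
  invFun x := ⟨LinearEquiv.ofLinearMap
      ((LinearMap.fst S A C + x.1 ∘ₗ LinearMap.snd S A C).prod
        (x.2.toLinearMap ∘ₗ LinearMap.snd S A C))
      ((LinearMap.fst S A C - x.1 ∘ₗ x.2.symm.toLinearMap ∘ₗ LinearMap.snd S A C).prod
        (x.2.symm.toLinearMap ∘ₗ LinearMap.snd S A C))
      (by ext <;> simp) (by ext <;> simp), fun a => by simp⟩
  left_inv θ := by
    ext ⟨a, c⟩
    · have : θ.1 (a, c) = (a, 0) + θ.1 (0, c) := by rw [← θ.2, ← map_add]; simp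
      simp [this]
    · have : θ.1 (a, c) = (a, 0) + θ.1 (0, c) := by rw [← θ.2, ← map_add]; simp
      simp [this]
  right_inv x := by
    ext <;> simp

/-- Aut(A × C) acts on the embeddings A → A × C with cokernel C. Each of them splits by
`exists_retraction_of_card_le`, so the action is transitive; the stabilizer of the standard
embedding is computed in `fixEquiv`. -/
theorem autCard_prod [Finite A] [Finite C] :
    autCard S (A × C) =
      hallCard S A (A × C) C * autCard S A * (Nat.card (C →ₗ[S] A) * autCard S C) := by
  rw [hallCard, ← card_injWith, autCard, autCard, ← Nat.card_prod, ← Nat.card_prod,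
    ← Nat.card_congr (Equiv.prodCongrRight fun _ => fixEquiv (S := S) (A := A) (C := C))]
  have hsplit : ∀ i : InjWith S A (A × C) C, ∃ ψ : (A × C) ≃ₗ[S] (A × C), ∀ a, ψ (a, 0) = i.1 a := by
    rintro ⟨i, hi, ⟨e⟩⟩
    let ei := LinearEquiv.ofInjective i hi
    let E : (LinearMap.range i × ((A × C) ⧸ LinearMap.range i)) ≃ₗ[S] (A × C) :=
      ei.symm.prodCongr e
    obtain ⟨r, hr⟩ := exists_retraction_of_card_le (LinearMap.range i) (homCard_congr E E).le
    obtain ⟨f, hf⟩ := nonempty_prod_equiv_of_retraction _ r hr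
    refine ⟨E.symm ≪≫ₗ f, fun a => ?_⟩
    have : E.symm (a, 0) = (ei a, 0) := by
      rw [LinearEquiv.symm_apply_eq]; simp [E]
    simp [this, hf, ei]
  choose Ψ hΨ using hsplit
  refine Nat.card_congr ?_
  -- Ψ extends each embedding to an automorphism, so an automorphism is the pair of its restriction
  -- to A and the correcting element of the stabilizer.
  refine Equiv.ofBijective
    (fun ψ => (⟨ψ.toLinearMap ∘ₗ LinearMap.inl S A C, ?_, ?_⟩, ⟨ψ ≪≫ₗ (Ψ ⟨ψ.toLinearMap ∘ₗ LinearMap.inl S A C, ?_, ?_⟩).symm, ?_⟩)) ⟨?_, ?_⟩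
  · simpa using! (LinearMap.inl_injective : Function.Injective (LinearMap.inl S A C))
  · rw [LinearMap.range_comp]
    obtain ⟨e⟩ := nonempty_quot_map_equiv ψ (LinearMap.range (LinearMap.inl S A C))
    refine ⟨e.symm ≪≫ₗ Submodule.quotEquivOfEq _ _ (LinearMap.range_inl S A C) ≪≫ₗ
      (LinearMap.snd S A C).quotKerEquivOfSurjective LinearMap.snd_surjective⟩
  · simpa using! (LinearMap.inl_injective : Function.Injective (LinearMap.inl S A C))
  · rw [LinearMap.range_comp]
    obtain ⟨e⟩ := nonempty_quot_map_equiv ψ (LinearMap.range (LinearMap.inl S A C))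
    refine ⟨e.symm ≪≫ₗ Submodule.quotEquivOfEq _ _ (LinearMap.range_inl S A C) ≪≫ₗ
      (LinearMap.snd S A C).quotKerEquivOfSurjective LinearMap.snd_surjective⟩
  · intro a
    rw [LinearEquiv.trans_apply, LinearEquiv.symm_apply_eq, hΨ]; simp
  · intro ψ ψ' h
    have h1 := congrArg (fun x => x.1) h
    have h2 := congrArg (fun x => x.2.1) h
    simp only at h1 h2
    rw [h1] at h2
    ext x : 1
    have := DFunLike.congr_fun h2 x
    simpa using this
  · rintro ⟨i, θ⟩
    refine ⟨θ.1 ≪≫ₗ Ψ i, ?_⟩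
    have h1 : (θ.1 ≪≫ₗ Ψ i).toLinearMap ∘ₗ LinearMap.inl S A C = i.1 := by
      refine LinearMap.ext fun a => ?_
      simp [θ.2, hΨ]
    refine Prod.ext (Subtype.ext h1) (Subtype.ext ?_)
    simp only [h1]
    ext x : 1
    simp

end Modules

attribute [local instance] finite_hom finite_equiv finite_quotient

/-! ### Additive functions of multiplicities -/

section Weights

variable {ι : Type} [Fintype ι]

/-- The additive extension of a function on the index set to multiplicity functions. -/
def wt (g : ι → ℕ) (a : ι → ℕ) : ℕ := ∑ i, a i * g i

theorem wt_add (g : ι → ℕ) (a b : ι → ℕ) : wt g (a + b) = wt g a + wt g b := by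
  simp [wt, add_mul, Finset.sum_add_distrib]

theorem wt_single [DecidableEq ι] (g : ι → ℕ) (i : ι) : wt g (Pi.single i 1) = g i := by
  rw [wt, Finset.sum_eq_single i] <;> simp +contextual

theorem le_wt {g : ι → ℕ} (hg : ∀ i, 0 < g i) (a : ι → ℕ) (i : ι) : a i ≤ wt g a := by
  refine le_trans ?_ (Finset.single_le_sum (f := fun i => a i * g i)
    (fun j _ => Nat.zero_le _) (Finset.mem_univ i))
  exact Nat.le_mul_of_pos_right _ (hg i)

/-- The bilinear extension of a matrix to multiplicity functions. -/
def wt₂ (h : ι → ι → ℕ) (a b : ι → ℕ) : ℕ := wt (fun i => wt (h i) b) a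

theorem wt₂_single_left [DecidableEq ι] (h : ι → ι → ℕ) (i : ι) (b : ι → ℕ) :
    wt₂ h (Pi.single i 1) b = wt (h i) b := wt_single _ _

end Weights

/-! ### Complete families of indecomposables and Krull–Schmidt uniqueness -/

section System

/-- The direct sum of copies of the modules of a finite family. -/
abbrev MSum {ι : Type} (X : ι → Type u) (a : ι → ℕ) : Type u := ∀ i, Fin (a i) → X i

variable {S : Type*} [Ring S] {ι : Type} {X : ι → Type u} [∀ i, AddCommGroup (X i)]
  [∀ i, Module S (X i)]

/-- The direct sum for a sum of multiplicity functions. -/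
def mSumAdd (a b : ι → ℕ) : MSum X (a + b) ≃ₗ[S] (MSum X a × MSum X b) where
  toFun v := (fun i j => v i (Fin.castAdd (b i) j), fun i j => v i (Fin.natAdd (a i) j))
  invFun v := fun i => Fin.append (v.1 i) (v.2 i)
  map_add' v v' := rfl
  map_smul' s v := rfl
  left_inv v := by
    funext i
    exact Fin.append_castAdd_natAdd
  right_inv v := by
    refine Prod.ext ?_ ?_
    · funext i j; exact Fin.append_left _ _ _
    · funext i j; exact Fin.append_right _ _ _

theorem subsingleton_mSum_zero : Subsingleton (MSum X (0 : ι → ℕ)) :=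
  ⟨fun v v' => by funext i j; exact j.elim0⟩

variable [Fintype ι] [DecidableEq ι]

/-- The direct sum with a single summand. -/
theorem nonempty_mSumSingle (i : ι) : Nonempty (MSum X (Pi.single i 1) ≃ₗ[S] X i) := by
  have hi : (Pi.single i 1 : ι → ℕ) i = 1 := Pi.single_eq_same i 1
  let j0 : Fin ((Pi.single i 1 : ι → ℕ) i) := ⟨0, by rw [hi]; exact one_pos⟩
  let f : MSum X (Pi.single i 1) →ₗ[S] X i := LinearMap.proj j0 ∘ₗ LinearMap.proj i
  refine ⟨LinearEquiv.ofBijective f ⟨?_, ?_⟩⟩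
  · intro v v' h
    funext k j
    by_cases hk : k = i
    · subst hk
      have : j = j0 := by
        apply Fin.ext
        have := j.2
        simp only [hi] at this
        simp only [j0]; omega
      rw [this]; exact h
    · exact absurd j.2 (by simp [Pi.single_eq_of_ne hk])
  · intro x
    refine ⟨Pi.single i (fun _ => x), ?_⟩
    simp [f]

theorem card_pi_hom {κ : Type*} [Fintype κ] {A : κ → Type*} [∀ k, AddCommGroup (A k)]
    [∀ k, Module S (A k)] {M : Type*} [AddCommGroup M] [Module S M] :
    Nat.card ((∀ k, A k) →ₗ[S] M) = ∏ k, Nat.card (A k →ₗ[S] M) := by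
  classical
  rw [← Nat.card_pi]
  exact Nat.card_congr (LinearMap.lsum S A ℕ).symm.toEquiv

/-- Homomorphisms to a product. -/
def homPiEquiv {κ : Type*} {A : κ → Type*} [∀ k, AddCommGroup (A k)]
    [∀ k, Module S (A k)] {M : Type*} [AddCommGroup M] [Module S M] :
    (M →ₗ[S] (∀ k, A k)) ≃ (∀ k, M →ₗ[S] A k) where
  toFun f k := LinearMap.proj k ∘ₗ f
  invFun f := LinearMap.pi f
  left_inv _ := rfl
  right_inv _ := rfl

variable (S X)

/-- A finite family of modules over `S` which is a complete list of the indecomposable finite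
modules, with dimensions `d` and with dimensions `h` of the homomorphism spaces, over a field with
`q` elements. -/
structure Sys (q : ℕ) (d : ι → ℕ) (h : ι → ι → ℕ) : Prop where
  one_lt : 1 < q
  card : ∀ i, Nat.card (X i) = q ^ d i
  d_pos : ∀ i, 0 < d i
  card_hom : ∀ i j, Nat.card (X i →ₗ[S] X j) = q ^ h i j
  complete : ∀ (M : Type u) [AddCommGroup M] [Module S M] [Finite M],
    ∃ a, Nonempty (M ≃ₗ[S] MSum X a)
  indec : ∀ i a, Nonempty (X i ≃ₗ[S] MSum X a) → a = Pi.single i 1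
  nonunits : ∀ i, ∃ N : AddSubgroup (X i →ₗ[S] X i),
    (∀ φ, φ ∈ N ↔ ¬ Function.Bijective φ) ∧ Nat.card N * q = q ^ h i i

variable {S X}

variable {q : ℕ} {d : ι → ℕ} {h : ι → ι → ℕ}

namespace Sys

theorem q_pos (σ : Sys S X q d h) : 0 < q := zero_lt_one.trans σ.one_lt

theorem pow_inj (σ : Sys S X q d h) {m n : ℕ} (hmn : q ^ m = q ^ n) : m = n :=
  Nat.pow_right_injective σ.one_lt hmn

theorem finite (σ : Sys S X q d h) (i : ι) : Finite (X i) :=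
  Nat.finite_of_card_ne_zero (by rw [σ.card]; exact (pow_pos σ.q_pos _).ne')

theorem finite_mSum (σ : Sys S X q d h) (a : ι → ℕ) : Finite (MSum X a) := by
  have := σ.finite
  infer_instance

theorem card_mSum (σ : Sys S X q d h) (a : ι → ℕ) : Nat.card (MSum X a) = q ^ wt d a := by
  rw [Nat.card_pi, wt, ← Finset.prod_pow_eq_pow_sum]
  refine Finset.prod_congr rfl fun i _ => ?_
  rw [Nat.card_pi]
  simp [σ.card, mul_comm (a i), pow_mul]

theorem card_hom_mSum (σ : Sys S X q d h) (a b : ι → ℕ) :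
    Nat.card (MSum X a →ₗ[S] MSum X b) = q ^ wt₂ h a b := by
  have h1 : ∀ i, Nat.card (X i →ₗ[S] MSum X b) = q ^ wt (h i) b := fun i => by
    rw [Nat.card_congr homPiEquiv, Nat.card_pi, wt, ← Finset.prod_pow_eq_pow_sum]
    refine Finset.prod_congr rfl fun j _ => ?_
    rw [Nat.card_congr homPiEquiv, Nat.card_pi]
    simp [σ.card_hom, mul_comm (b j), pow_mul]
  rw [card_pi_hom, wt₂, wt, ← Finset.prod_pow_eq_pow_sum]
  refine Finset.prod_congr rfl fun i _ => ?_
  rw [card_pi_hom]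
  simp [h1, mul_comm (a i), pow_mul]

/-- If r ∘ s is bijective, X_i is a direct summand of X_j. The complement has a decomposition by
completeness, and indecomposability of X_j forces it to be zero. -/
theorem eq_of_split (σ : Sys S X q d h) {i j : ι} (s : X i →ₗ[S] X j) (r : X j →ₗ[S] X i)
    (hrs : Function.Bijective (r ∘ₗ s)) : i = j ∧ Function.Bijective s := by
  have := σ.finite
  have hs : Function.Injective s := fun x y hxy => hrs.1 (by simp [hxy])
  let e := LinearEquiv.ofBijective (r ∘ₗ s) hrs
  let es := LinearEquiv.ofInjective s hs
  obtain ⟨f, -⟩ := nonempty_prod_equiv_of_retraction (LinearMap.range s)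
    (es.toLinearMap ∘ₗ e.symm.toLinearMap ∘ₗ r) (by
      rintro ⟨_, x, rfl⟩
      have : e.symm (r (s x)) = x := by rw [LinearEquiv.symm_apply_eq]; rfl
      simp only [LinearMap.comp_apply, LinearEquiv.coe_coe, this]
      rfl)
  obtain ⟨c, ⟨g⟩⟩ := σ.complete (X j ⧸ LinearMap.range s)
  obtain ⟨t⟩ := nonempty_mSumSingle (S := S) (X := X) i
  have hj := σ.indec j (Pi.single i 1 + c)
    ⟨f.symm ≪≫ₗ (es.symm ≪≫ₗ t.symm).prodCongr g ≪≫ₗ (mSumAdd _ _).symm⟩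
  have hij : i = j := by
    by_contra hne
    have := congrFun hj i
    rw [Pi.add_apply, Pi.single_eq_same, Pi.single_eq_of_ne hne] at this
    omega
  subst hij
  exact ⟨rfl, Finite.injective_iff_bijective.mp hs⟩

/-- A retraction writes the identity of X_i as a sum of endomorphisms that pass through single
summands. Nonunits form a group, so one of these is a unit, and by `eq_of_split` it passes
isomorphically through a copy of X_i. -/
theorem exists_retraction_iff (σ : Sys S X q d h) {i : ι} {a : ι → ℕ} (φ : X i →ₗ[S] MSum X a) :
    (∃ r : MSum X a →ₗ[S] X i, r ∘ₗ φ = LinearMap.id) ↔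
      ∃ j, Function.Bijective (LinearMap.proj j ∘ₗ (LinearMap.proj i : MSum X a →ₗ[S] _) ∘ₗ φ) := by
  constructor
  · rintro ⟨r, hr⟩
    obtain ⟨N, hN, -⟩ := σ.nonunits i
    let ψ : ∀ k, Fin (a k) → (X i →ₗ[S] X i) := fun k j =>
      (r ∘ₗ LinearMap.single S (fun k => Fin (a k) → X k) k ∘ₗ LinearMap.single S (fun _ => X k) j) ∘ₗ
        (LinearMap.proj j ∘ₗ (LinearMap.proj k : MSum X a →ₗ[S] _) ∘ₗ φ)
    have hsum : ∑ k, ∑ j, ψ k j = LinearMap.id := by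
      rw [← hr]
      refine LinearMap.ext fun x => ?_
      have : φ x = ∑ k, Pi.single k (∑ j, Pi.single j (φ x k j)) := by
        simp only [Finset.univ_sum_single]
      have h2 : ∀ k, (Pi.single k (∑ j, Pi.single j (φ x k j)) : MSum X a) =
          ∑ j, Pi.single k (Pi.single j (φ x k j)) :=
        fun k => map_sum (LinearMap.single S (fun k => Fin (a k) → X k) k) _ _
      rw [LinearMap.comp_apply, this]
      simp [ψ, LinearMap.sum_apply, h2]
    by_contra hcon
    have hall : ∀ k j, ψ k j ∈ N := by
      intro k j
      rw [hN]
      intro hb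
      obtain ⟨rfl, hb'⟩ := σ.eq_of_split _ _ hb
      exact hcon ⟨j, hb'⟩
    have hid : (LinearMap.id : X i →ₗ[S] X i) ∈ N := by
      rw [← hsum]
      exact N.sum_mem fun k _ => N.sum_mem fun j _ => hall k j
    exact (hN _).1 hid Function.bijective_id
  · rintro ⟨j, hj⟩
    let e := LinearEquiv.ofBijective _ hj
    refine ⟨e.symm.toLinearMap ∘ₗ LinearMap.proj j ∘ₗ LinearMap.proj i, ?_⟩
    refine LinearMap.ext fun x => ?_
    exact e.symm_apply_apply x

/-- By `exists_retraction_iff` a map is non-split exactly when its a_i components in copies of X_i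
are nonunits. Each of these conditions divides the number of maps by q; the other components are
free. -/
theorem card_not_split (σ : Sys S X q d h) (i : ι) (a : ι → ℕ) :
    Nat.card {φ : X i →ₗ[S] MSum X a // ¬ ∃ r : MSum X a →ₗ[S] X i, r ∘ₗ φ = LinearMap.id} * q ^ a i =
      q ^ wt (h i) a := by
  obtain ⟨N, hN, hcard⟩ := σ.nonunits i
  let P : ∀ k, (X i →ₗ[S] X k) → Prop := fun k f => ∀ hk : k = i, ¬ Function.Bijective f
  have e : {φ : X i →ₗ[S] MSum X a // ¬ ∃ r : MSum X a →ₗ[S] X i, r ∘ₗ φ = LinearMap.id} ≃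
      ∀ k, Fin (a k) → {f : X i →ₗ[S] X k // P k f} :=
    { toFun := fun φ k j => ⟨LinearMap.proj j ∘ₗ LinearMap.proj k ∘ₗ φ.1, by
        rintro rfl hb
        exact φ.2 ((σ.exists_retraction_iff _).2 ⟨j, hb⟩)⟩
      invFun := fun f => ⟨LinearMap.pi fun k => LinearMap.pi fun j => (f k j).1, by
        rw [σ.exists_retraction_iff]
        rintro ⟨j, hj⟩
        exact (f i j).2 rfl hj⟩
      left_inv := fun φ => rfl
      right_inv := fun f => rfl }
  rw [Nat.card_congr e, Nat.card_pi, wt, ← Finset.prod_pow_eq_pow_sum,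
    ← Finset.mul_prod_erase _ _ (Finset.mem_univ i),
    ← Finset.mul_prod_erase (f := fun x => q ^ (a x * h i x)) _ (Finset.mem_univ i)]
  have h1 : Nat.card {f : X i →ₗ[S] X i // P i f} * q = q ^ h i i := by
    rw [← hcard]
    congr 1
    exact Nat.card_congr (Equiv.subtypeEquivRight fun φ => by simp [P, hN])
  have h2 : ∀ k ∈ Finset.univ.erase i, Nat.card (Fin (a k) → {f : X i →ₗ[S] X k // P k f}) =
      q ^ (a k * h i k) := by
    intro k hk
    have hk' : k ≠ i := Finset.ne_of_mem_erase hk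
    rw [Nat.card_pi, mul_comm, pow_mul, ← σ.card_hom]
    simp only [Finset.prod_const, Finset.card_univ, Fintype.card_fin]
    congr 1
    exact Nat.card_congr (Equiv.subtypeUnivEquiv fun f hk'' => absurd hk'' hk')
  rw [Finset.prod_congr rfl h2, Nat.card_pi]
  simp only [Finset.prod_const, Finset.card_univ, Fintype.card_fin]
  rw [mul_comm (a i) (h i i), pow_mul, ← h1, mul_pow]
  ring

/-- The multiplicity a_i is an invariant, as the non-split maps among all maps from X_i have
proportion q^{-a_i}. -/
theorem eq_of_equiv (σ : Sys S X q d h) {a b : ι → ℕ} (e : MSum X a ≃ₗ[S] MSum X b) : a = b := by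
  funext i
  have h1 := σ.card_not_split i a
  have h2 := σ.card_not_split i b
  have h3 : q ^ wt (h i) a = q ^ wt (h i) b := by
    rw [← wt₂_single_left, ← wt₂_single_left, ← σ.card_hom_mSum, ← σ.card_hom_mSum]
    exact homCard_congr (LinearEquiv.refl S _) e
  have h4 : Nat.card {φ : X i →ₗ[S] MSum X a // ¬ ∃ r : MSum X a →ₗ[S] X i, r ∘ₗ φ = LinearMap.id} =
      Nat.card {φ : X i →ₗ[S] MSum X b // ¬ ∃ r : MSum X b →ₗ[S] X i, r ∘ₗ φ = LinearMap.id} := by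
    refine Nat.card_congr (Equiv.subtypeEquiv
      { toFun := fun φ => e.toLinearMap ∘ₗ φ
        invFun := fun φ => e.symm.toLinearMap ∘ₗ φ
        left_inv := fun φ => by ext; simp
        right_inv := fun φ => by refine LinearMap.ext fun x => ?_; simp } fun φ => ?_)
    refine not_congr ⟨?_, ?_⟩
    · rintro ⟨r, hr⟩
      refine ⟨r ∘ₗ e.symm.toLinearMap, ?_⟩
      rw [← hr]; refine LinearMap.ext fun x => ?_; simp
    · rintro ⟨r, hr⟩
      exact ⟨r ∘ₗ e.toLinearMap, by rw [← hr]; rfl⟩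
  rw [← h3, ← h1, h4] at h2
  have h5 : 0 < Nat.card {φ : X i →ₗ[S] MSum X b // ¬ ∃ r : MSum X b →ₗ[S] X i, r ∘ₗ φ = LinearMap.id} := by
    rw [← h4]
    refine Nat.pos_of_ne_zero fun h0 => ?_
    rw [h0, zero_mul] at h1
    exact (pow_pos σ.q_pos _).ne h1
  exact (σ.pow_inj (Nat.eq_of_mul_eq_mul_left h5 h2)).symm

/-! ### The type of a finite module -/

/-- The multiplicity function of a finite module. -/
def ty (σ : Sys S X q d h) (M : Type u) [AddCommGroup M] [Module S M] [Finite M] :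
    ι → ℕ := (σ.complete M).choose

section

variable (σ : Sys S X q d h) {M M' : Type u} [AddCommGroup M] [Module S M] [Finite M]
  [AddCommGroup M'] [Module S M'] [Finite M']

theorem nonempty_equiv_ty : Nonempty (M ≃ₗ[S] MSum X (σ.ty M)) := (σ.complete M).choose_spec

theorem ty_eq_iff {a : ι → ℕ} : σ.ty M = a ↔ Nonempty (M ≃ₗ[S] MSum X a) := by
  obtain ⟨e⟩ := σ.nonempty_equiv_ty (M := M)
  constructor
  · rintro rfl; exact ⟨e⟩
  · rintro ⟨f⟩; exact σ.eq_of_equiv (e.symm ≪≫ₗ f)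

theorem ty_congr (e : M ≃ₗ[S] M') : σ.ty M = σ.ty M' := by
  obtain ⟨f⟩ := σ.nonempty_equiv_ty (M := M')
  exact σ.ty_eq_iff.2 ⟨e ≪≫ₗ f⟩

theorem ty_mSum (a : ι → ℕ) [Finite (MSum X a)] : σ.ty (MSum X a) = a :=
  σ.ty_eq_iff.2 ⟨LinearEquiv.refl S _⟩

theorem ty_X (i : ι) [Finite (X i)] : σ.ty (X i) = Pi.single i 1 := by
  obtain ⟨e⟩ := nonempty_mSumSingle (S := S) (X := X) i
  exact σ.ty_eq_iff.2 ⟨e.symm⟩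

theorem ty_prod : σ.ty (M × M') = σ.ty M + σ.ty M' := by
  obtain ⟨e⟩ := σ.nonempty_equiv_ty (M := M)
  obtain ⟨f⟩ := σ.nonempty_equiv_ty (M := M')
  exact σ.ty_eq_iff.2 ⟨e.prodCongr f ≪≫ₗ (mSumAdd _ _).symm⟩

theorem card_hom_ty : Nat.card (M →ₗ[S] M') = q ^ wt₂ h (σ.ty M) (σ.ty M') := by
  obtain ⟨e⟩ := σ.nonempty_equiv_ty (M := M)
  obtain ⟨f⟩ := σ.nonempty_equiv_ty (M := M')
  rw [homCard_congr e f, σ.card_hom_mSum]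

theorem card_ty : Nat.card M = q ^ wt d (σ.ty M) := by
  obtain ⟨e⟩ := σ.nonempty_equiv_ty (M := M)
  rw [Nat.card_congr e.toEquiv, σ.card_mSum]

theorem pow_le (σ : Sys S X q d h) {m n : ℕ} : q ^ m ≤ q ^ n ↔ m ≤ n :=
  Nat.pow_le_pow_iff_right σ.one_lt

theorem dim_add (U : Submodule S M) :
    wt d (σ.ty M) = wt d (σ.ty U) + wt d (σ.ty (M ⧸ U)) := by
  apply σ.pow_inj
  rw [pow_add, ← σ.card_ty, ← σ.card_ty, ← σ.card_ty]
  exact card_submodule_mul_quotient U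

theorem hom_le_add (U : Submodule S M) (t : ι → ℕ) :
    wt₂ h t (σ.ty M) ≤ wt₂ h t (σ.ty U) + wt₂ h t (σ.ty (M ⧸ U)) := by
  have := σ.finite_mSum t
  rw [← σ.pow_le, pow_add]
  have := hom_le_mul (T := MSum X t) U
  rwa [σ.card_hom_ty, σ.card_hom_ty, σ.card_hom_ty, σ.ty_mSum] at this

theorem hom_sub_le (U : Submodule S M) (t : ι → ℕ) :
    wt₂ h t (σ.ty U) ≤ wt₂ h t (σ.ty M) := by
  have := σ.finite_mSum t
  rw [← σ.pow_le]
  have := hom_submodule_le (T := MSum X t) U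
  rwa [σ.card_hom_ty, σ.card_hom_ty, σ.ty_mSum] at this

theorem quot_hom_le (U : Submodule S M) (t : ι → ℕ) :
    wt₂ h (σ.ty (M ⧸ U)) t ≤ wt₂ h (σ.ty M) t := by
  have := σ.finite_mSum t
  rw [← σ.pow_le]
  have := quotient_hom_le (T := MSum X t) U
  rwa [σ.card_hom_ty, σ.card_hom_ty, σ.ty_mSum] at this

/-- A submodule with |End(U ⊕ M/U)| ≤ |End M| splits off. The dimension of the endomorphism ring
thus serves as the induction measure that ranks a direct sum above all other middle terms. -/
theorem end_lt_of_ne (U : Submodule S M) (hne : σ.ty M ≠ σ.ty U + σ.ty (M ⧸ U)) :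
    wt₂ h (σ.ty M) (σ.ty M) <
      wt₂ h (σ.ty U + σ.ty (M ⧸ U)) (σ.ty U + σ.ty (M ⧸ U)) := by
  by_contra hcon
  rw [not_lt, ← σ.ty_prod, ← σ.pow_le, ← σ.card_hom_ty, ← σ.card_hom_ty] at hcon
  obtain ⟨r, hr⟩ := exists_retraction_of_card_le U hcon
  obtain ⟨e, -⟩ := nonempty_prod_equiv_of_retraction U r hr
  exact hne (by rw [← σ.ty_congr e, σ.ty_prod])

end

/-- The number of split embeddings of an indecomposable. -/
theorem hallCard_mul_autCard_single (σ : Sys S X q d h) (i : ι) (a : ι → ℕ) :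
    hallCard S (X i) (X i × MSum X a) (MSum X a) * autCard S (X i) =
      q ^ (h i i + wt (h i) a) - q ^ (h i i + wt (h i) a - (a i + 1)) := by
  have := σ.finite
  have := σ.finite_mSum
  obtain ⟨e⟩ := nonempty_mSumSingle (S := S) (X := X) i
  have hns := σ.card_not_split i (Pi.single i 1 + a)
  have h1 : hallCard S (X i) (X i × MSum X a) (MSum X a) =
      hallCard S (X i) (MSum X (Pi.single i 1 + a)) (MSum X a) :=
    hallCard_congr (e.symm.prodCongr (LinearEquiv.refl S _) ≪≫ₗ (mSumAdd _ _).symm)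
      (LinearEquiv.refl S _) (LinearEquiv.refl S _)
  have h2 : Nat.card (X i →ₗ[S] MSum X (Pi.single i 1 + a)) = q ^ (h i i + wt (h i) a) := by
    rw [σ.card_hom_ty, σ.ty_X, σ.ty_mSum, wt₂_single_left, wt_add, wt_single]
  have h3 : Nat.card {φ : X i →ₗ[S] MSum X (Pi.single i 1 + a) //
      ∃ r : MSum X (Pi.single i 1 + a) →ₗ[S] X i, r ∘ₗ φ = LinearMap.id} +
      Nat.card {φ : X i →ₗ[S] MSum X (Pi.single i 1 + a) //
      ¬ ∃ r : MSum X (Pi.single i 1 + a) →ₗ[S] X i, r ∘ₗ φ = LinearMap.id} =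
      q ^ (h i i + wt (h i) a) := by
    classical
    rw [← h2, ← Nat.card_sum]
    exact Nat.card_congr (Equiv.sumCompl _)
  rw [h1, hallCard, ← card_injWith]
  have h4 : Nat.card (InjWith S (X i) (MSum X (Pi.single i 1 + a)) (MSum X a)) =
      Nat.card {φ : X i →ₗ[S] MSum X (Pi.single i 1 + a) //
      ∃ r : MSum X (Pi.single i 1 + a) →ₗ[S] X i, r ∘ₗ φ = LinearMap.id} := by
    refine Nat.card_congr (Equiv.subtypeEquivRight fun φ => ⟨?_, ?_⟩)
    · rintro ⟨hi, hc⟩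
      let eφ := LinearEquiv.ofInjective φ hi
      have hty : σ.ty (MSum X (Pi.single i 1 + a)) =
          σ.ty (LinearMap.range φ × (MSum X (Pi.single i 1 + a) ⧸ LinearMap.range φ)) := by
        rw [σ.ty_prod, σ.ty_mSum, ← σ.ty_congr eφ, σ.ty_X, σ.ty_eq_iff.2 hc]
      -- Image and cokernel have the sum M itself as their direct sum, so the endomorphism counts
      -- agree and the embedding splits.
      obtain ⟨r, hr⟩ := exists_retraction_of_card_le (LinearMap.range φ) (by
        rw [σ.card_hom_ty, σ.card_hom_ty, ← hty])
      refine ⟨eφ.symm.toLinearMap ∘ₗ r, ?_⟩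
      refine LinearMap.ext fun x => ?_
      have : r (φ x) = eφ x := hr (eφ x)
      simp [this]
    · rintro ⟨r, hr⟩
      have hr' : ∀ x, r (φ x) = x := fun x => DFunLike.congr_fun hr x
      have hi : Function.Injective φ := Function.LeftInverse.injective hr'
      refine ⟨hi, ?_⟩
      let eφ := LinearEquiv.ofInjective φ hi
      obtain ⟨f, -⟩ := nonempty_prod_equiv_of_retraction (LinearMap.range φ)
        (eφ.toLinearMap ∘ₗ r) (by
          rintro ⟨_, x, rfl⟩
          simp only [LinearMap.comp_apply, LinearEquiv.coe_coe, hr']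
          rfl)
      have := σ.ty_congr f
      rw [σ.ty_prod, ← σ.ty_congr eφ, σ.ty_X, σ.ty_mSum] at this
      exact σ.ty_eq_iff.1 (add_left_cancel this)
  rw [h4]
  rw [Pi.add_apply, Pi.single_eq_same, wt_add, wt_single, add_comm 1 (a i)] at hns
  have hle : a i + 1 ≤ h i i + wt (h i) a := by
    rw [← σ.pow_le, ← hns]
    refine Nat.le_mul_of_pos_left _ (Nat.pos_of_ne_zero fun h0 => ?_)
    rw [h0, zero_mul] at hns
    exact (pow_pos σ.q_pos _).ne hns
  have h5 : Nat.card {φ : X i →ₗ[S] MSum X (Pi.single i 1 + a) //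
      ¬ ∃ r : MSum X (Pi.single i 1 + a) →ₗ[S] X i, r ∘ₗ φ = LinearMap.id} =
      q ^ (h i i + wt (h i) a - (a i + 1)) := by
    refine Nat.eq_of_mul_eq_mul_right (pow_pos σ.q_pos (a i + 1)) ?_
    rw [hns, ← pow_add, Nat.sub_add_cancel hle]
  omega

end Sys

end System

/-! ### The exact functor M ↦ εM of an idempotent -/

section Idempotent

variable {S : Type*} [Ring S] {M M' : Type*} [AddCommGroup M] [Module S M]
  [AddCommGroup M'] [Module S M']

/-- The subgroup `εM` for an idempotent `ε`. -/
def epart (ε : S) (M : Type*) [AddCommGroup M] [Module S M] : AddSubgroup M where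
  carrier := {v | ε • v = v}
  zero_mem' := smul_zero _
  add_mem' := fun {a b} ha hb => by
    change ε • (a + b) = a + b
    rw [smul_add, show ε • a = a from ha, show ε • b = b from hb]
  neg_mem' := fun {a} ha => by
    change ε • (-a) = -a
    rw [smul_neg, show ε • a = a from ha]

theorem mem_epart {ε : S} {v : M} : v ∈ epart ε M ↔ ε • v = v := Iff.rfl

theorem card_epart_congr (ε : S) (e : M ≃ₗ[S] M') :
    Nat.card (epart ε M) = Nat.card (epart ε M') :=
  Nat.card_congr (e.toEquiv.subtypeEquiv fun v => by
    simp only [mem_epart]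
    change _ ↔ ε • e v = e v
    rw [← map_smul, e.injective.eq_iff])

theorem card_epart_pi (ε : S) {κ : Type*} [Fintype κ] {A : κ → Type*} [∀ k, AddCommGroup (A k)]
    [∀ k, Module S (A k)] : Nat.card (epart ε (∀ k, A k)) = ∏ k, Nat.card (epart ε (A k)) := by
  rw [← Nat.card_pi]
  exact Nat.card_congr
    { toFun := fun v k => ⟨v.1 k, congrFun v.2 k⟩
      invFun := fun v => ⟨fun k => (v k).1, funext fun k => (v k).2⟩
      left_inv := fun v => rfl
      right_inv := fun v => rfl }

/-- Exactness: if the class of v is fixed by ε, then εv is a lift of it in εM. This makes dimension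
vectors additive. -/
theorem card_epart_submodule {ε : S} (hε : IsIdempotentElem ε) [Finite M] (U : Submodule S M) :
    Nat.card (epart ε M) = Nat.card (epart ε U) * Nat.card (epart ε (M ⧸ U)) := by
  let f : epart ε M →+ epart ε (M ⧸ U) :=
    { toFun := fun v => ⟨U.mkQ v.1, by
        rw [mem_epart, ← map_smul, show ε • v.1 = v.1 from v.2]⟩
      map_zero' := by simp
      map_add' := fun a b => by ext; simp }
  have hf : Function.Surjective f := by
    rintro ⟨x, hx⟩
    obtain ⟨v, rfl⟩ := U.mkQ_surjective x
    refine ⟨⟨ε • v, by rw [mem_epart, smul_smul, hε.eq]⟩, ?_⟩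
    ext
    exact (map_smul U.mkQ ε v).trans hx
  rw [← AddSubgroup.card_mul_index f.ker, AddSubgroup.index_ker,
    AddMonoidHom.range_eq_top.2 hf, AddSubgroup.card_top]
  congr 1
  refine Nat.card_congr
    { toFun := fun v => ⟨⟨v.1.1, ?_⟩, Subtype.ext v.1.2⟩
      invFun := fun v => ⟨⟨v.1.1, congrArg Subtype.val v.2⟩, ?_⟩
      left_inv := fun v => rfl
      right_inv := fun v => rfl }
  · have := congrArg Subtype.val (show f v.1 = 0 from v.2)
    exact (Submodule.Quotient.mk_eq_zero U).1 this
  · refine Subtype.ext ?_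
    exact (Submodule.Quotient.mk_eq_zero U).2 v.1.2

end Idempotent

/-! ### Summation over types in a finite box -/

section Group

theorem card_sigma_fiber {α κ : Type*} [Finite α] [DecidableEq κ] {β : α → Type*}
    [∀ a, Finite (β a)] (τ : α → κ) (B : Finset κ) (hB : ∀ a, τ a ∈ B) (f : κ → ℕ)
    (hf : ∀ a, Nat.card (β a) = f (τ a)) :
    Nat.card (Sigma β) = ∑ t ∈ B, Nat.card {a // τ a = t} * f t := by
  have := Fintype.ofFinite α
  rw [Nat.card_sigma, ← Finset.sum_fiberwise_of_maps_to (g := τ) (t := B) fun a _ => hB a]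
  refine Finset.sum_congr rfl fun t _ => ?_
  rw [Finset.sum_congr rfl (g := fun _ => f t) fun a ha => by
    rw [hf, (Finset.mem_filter.1 ha).2]]
  rw [Finset.sum_const, smul_eq_mul, Nat.card_eq_fintype_card, Fintype.card_subtype]

variable {ι : Type} [Fintype ι] [DecidableEq ι]

/-- The multiplicity functions with all values at most `n`. -/
def box (n : ℕ) : Finset (ι → ℕ) := Fintype.piFinset fun _ => Finset.range (n + 1)

/-- As every indecomposable has positive dimension, the total dimension bounds each multiplicity.
The sums over types can therefore be taken over a finite set that is the same for all fields. -/
theorem mem_box {d : ι → ℕ} (hd : ∀ i, 0 < d i) {a : ι → ℕ} {n : ℕ} (h : wt d a ≤ n) :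
    a ∈ (box n : Finset (ι → ℕ)) := by
  rw [box, Fintype.mem_piFinset]
  intro i
  have := le_wt hd a i
  rw [Finset.mem_range]; omega

end Group

/-! ### Subquotients -/

section Chains

variable {S : Type*} [Ring S] {B : Type*} [AddCommGroup B] [Module S B]

/-- The quotient of submodules as a submodule of the quotient. -/
theorem nonempty_subquotient_equiv {U V : Submodule S B} :
    Nonempty ((V ⧸ U.submoduleOf V) ≃ₗ[S] V.map U.mkQ) := by
  let g : V →ₗ[S] V.map U.mkQ := (U.mkQ ∘ₗ V.subtype).codRestrict _ fun v =>
    ⟨v, v.2, rfl⟩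
  have hg : Function.Surjective g := by
    rintro ⟨_, v, hv, rfl⟩
    exact ⟨⟨v, hv⟩, rfl⟩
  have hk : LinearMap.ker g = U.submoduleOf V := by
    ext v
    rw [LinearMap.mem_ker]
    constructor
    · intro h
      exact (Submodule.Quotient.mk_eq_zero U).1 (congrArg Subtype.val h)
    · intro h
      exact Subtype.ext ((Submodule.Quotient.mk_eq_zero U).2 h)
  exact ⟨Submodule.quotEquivOfEq _ _ hk.symm ≪≫ₗ g.quotKerEquivOfSurjective hg⟩

end Chains

/-! ### Hall numbers and their counting identities -/

section HallNumbers

variable {S : Type*} [Ring S] {ι : Type} {X : ι → Type u} [∀ i, AddCommGroup (X i)]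
  [∀ i, Module S (X i)] [Fintype ι] [DecidableEq ι] {q : ℕ} {d : ι → ℕ} {h : ι → ι → ℕ}

variable (S X) in
/-- The Hall number of three multiplicity functions. -/
def hall (a b c : ι → ℕ) : ℕ := hallCard S (MSum X a) (MSum X b) (MSum X c)

variable (S X) in
/-- The number of submodules of a given type. -/
def subN (b t : ι → ℕ) : ℕ :=
  Nat.card {U : Submodule S (MSum X b) // Nonempty (U ≃ₗ[S] MSum X t)}

variable (S X) in
/-- The number of submodules with quotient of a given type. -/
def quoN (b t : ι → ℕ) : ℕ :=
  Nat.card {U : Submodule S (MSum X b) // Nonempty ((MSum X b ⧸ U) ≃ₗ[S] MSum X t)}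

variable (S X) in
/-- The number of automorphisms. -/
def autN (a : ι → ℕ) : ℕ := autCard S (MSum X a)

variable (S X) in
/-- The number of elements of `εM` that generate a submodule with quotient of a given type. -/
def cycN (ε : S) (b c : ι → ℕ) : ℕ :=
  Nat.card {v : epart ε (MSum X b) //
    Nonempty ((MSum X b ⧸ Submodule.span S {v.1}) ≃ₗ[S] MSum X c)}

namespace Sys

variable {M : Type u} [AddCommGroup M] [Module S M] [Finite M]

theorem hallCard_eq (σ : Sys S X q d h) (a c : ι → ℕ) :
    hallCard S (MSum X a) M (MSum X c) = hall S X a (σ.ty M) c := by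
  obtain ⟨e⟩ := σ.nonempty_equiv_ty (M := M)
  exact hallCard_congr e (LinearEquiv.refl S _) (LinearEquiv.refl S _)

theorem hallCard_eq_card_ty (σ : Sys S X q d h) (a c : ι → ℕ) :
    hallCard S (MSum X a) M (MSum X c) =
      Nat.card {U : Submodule S M // σ.ty U = a ∧ σ.ty (M ⧸ U) = c} :=
  Nat.card_congr (Equiv.subtypeEquivRight fun U => by rw [σ.ty_eq_iff, σ.ty_eq_iff])

theorem card_quo (σ : Sys S X q d h) (t : ι → ℕ) :
    Nat.card {U : Submodule S M // σ.ty (M ⧸ U) = t} = quoN S X (σ.ty M) t := by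
  obtain ⟨e⟩ := σ.nonempty_equiv_ty (M := M)
  refine Nat.card_congr ((Submodule.orderIsoMapComap e).toEquiv.subtypeEquiv fun U => ?_)
  obtain ⟨e2⟩ := nonempty_quot_map_equiv e U
  rw [σ.ty_eq_iff]
  exact ⟨fun ⟨f⟩ => ⟨e2.symm ≪≫ₗ f⟩, fun ⟨f⟩ => ⟨e2 ≪≫ₗ f⟩⟩

theorem card_sub (σ : Sys S X q d h) (t : ι → ℕ) :
    Nat.card {U : Submodule S M // σ.ty U = t} = subN S X (σ.ty M) t := by
  obtain ⟨e⟩ := σ.nonempty_equiv_ty (M := M)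
  refine Nat.card_congr ((Submodule.orderIsoMapComap e).toEquiv.subtypeEquiv fun U => ?_)
  have e1 : U ≃ₗ[S] U.map e.toLinearMap := e.submoduleMap U
  rw [σ.ty_eq_iff]
  exact ⟨fun ⟨f⟩ => ⟨e1.symm ≪≫ₗ f⟩, fun ⟨f⟩ => ⟨e1 ≪≫ₗ f⟩⟩

/-- Hall numbers detect submodules. -/
theorem hall_ne_zero_iff (σ : Sys S X q d h) {a b c : ι → ℕ} : hall S X a b c ≠ 0 ↔
    ∃ U : Submodule S (MSum X b), Nonempty (U ≃ₗ[S] MSum X a) ∧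
      Nonempty ((MSum X b ⧸ U) ≃ₗ[S] MSum X c) := by
  have := σ.finite_mSum b
  rw [hall, hallCard, ← Nat.pos_iff_ne_zero, Nat.card_pos_iff]
  constructor
  · rintro ⟨⟨U, hU⟩, -⟩; exact ⟨U, hU⟩
  · rintro ⟨U, hU⟩; exact ⟨⟨⟨U, hU⟩⟩, inferInstance⟩

theorem dim_of_hall (σ : Sys S X q d h) {a b c : ι → ℕ} (hh : hall S X a b c ≠ 0) : wt d b = wt d a + wt d c := by
  have := σ.finite_mSum b
  obtain ⟨U, hU, hQ⟩ := σ.hall_ne_zero_iff.1 hh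
  have := σ.dim_add U
  rwa [σ.ty_mSum, σ.ty_eq_iff.2 hU, σ.ty_eq_iff.2 hQ] at this

theorem hom_le_of_hall (σ : Sys S X q d h) {a b c : ι → ℕ} (hh : hall S X a b c ≠ 0) (t : ι → ℕ) :
    wt₂ h t b ≤ wt₂ h t a + wt₂ h t c := by
  have := σ.finite_mSum b
  obtain ⟨U, hU, hQ⟩ := σ.hall_ne_zero_iff.1 hh
  have := σ.hom_le_add U t
  rwa [σ.ty_mSum, σ.ty_eq_iff.2 hU, σ.ty_eq_iff.2 hQ] at this

theorem hom_sub_le_of_hall (σ : Sys S X q d h) {a b c : ι → ℕ} (hh : hall S X a b c ≠ 0) (t : ι → ℕ) :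
    wt₂ h t a ≤ wt₂ h t b := by
  have := σ.finite_mSum b
  obtain ⟨U, hU, hQ⟩ := σ.hall_ne_zero_iff.1 hh
  have := σ.hom_sub_le U t
  rwa [σ.ty_mSum, σ.ty_eq_iff.2 hU] at this

theorem quot_hom_le_of_hall (σ : Sys S X q d h) {a b c : ι → ℕ} (hh : hall S X a b c ≠ 0) (t : ι → ℕ) :
    wt₂ h c t ≤ wt₂ h b t := by
  have := σ.finite_mSum b
  obtain ⟨U, hU, hQ⟩ := σ.hall_ne_zero_iff.1 hh
  have := σ.quot_hom_le U t
  rwa [σ.ty_mSum, σ.ty_eq_iff.2 hQ] at this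

theorem end_lt_of_hall (σ : Sys S X q d h) {a b c : ι → ℕ} (hh : hall S X a b c ≠ 0) (hne : b ≠ a + c) :
    wt₂ h b b < wt₂ h (a + c) (a + c) := by
  have := σ.finite_mSum b
  obtain ⟨U, hU, hQ⟩ := σ.hall_ne_zero_iff.1 hh
  have := σ.end_lt_of_ne U
  rw [σ.ty_mSum, σ.ty_eq_iff.2 hU, σ.ty_eq_iff.2 hQ] at this
  exact this hne

theorem card_epart (σ : Sys S X q d h) {ε : S} {e : ι → ℕ} (he : ∀ i, Nat.card (epart ε (X i)) = q ^ e i) :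
    Nat.card (epart ε M) = q ^ wt e (σ.ty M) := by
  obtain ⟨f⟩ := σ.nonempty_equiv_ty (M := M)
  rw [card_epart_congr ε f, card_epart_pi, wt, ← Finset.prod_pow_eq_pow_sum]
  refine Finset.prod_congr rfl fun i _ => ?_
  rw [card_epart_pi]
  simp [he, mul_comm (σ.ty M i), pow_mul]

theorem epart_add (σ : Sys S X q d h) {ε : S} (hε : IsIdempotentElem ε) {e : ι → ℕ}
    (he : ∀ i, Nat.card (epart ε (X i)) = q ^ e i) (U : Submodule S M) :
    wt e (σ.ty M) = wt e (σ.ty U) + wt e (σ.ty (M ⧸ U)) := by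
  apply σ.pow_inj
  rw [pow_add, ← σ.card_epart he, ← σ.card_epart he, ← σ.card_epart he]
  exact card_epart_submodule hε U

theorem epart_of_hall (σ : Sys S X q d h) {ε : S} (hε : IsIdempotentElem ε) {e : ι → ℕ}
    (he : ∀ i, Nat.card (epart ε (X i)) = q ^ e i) {a b c : ι → ℕ} (hh : hall S X a b c ≠ 0) :
    wt e b = wt e a + wt e c := by
  have := σ.finite_mSum b
  obtain ⟨U, hU, hQ⟩ := σ.hall_ne_zero_iff.1 hh
  have := σ.epart_add hε he U
  rwa [σ.ty_mSum, σ.ty_eq_iff.2 hU, σ.ty_eq_iff.2 hQ] at this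

theorem ty_sub_mem_box (σ : Sys S X q d h) (U : Submodule S M) : σ.ty U ∈ (box (wt d (σ.ty M)) : Finset (ι → ℕ)) :=
  mem_box σ.d_pos (by rw [σ.dim_add U]; omega)

theorem ty_quo_mem_box (σ : Sys S X q d h) (U : Submodule S M) :
    σ.ty (M ⧸ U) ∈ (box (wt d (σ.ty M)) : Finset (ι → ℕ)) :=
  mem_box σ.d_pos (by rw [σ.dim_add U]; omega)

/-- Homomorphisms are counted by their images. -/
theorem pow_hom_eq_sum (σ : Sys S X q d h) (a b : ι → ℕ) :
    q ^ wt₂ h a b = ∑ t ∈ box (wt d b), subN S X b t * (quoN S X a t * autN S X t) := by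
  have := σ.finite_mSum
  rw [← σ.card_hom_mSum]
  have e : (MSum X a →ₗ[S] MSum X b) ≃
      Σ U : Submodule S (MSum X b), {p : MSum X a →ₗ[S] U // Function.Surjective p ∧ True} :=
    { toFun := fun f => ⟨LinearMap.range f, f.rangeRestrict, f.surjective_rangeRestrict, trivial⟩
      invFun := fun x => x.1.subtype ∘ₗ x.2.1
      left_inv := fun f => rfl
      right_inv := by
        rintro ⟨U, p, hp, -⟩
        have hr : LinearMap.range (U.subtype ∘ₗ p) = U := by
          rw [LinearMap.range_comp, LinearMap.range_eq_top.2 hp, Submodule.map_top,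
            Submodule.range_subtype]
        refine Sigma.ext hr ?_
        have key : ∀ (V : Submodule S (MSum X b)) (_ : V = U)
            (p' : {p : MSum X a →ₗ[S] V // Function.Surjective p ∧ True})
            (_ : ∀ a, (p'.1 a : MSum X b) = p a), p' ≍ (⟨p, hp, trivial⟩ :
              {p : MSum X a →ₗ[S] U // Function.Surjective p ∧ True}) := by
          rintro V rfl p' he
          refine heq_of_eq (Subtype.ext ?_)
          refine LinearMap.ext fun x => Subtype.ext (he x)
        exact key _ hr _ fun a => rfl }
  rw [Nat.card_congr e]
  have hB : ∀ U : Submodule S (MSum X b), σ.ty U ∈ (box (wt d b) : Finset (ι → ℕ)) := fun U => by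
    have := σ.ty_sub_mem_box U
    rwa [σ.ty_mSum] at this
  rw [card_sigma_fiber (fun U : Submodule S (MSum X b) => σ.ty U) (box (wt d b)) hB
    (fun t => quoN S X a t * autN S X t) ?_]
  · refine Finset.sum_congr rfl fun t _ => ?_
    rw [σ.card_sub, σ.ty_mSum]
  · intro U
    obtain ⟨f⟩ := σ.nonempty_equiv_ty (M := U)
    rw [card_surjWith (fun _ => True), autCard_congr f]
    congr 1
    refine Nat.card_congr (Equiv.subtypeEquivRight fun V => ?_)
    rw [and_true]
    exact ⟨fun ⟨g⟩ => ⟨g ≪≫ₗ f⟩, fun ⟨g⟩ => ⟨g ≪≫ₗ f.symm⟩⟩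

/-- Associativity of the Hall algebra. -/
theorem hall_assoc (σ : Sys S X q d h) (a₁ a₂ b c : ι → ℕ) :
    ∑ m ∈ box (wt d b), hall S X m b c * hall S X a₁ m a₂ =
      ∑ n ∈ box (wt d b), hall S X a₁ b n * hall S X a₂ n c := by
  have := σ.finite_mSum
  let B := MSum X b
  -- Both sides count the chains U₁ ≤ U₂ ≤ B with U₁ of type a₁, U₂/U₁ of type a₂ and B/U₂ of type
  -- c. The left side chooses U₂ first, the right side U₁.
  let Ch := {p : Submodule S B × Submodule S B // p.1 ≤ p.2 ∧ σ.ty p.1 = a₁ ∧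
    σ.ty (p.2 ⧸ p.1.submoduleOf p.2) = a₂ ∧ σ.ty (B ⧸ p.2) = c}
  have hL : Nat.card Ch = ∑ m ∈ box (wt d b), hall S X m b c * hall S X a₁ m a₂ := by
    let f : Ch → Σ U₂ : {U : Submodule S B // σ.ty (B ⧸ U) = c},
        {V : Submodule S U₂.1 // σ.ty V = a₁ ∧ σ.ty (U₂.1 ⧸ V) = a₂} :=
      fun p => ⟨⟨p.1.2, p.2.2.2.2⟩, ⟨p.1.1.submoduleOf p.1.2,
        (σ.ty_congr (Submodule.submoduleOfEquivOfLe p.2.1)).trans p.2.2.1, p.2.2.2.1⟩⟩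
    have hf : Function.Bijective f := by
      constructor
      · rintro ⟨⟨U, V⟩, hUV, h1, h2, h3⟩ ⟨⟨U', V'⟩, hUV', h1', h2', h3'⟩ hff
        simp only [f, Sigma.mk.injEq, Subtype.mk.injEq] at hff
        obtain ⟨rfl, hff⟩ := hff
        have := congrArg (Submodule.map V.subtype) (Subtype.mk.inj (eq_of_heq hff))
        simp only [Submodule.submoduleOf, Submodule.map_comap_subtype] at this
        rw [inf_eq_right.2 hUV, inf_eq_right.2 hUV'] at this
        subst this
        rfl
      · rintro ⟨⟨V, hV⟩, ⟨W, hW1, hW2⟩⟩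
        have hW : (W.map V.subtype).submoduleOf V = W :=
          Submodule.comap_map_eq_of_injective V.injective_subtype W
        refine ⟨⟨⟨W.map V.subtype, V⟩, V.map_subtype_le W, ?_, ?_, hV⟩, ?_⟩
        · rw [← hW1]
          exact (σ.ty_congr (V.equivSubtypeMap W)).symm
        · rw [hW]; exact hW2
        · simp only [f, hW]
    rw [Nat.card_congr (Equiv.ofBijective f hf)]
    rw [card_sigma_fiber (fun U : {U : Submodule S B // σ.ty (B ⧸ U) = c} => σ.ty U.1) (box (wt d b)) (fun U => by
      have := σ.ty_sub_mem_box U.1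
      rwa [σ.ty_mSum] at this) (fun m => hall S X a₁ m a₂) fun U => by
        rw [← σ.hallCard_eq, σ.hallCard_eq_card_ty]]
    refine Finset.sum_congr rfl fun t _ => ?_
    congr 1
    rw [hall, σ.hallCard_eq_card_ty]
    exact Nat.card_congr ((Equiv.subtypeSubtypeEquivSubtypeInter _
      (fun U : Submodule S B => σ.ty U = t)).trans
      (Equiv.subtypeEquivRight fun U => and_comm))
  have hR : Nat.card Ch = ∑ n ∈ box (wt d b), hall S X a₁ b n * hall S X a₂ n c := by
    have hq : ∀ U V : Submodule S B, σ.ty (V ⧸ U.submoduleOf V) = σ.ty (V.map U.mkQ) := by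
      intro U V
      obtain ⟨e⟩ := nonempty_subquotient_equiv (U := U) (V := V)
      exact σ.ty_congr e
    let f : Ch → Σ U₁ : {U : Submodule S B // σ.ty U = a₁},
        {W : Submodule S (B ⧸ U₁.1) // σ.ty W = a₂ ∧ σ.ty ((B ⧸ U₁.1) ⧸ W) = c} :=
      fun p => ⟨⟨p.1.1, p.2.2.1⟩, ⟨p.1.2.map p.1.1.mkQ, (hq _ _).symm.trans p.2.2.2.1,
        (σ.ty_congr (Submodule.quotientQuotientEquivQuotient _ _ p.2.1)).trans p.2.2.2.2⟩⟩
    have hf : Function.Bijective f := by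
      constructor
      · rintro ⟨⟨U, V⟩, hUV, h1, h2, h3⟩ ⟨⟨U', V'⟩, hUV', h1', h2', h3'⟩ hff
        simp only [f, Sigma.mk.injEq, Subtype.mk.injEq] at hff
        obtain ⟨rfl, hff⟩ := hff
        have := congrArg (Submodule.comap U.mkQ) (Subtype.mk.inj (eq_of_heq hff))
        rw [Submodule.comap_map_mkQ, Submodule.comap_map_mkQ, sup_eq_right.2 hUV,
          sup_eq_right.2 hUV'] at this
        subst this
        rfl
      · rintro ⟨⟨U, hU⟩, ⟨W, hW1, hW2⟩⟩
        have hW : (W.comap U.mkQ).map U.mkQ = W :=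
          Submodule.map_comap_eq_of_surjective U.mkQ_surjective W
        have hle : U ≤ W.comap U.mkQ := Submodule.le_comap_mkQ U W
        refine ⟨⟨⟨U, W.comap U.mkQ⟩, hle, hU, ?_, ?_⟩, ?_⟩
        · rw [hq, hW]; exact hW1
        · have := σ.ty_congr (Submodule.quotientQuotientEquivQuotient _ _ hle)
          rw [hW] at this
          exact this.symm.trans hW2
        · simp only [f, hW]
    rw [Nat.card_congr (Equiv.ofBijective f hf)]
    rw [card_sigma_fiber (fun U => σ.ty (B ⧸ U.1)) (box (wt d b)) (fun U => by
      have := σ.ty_quo_mem_box U.1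
      rwa [σ.ty_mSum] at this) (fun n => hall S X a₂ n c) fun U => by
        rw [← σ.hallCard_eq, σ.hallCard_eq_card_ty]]
    refine Finset.sum_congr rfl fun t _ => ?_
    congr 1
    rw [hall, σ.hallCard_eq_card_ty]
    exact Nat.card_congr (Equiv.subtypeSubtypeEquivSubtypeInter _ (fun U => σ.ty (B ⧸ U) = t))
  rw [← hL, hR]

theorem card_cyc (σ : Sys S X q d h) (ε : S) (t : ι → ℕ) (b : ι → ℕ) [Finite (MSum X b)] :
    Nat.card {v : epart ε (MSum X b) // σ.ty (MSum X b ⧸ Submodule.span S {v.1}) = t} =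
      cycN S X ε b t :=
  Nat.card_congr (Equiv.subtypeEquivRight fun v => by rw [σ.ty_eq_iff])

/-- The recursion for the number of cyclic submodules with given quotient. -/
theorem sum_cycN (σ : Sys S X q d h) {ε : S} (hε : IsIdempotentElem ε) {e : ι → ℕ}
    (he : ∀ i, Nat.card (epart ε (X i)) = q ^ e i) (b t : ι → ℕ) :
    quoN S X b t * q ^ wt e b =
      (∑ c ∈ box (wt d b), cycN S X ε b c * quoN S X c t) * q ^ wt e t := by
  have := σ.finite_mSum
  let B := MSum X b
  -- These are pairs of a submodule U with quotient of type t and an element v of εU. Given v, the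
  -- choices of U correspond to submodules of B/⟨v⟩; given U, the number of choices of v depends
  -- only on the types b and t.
  let Ch := {p : Submodule S B × epart ε B // p.2.1 ∈ p.1 ∧ σ.ty (B ⧸ p.1) = t}
  have hR : Nat.card Ch = ∑ c ∈ box (wt d b), cycN S X ε b c * quoN S X c t := by
    let f : Ch → Σ v : epart ε B,
        {W : Submodule S (B ⧸ Submodule.span S {v.1}) //
          σ.ty ((B ⧸ Submodule.span S {v.1}) ⧸ W) = t} :=
      fun p => ⟨p.1.2, ⟨p.1.1.map (Submodule.span S {p.1.2.1}).mkQ,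
        (σ.ty_congr (Submodule.quotientQuotientEquivQuotient _ _
          ((Submodule.span_singleton_le_iff_mem _ _).2 p.2.1))).trans p.2.2⟩⟩
    have hf : Function.Bijective f := by
      constructor
      · rintro ⟨⟨U, v⟩, hv, h1⟩ ⟨⟨U', v'⟩, hv', h1'⟩ hff
        simp only [f, Sigma.mk.injEq] at hff
        obtain ⟨rfl, hff⟩ := hff
        have := congrArg (Submodule.comap (Submodule.span S {v.1}).mkQ)
          (Subtype.mk.inj (eq_of_heq hff))
        rw [Submodule.comap_map_mkQ, Submodule.comap_map_mkQ,
          sup_eq_right.2 ((Submodule.span_singleton_le_iff_mem _ _).2 hv),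
          sup_eq_right.2 ((Submodule.span_singleton_le_iff_mem _ _).2 hv')] at this
        subst this
        rfl
      · rintro ⟨v, ⟨W, hW1⟩⟩
        let U := Submodule.span S {v.1}
        have hW : (W.comap U.mkQ).map U.mkQ = W :=
          Submodule.map_comap_eq_of_surjective U.mkQ_surjective W
        have hle : U ≤ W.comap U.mkQ := Submodule.le_comap_mkQ U W
        refine ⟨⟨⟨W.comap U.mkQ, v⟩, hle (Submodule.mem_span_singleton_self _), ?_⟩, ?_⟩
        · have := σ.ty_congr (Submodule.quotientQuotientEquivQuotient _ _ hle)
          rw [hW] at this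
          exact this.symm.trans hW1
        · simp only [f]
          congr 2
    rw [Nat.card_congr (Equiv.ofBijective f hf)]
    rw [card_sigma_fiber (fun v => σ.ty (B ⧸ Submodule.span S {v.1})) (box (wt d b)) (fun v => by
      have := σ.ty_quo_mem_box (Submodule.span S {v.1})
      rwa [σ.ty_mSum] at this) (fun n => quoN S X n t) fun U => by
        rw [← σ.card_quo]]
    refine Finset.sum_congr rfl fun c _ => ?_
    rw [σ.card_cyc]
  have hL : Nat.card Ch * q ^ wt e t = quoN S X b t * q ^ wt e b := by
    let E : Ch ≃ Σ U : {U : Submodule S B // σ.ty (B ⧸ U) = t}, epart ε U.1 :=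
      { toFun := fun p => ⟨⟨p.1.1, p.2.2⟩, ⟨⟨p.1.2.1, p.2.1⟩, Subtype.ext p.1.2.2⟩⟩
        invFun := fun x => ⟨⟨x.1.1, ⟨x.2.1.1, congrArg Subtype.val x.2.2⟩⟩, x.2.1.2, x.1.2⟩
        left_inv := fun p => rfl
        right_inv := fun x => rfl }
    have hE : ∀ U : {U : Submodule S B // σ.ty (B ⧸ U) = t},
        Nat.card (epart ε U.1) = q ^ (wt e b - wt e t) := by
      intro U
      have := σ.epart_add hε he U.1
      rw [U.2, σ.ty_mSum] at this
      rw [σ.card_epart he]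
      congr 1
      omega
    rw [Nat.card_congr E, card_sigma_const _ hE, σ.card_quo, σ.ty_mSum, mul_assoc, ← pow_add]
    by_cases h0 : quoN S X b t = 0
    · simp [h0]
    · have : ∃ U : Submodule S B, σ.ty (B ⧸ U) = t := by
        rw [← ne_eq, quoN, ← Nat.pos_iff_ne_zero, Nat.card_pos_iff] at h0
        obtain ⟨⟨U, hU⟩⟩ := h0.1
        exact ⟨U, σ.ty_eq_iff.2 hU⟩
      obtain ⟨U, hU⟩ := this
      have := σ.epart_add hε he U
      rw [hU, σ.ty_mSum] at this
      congr 2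
      omega
  rw [← hL, hR]

end Sys

end HallNumbers

/-! ### Diagonal terms, split Hall numbers and cyclic submodules -/

section Single

variable {S : Type*} [Ring S] {ι : Type} {X : ι → Type u} [∀ i, AddCommGroup (X i)]
  [∀ i, Module S (X i)] [Fintype ι] [DecidableEq ι] {q : ℕ} {d : ι → ℕ} {h : ι → ι → ℕ}

namespace Sys

/-- A submodule of full dimension is the whole module. Together with `eq_of_quoN` this makes the
identities for the counts of submodules and quotients triangular with respect to dimension. -/
theorem eq_of_subN {b t : ι → ℕ} (σ : Sys S X q d h) (hs : subN S X b t ≠ 0) :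
    wt d t ≤ wt d b ∧ (wt d t = wt d b → t = b) := by
  have := σ.finite_mSum b
  rw [subN, ← Nat.pos_iff_ne_zero, Nat.card_pos_iff] at hs
  obtain ⟨⟨U, hU⟩⟩ := hs.1
  have h1 := σ.dim_add U
  rw [σ.ty_mSum, σ.ty_eq_iff.2 hU] at h1
  refine ⟨by omega, fun h2 => ?_⟩
  have h3 : U = ⊤ := by
    have h4 : Nat.card U = Nat.card (MSum X b) := by
      rw [σ.card_ty, σ.card_ty (M := MSum X b), σ.ty_mSum, σ.ty_eq_iff.2 hU, h2]
    rw [← Submodule.toAddSubgroup_inj, Submodule.top_toAddSubgroup]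
    exact AddSubgroup.eq_top_of_card_eq _ h4
  subst h3
  obtain ⟨e⟩ := hU
  exact σ.eq_of_equiv (e.symm ≪≫ₗ Submodule.topEquiv)

theorem subN_self (σ : Sys S X q d h) (b : ι → ℕ) : subN S X b b = 1 := by
  have := σ.finite_mSum b
  rw [subN, Nat.card_eq_one_iff_unique]
  refine ⟨⟨fun U V => Subtype.ext ?_⟩, ⟨⟨⊤, ⟨Submodule.topEquiv⟩⟩⟩⟩
  have key : ∀ U : Submodule S (MSum X b), Nonempty (U ≃ₗ[S] MSum X b) → U = ⊤ := by
    rintro U ⟨e⟩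
    rw [← Submodule.toAddSubgroup_inj, Submodule.top_toAddSubgroup]
    exact AddSubgroup.eq_top_of_card_eq _ (Nat.card_congr e.toEquiv)
  rw [key U U.2, key V V.2]

theorem eq_bot_of_quotient_equiv {B : Type*} [AddCommGroup B] [Module S B] [Finite B]
    (U : Submodule S B) (hc : Nat.card (B ⧸ U) = Nat.card B) : U = ⊥ := by
  have h1 := card_submodule_mul_quotient U
  rw [hc] at h1
  have h2 : Nat.card U = 1 := by
    have : 0 < Nat.card B := Nat.card_pos
    exact Nat.eq_of_mul_eq_mul_right this (by rw [one_mul]; exact h1.symm)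
  rw [← Submodule.toAddSubgroup_inj, Submodule.bot_toAddSubgroup]
  exact AddSubgroup.eq_bot_of_card_eq _ h2

theorem eq_of_quoN {b t : ι → ℕ} (σ : Sys S X q d h) (hs : quoN S X b t ≠ 0) :
    wt d t ≤ wt d b ∧ (wt d t = wt d b → t = b) := by
  have := σ.finite_mSum b
  rw [quoN, ← Nat.pos_iff_ne_zero, Nat.card_pos_iff] at hs
  obtain ⟨⟨U, hU⟩⟩ := hs.1
  have h1 := σ.dim_add U
  rw [σ.ty_mSum, σ.ty_eq_iff.2 hU] at h1
  refine ⟨by omega, fun h2 => ?_⟩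
  have h3 : U = ⊥ := eq_bot_of_quotient_equiv U (by
    rw [σ.card_ty, σ.card_ty (M := MSum X b), σ.ty_mSum, σ.ty_eq_iff.2 hU, h2])
  subst h3
  obtain ⟨e⟩ := hU
  exact σ.eq_of_equiv (e.symm ≪≫ₗ Submodule.quotEquivOfEqBot _ rfl)

theorem quoN_self (σ : Sys S X q d h) (b : ι → ℕ) : quoN S X b b = 1 := by
  have := σ.finite_mSum b
  rw [quoN, Nat.card_eq_one_iff_unique]
  refine ⟨⟨fun U V => Subtype.ext ?_⟩, ⟨⟨⊥, ⟨Submodule.quotEquivOfEqBot _ rfl⟩⟩⟩⟩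
  have key : ∀ U : Submodule S (MSum X b), Nonempty ((MSum X b ⧸ U) ≃ₗ[S] MSum X b) → U = ⊥ := by
    rintro U ⟨e⟩
    exact eq_bot_of_quotient_equiv U (Nat.card_congr e.toEquiv)
  rw [key U U.2, key V V.2]

theorem hall_zero (σ : Sys S X q d h) (b c : ι → ℕ) :
    hall S X 0 b c = if b = c then 1 else 0 := by
  have := σ.finite_mSum b
  have hz := subsingleton_mSum_zero (X := X)
  have key : ∀ U : Submodule S (MSum X b), Nonempty (U ≃ₗ[S] MSum X (0 : ι → ℕ)) → U = ⊥ := by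
    rintro U ⟨e⟩
    rw [Submodule.eq_bot_iff]
    intro x hx
    have : (⟨x, hx⟩ : U) = 0 := e.injective (Subsingleton.elim _ _)
    exact congrArg Subtype.val this
  split_ifs with hbc
  · subst hbc
    rw [hall, hallCard, Nat.card_eq_one_iff_unique]
    refine ⟨⟨fun U V => Subtype.ext ?_⟩, ⟨⟨⊥, ⟨?_⟩, ⟨Submodule.quotEquivOfEqBot _ rfl⟩⟩⟩⟩
    · rw [key U U.2.1, key V V.2.1]
    · exact { (0 : (⊥ : Submodule S (MSum X b)) →ₗ[S] MSum X 0) with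
        invFun := 0
        left_inv := fun x => Subsingleton.elim _ _
        right_inv := fun x => Subsingleton.elim _ _ }
  · by_contra hne
    obtain ⟨U, hU, ⟨e⟩⟩ := σ.hall_ne_zero_iff.1 hne
    have := key U hU
    subst this
    exact hbc (σ.eq_of_equiv ((Submodule.quotEquivOfEqBot _ rfl).symm ≪≫ₗ e))

theorem eq_of_cycN {b t : ι → ℕ} {ε : S} (σ : Sys S X q d h) (hs : cycN S X ε b t ≠ 0) :
    wt d t ≤ wt d b := by
  have := σ.finite_mSum b
  rw [cycN, ← Nat.pos_iff_ne_zero, Nat.card_pos_iff] at hs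
  obtain ⟨⟨v, hv⟩⟩ := hs.1
  have h1 := σ.dim_add (Submodule.span S {v.1})
  rw [σ.ty_mSum, σ.ty_eq_iff.2 hv] at h1
  omega

/-- `autCard_prod` with one indecomposable split off; the difference of powers of q counts the split
embeddings of X_i. -/
theorem autN_single_add (σ : Sys S X q d h) (i : ι) (a : ι → ℕ) :
    autN S X (Pi.single i 1 + a) =
      (q ^ (h i i + wt (h i) a) - q ^ (h i i + wt (h i) a - (a i + 1))) *
        (q ^ wt₂ h a (Pi.single i 1) * autN S X a) := by
  have := σ.finite
  have := σ.finite_mSum a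
  obtain ⟨e⟩ := nonempty_mSumSingle (S := S) (X := X) i
  rw [autN, autCard_congr (mSumAdd (Pi.single i 1) a ≪≫ₗ e.prodCongr (LinearEquiv.refl S _)),
    autCard_prod, σ.hallCard_mul_autCard_single, σ.card_hom_ty, σ.ty_X, σ.ty_mSum]
  rfl

theorem autN_add (σ : Sys S X q d h) (a c : ι → ℕ) :
    autN S X (a + c) = hall S X a (a + c) c * autN S X a * (q ^ wt₂ h c a * autN S X c) := by
  have := σ.finite_mSum
  have h1 : hall S X a (a + c) c = hallCard S (MSum X a) (MSum X a × MSum X c) (MSum X c) :=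
    hallCard_congr (mSumAdd a c) (LinearEquiv.refl S _) (LinearEquiv.refl S _)
  rw [autN, autCard_congr (mSumAdd a c), autCard_prod, σ.card_hom_mSum, h1]
  rfl

theorem autN_zero (σ : Sys S X q d h) : autN S X (0 : ι → ℕ) = 1 := by
  have hz := subsingleton_mSum_zero (X := X)
  rw [autN, autCard, Nat.card_eq_one_iff_unique]
  exact ⟨⟨fun a b => by ext x : 1; exact Subsingleton.elim _ _⟩, ⟨LinearEquiv.refl S _⟩⟩

theorem autN_pos (σ : Sys S X q d h) (a : ι → ℕ) : 0 < autN S X a := by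
  have := σ.finite_mSum a
  exact autCard_pos

theorem h_self_pos (σ : Sys S X q d h) (i : ι) : 0 < h i i := by
  obtain ⟨N, -, hN⟩ := σ.nonunits i
  rcases Nat.eq_zero_or_pos (h i i) with h0 | h0
  · rw [h0, pow_zero] at hN
    have := Nat.eq_one_of_mul_eq_one_left hN
    have := σ.one_lt
    omega
  · exact h0

/-- Submodules with a cyclic generator in `εM` are counted by their generators. -/
theorem hall_mul_gens (σ : Sys S X q d h) {ε : S} (i : ι) (b c : ι → ℕ)
    (hcyc : ∀ v : epart ε (MSum X b), Nonempty ((MSum X b ⧸ Submodule.span S {v.1}) ≃ₗ[S] MSum X c) →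
      Nonempty (Submodule.span S {v.1} ≃ₗ[S] X i)) :
    hall S X (Pi.single i 1) b c *
      Nat.card {v : epart ε (X i) // Submodule.span S {v.1} = ⊤} = cycN S X ε b c := by
  have := σ.finite_mSum b
  have := σ.finite i
  obtain ⟨e⟩ := nonempty_mSumSingle (S := S) (X := X) i
  let E : {v : epart ε (MSum X b) //
      Nonempty ((MSum X b ⧸ Submodule.span S {v.1}) ≃ₗ[S] MSum X c)} ≃
      Σ U : {U : Submodule S (MSum X b) // Nonempty (U ≃ₗ[S] MSum X (Pi.single i 1)) ∧
        Nonempty ((MSum X b ⧸ U) ≃ₗ[S] MSum X c)},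
        {v : epart ε (MSum X b) // Submodule.span S {v.1} = U.1} :=
    { toFun := fun v => ⟨⟨Submodule.span S {v.1.1}, (hcyc v.1 v.2).map fun f => f ≪≫ₗ e.symm, v.2⟩,
        ⟨v.1, rfl⟩⟩
      invFun := fun x => ⟨x.2.1, by rw [x.2.2]; exact x.1.2.2⟩
      left_inv := fun v => rfl
      right_inv := by
        rintro ⟨⟨U, hU⟩, ⟨v, hv⟩⟩
        have hv : Submodule.span S {v.1} = U := hv
        subst hv
        rfl }
  rw [cycN, Nat.card_congr E]
  refine (card_sigma_const _ fun U => ?_).symm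
  obtain ⟨U, ⟨f⟩, hU⟩ := U
  let g := f ≪≫ₗ e
  have hspan : ∀ v : U, Submodule.span S {(v : MSum X b)} = U ↔
      Submodule.span S {g v} = ⊤ := by
    intro v
    have h1 : Submodule.span S {(v : MSum X b)} = (Submodule.span S {v}).map U.subtype := by
      rw [Submodule.map_span, Set.image_singleton]; rfl
    have h2 : Submodule.span S {g v} = (Submodule.span S {v}).map g.toLinearMap := by
      rw [Submodule.map_span, Set.image_singleton]; rfl
    have h3 : Submodule.span S {(v : MSum X b)} = U ↔ Submodule.span S {v} = ⊤ := by
      rw [h1]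
      constructor
      · intro h
        apply Submodule.map_injective_of_injective U.injective_subtype
        rw [h, Submodule.map_top, Submodule.range_subtype]
      · intro h
        rw [h, Submodule.map_top, Submodule.range_subtype]
    rw [h3, h2]
    constructor
    · intro h
      rw [h, Submodule.map_top, LinearEquiv.range]
    · intro h
      apply Submodule.map_injective_of_injective g.injective
      rw [h, Submodule.map_top, LinearEquiv.range]
  refine Nat.card_congr
    { toFun := fun v => ⟨⟨g ⟨v.1.1, ?_⟩, ?_⟩, ?_⟩
      invFun := fun v => ⟨⟨(g.symm v.1.1).1, ?_⟩, ?_⟩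
      left_inv := fun v => by ext1; ext1; simp
      right_inv := fun v => by ext1; ext1; simp }
  · have hv : Submodule.span S {v.1.1} = U := v.2
    exact (Submodule.span_singleton_le_iff_mem _ _).1 hv.le
  · rw [mem_epart, ← map_smul]
    congr 1
    exact Subtype.ext v.1.2
  · exact (hspan _).1 v.2
  · have : ε • v.1.1 = v.1.1 := v.1.2
    rw [mem_epart]
    rw [← Submodule.coe_smul, ← map_smul, this]
  · exact (hspan _).2 (by simpa using v.2)

end Sys

end Single

/-! ### Families over all finite fields: rationality and good types -/

section Family

variable {S : FinField.{u} → Type u} [∀ F, Ring (S F)] {ι : Type} {X : ∀ F : FinField.{u}, ι → Type u}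
  [∀ F i, AddCommGroup (X F i)] [∀ F i, Module (S F) (X F i)] [Fintype ι] [DecidableEq ι]
  {d : ι → ℕ} {h : ι → ι → ℕ}

theorem exists_eq_single_add {κ : Type} [DecidableEq κ] {a : κ → ℕ} {i : κ} (hi : a i ≠ 0) :
    ∃ a' : κ → ℕ, a = Pi.single i 1 + a' := by
  refine ⟨a - Pi.single i 1, ?_⟩
  funext j
  by_cases hj : j = i
  · subst hj
    rw [Pi.add_apply, Pi.sub_apply, Pi.single_eq_same]
    omega
  · rw [Pi.add_apply, Pi.sub_apply, Pi.single_eq_of_ne hj]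
    omega

/-- A number attached to finite fields, as a rational function. -/
def ratOf (f : FinField.{u} → ℕ) : FinField.{u} → ℚ := fun F => (f F : ℚ)

theorem ratOf_pow (n : ℕ) : MonicFn (ratOf.{u} fun F => Nat.card F.K ^ n) := by
  convert MonicFn.pow n using 1
  funext F
  simp [ratOf, FinField.q]

theorem ratOf_zero : (ratOf.{u} fun _ => 0) ∈ RatFn := by
  convert RatFn.zero_mem using 1
  funext F; simp [ratOf]

theorem ratOf_one : (ratOf.{u} fun _ => 1) ∈ RatFn := by
  convert RatFn.one_mem using 1
  funext F; simp [ratOf]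

theorem ratOf_mul {f g : FinField.{u} → ℕ} (hf : ratOf f ∈ RatFn) (hg : ratOf g ∈ RatFn) :
    (ratOf fun F => f F * g F) ∈ RatFn := by
  convert RatFn.mul_mem hf hg using 1
  funext F; simp [ratOf]

theorem ratOf_sum {κ : Type*} {f : FinField.{u} → κ → ℕ} {B : Finset κ}
    (hf : ∀ t ∈ B, (ratOf fun F => f F t) ∈ RatFn) : (ratOf fun F => ∑ t ∈ B, f F t) ∈ RatFn := by
  convert RatFn.sum_mem hf using 1
  funext F; simp [ratOf]

theorem ratOf_cancel {f g : FinField.{u} → ℕ} (hf : MonicFn (ratOf f))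
    (hfg : (ratOf fun F => f F * g F) ∈ RatFn) : ratOf g ∈ RatFn := by
  refine hf.mem_of_mul_mem ?_
  convert hfg using 1
  funext F; simp [ratOf]

theorem ratOf_of_add {f g : FinField.{u} → ℕ} (hf : ratOf f ∈ RatFn)
    (hfg : (ratOf fun F => f F + g F) ∈ RatFn) : ratOf g ∈ RatFn := by
  convert RatFn.sub_mem hfg hf using 1
  funext F; simp [ratOf]

/-- Rational terms outside T can be subtracted from a rational sum. The index set T may contain
indices outside B at which the terms vanish. This isolates the leading term of a triangular
identity. -/
theorem ratOf_sum_of_subset {κ : Type*} [DecidableEq κ] {f : FinField.{u} → κ → ℕ}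
    {B T : Finset κ} (hB : (ratOf fun F => ∑ t ∈ B, f F t) ∈ RatFn)
    (h1 : ∀ t ∈ B, t ∉ T → (ratOf fun F => f F t) ∈ RatFn)
    (h2 : ∀ t ∈ T, t ∉ B → ∀ F, f F t = 0) :
    (ratOf fun F => ∑ t ∈ T, f F t) ∈ RatFn := by
  refine ratOf_of_add (f := fun F => ∑ t ∈ B \ T, f F t) (ratOf_sum fun t ht => ?_) ?_
  · rw [Finset.mem_sdiff] at ht
    exact h1 t ht.1 ht.2
  · convert hB using 2
    funext F
    have h3 : ∑ t ∈ T, f F t = ∑ t ∈ B ∩ T, f F t := by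
      refine (Finset.sum_subset Finset.inter_subset_right fun t ht ht' => ?_).symm
      refine h2 t ht (fun hb => ht' (Finset.mem_inter.2 ⟨hb, ht⟩)) F
    rw [h3, add_comm, Finset.sum_inter_add_sum_sdiff]

variable (S X) in
/-- A complete family of indecomposables over each finite field with the same numerical data. -/
def FamSys (d : ι → ℕ) (h : ι → ι → ℕ) : Prop :=
  ∀ F : FinField.{u}, Sys (S F) (X F) (Nat.card F.K) d h

namespace FamSys

variable (σ : FamSys S X d h)
include σ

theorem autN_monic (a : ι → ℕ) : MonicFn (ratOf fun F => autN (S F) (X F) a) := by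
  induction hn : wt d a using Nat.strong_induction_on generalizing a with
  | _ n ih =>
    obtain ⟨F0, -⟩ := FinField.exists_large.{u} 0
    by_cases ha : a = 0
    · subst ha
      convert MonicFn.pow 0 using 1
      funext F; simp [ratOf, (σ F).autN_zero]
    · obtain ⟨i, hi⟩ := Function.ne_iff.1 ha
      have hi : a i ≠ 0 := hi
      obtain ⟨a', rfl⟩ := exists_eq_single_add hi
      have hlt : wt d a' < n := by
        rw [← hn, wt_add, wt_single]
        have := (σ F0).d_pos i
        omega
      have h1 := ih _ hlt a' rfl
      have hpos := (σ F0).h_self_pos i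
      have h2 := MonicFn.pow_sub_pow.{u} (m := h i i + wt (h i) a' - (a' i + 1))
        (n := h i i + wt (h i) a') (by omega)
      convert h2.mul ((ratOf_pow (wt₂ h a' (Pi.single i 1))).mul h1) using 1
      funext F
      rw [ratOf, (σ F).autN_single_add]
      have hle : Nat.card F.K ^ (h i i + wt (h i) a' - (a' i + 1)) ≤
          Nat.card F.K ^ (h i i + wt (h i) a') :=
        Nat.pow_le_pow_right (σ F).q_pos (by omega)
      push_cast [Nat.cast_sub hle]
      simp [ratOf, FinField.q]

/-- `autN_add` solves for this split Hall number as a quotient of orders of automorphism groups and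
a power of q, all of them monic. -/
theorem hall_add_monic (a c : ι → ℕ) :
    MonicFn (ratOf fun F => hall (S F) (X F) a (a + c) c) := by
  have h1 := ((σ.autN_monic a).mul ((ratOf_pow (wt₂ h c a)).mul (σ.autN_monic c))).inv
  convert (σ.autN_monic (a + c)).mul h1 using 1
  funext F
  have := (σ F).autN_add a c
  have ha := (σ F).autN_pos a
  have hc := (σ F).autN_pos c
  have hq := (σ F).q_pos
  simp only [ratOf]
  rw [this]
  push_cast
  field_simp

/-- In `pow_hom_eq_sum` for Hom(a, t) and for Hom(t, b), images of type t contribute |Aut t| times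
the wanted number, because t has a single submodule and a single quotient of its own type. All other
nonzero terms belong to types of smaller dimension, so both statements follow together by induction,
with division by the monic |Aut t|. -/
theorem quoN_subN_mem (t : ι → ℕ) :
    (∀ a, (ratOf fun F => quoN (S F) (X F) a t) ∈ RatFn) ∧
      (∀ b, (ratOf fun F => subN (S F) (X F) b t) ∈ RatFn) := by
  induction hn : wt d t using Nat.strong_induction_on generalizing t with
  | _ n ih =>
    obtain ⟨F0, -⟩ := FinField.exists_large.{u} 0
    have htb : t ∈ (box (wt d t) : Finset (ι → ℕ)) := mem_box (σ F0).d_pos le_rfl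
    constructor
    · intro a
      refine ratOf_cancel (σ.autN_monic t) ?_
      have h1 : (ratOf fun F => ∑ t' ∈ box (wt d t), subN (S F) (X F) t t' *
          (quoN (S F) (X F) a t' * autN (S F) (X F) t')) ∈ RatFn := by
        convert (ratOf_pow (wt₂ h a t)).mem using 2
        funext F
        exact ((σ F).pow_hom_eq_sum a t).symm
      have h2 := ratOf_sum_of_subset (T := {t}) h1 (fun t' _ ht' => ?_) (fun t' ht' hb => ?_)
      · convert h2 using 2
        funext F
        rw [Finset.sum_singleton, (σ F).subN_self, one_mul, mul_comm]
      · rw [Finset.mem_singleton] at ht'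
        by_cases hlt : wt d t' < n
        · have := ih _ hlt t' rfl
          exact ratOf_mul (this.2 t) (ratOf_mul (this.1 a) (σ.autN_monic t').mem)
        · convert ratOf_zero using 2
          funext F
          have : subN (S F) (X F) t t' = 0 := by
            by_contra h0
            have := (σ F).eq_of_subN h0
            exact ht' (this.2 (by omega))
          rw [this, zero_mul]
      · rw [Finset.mem_singleton] at ht'
        subst ht'
        exact absurd htb hb
    · intro b
      refine ratOf_cancel (σ.autN_monic t) ?_
      have h1 : (ratOf fun F => ∑ t' ∈ box (wt d b), subN (S F) (X F) b t' *
          (quoN (S F) (X F) t t' * autN (S F) (X F) t')) ∈ RatFn := by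
        convert (ratOf_pow (wt₂ h t b)).mem using 2
        funext F
        exact ((σ F).pow_hom_eq_sum t b).symm
      have h2 := ratOf_sum_of_subset (T := {t}) h1 (fun t' _ ht' => ?_) (fun t' ht' hb F => ?_)
      · convert h2 using 2
        funext F
        rw [Finset.sum_singleton, (σ F).quoN_self, one_mul, mul_comm]
      · rw [Finset.mem_singleton] at ht'
        by_cases hlt : wt d t' < n
        · have := ih _ hlt t' rfl
          exact ratOf_mul (this.2 b) (ratOf_mul (this.1 t) (σ.autN_monic t').mem)
        · convert ratOf_zero using 2
          funext F
          have : quoN (S F) (X F) t t' = 0 := by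
            by_contra h0
            have := (σ F).eq_of_quoN h0
            exact ht' (this.2 (by omega))
          rw [this, zero_mul, mul_zero]
      · rw [Finset.mem_singleton] at ht'
        subst ht'
        have : subN (S F) (X F) b t' = 0 := by
          by_contra h0
          exact hb (mem_box (σ F).d_pos ((σ F).eq_of_subN h0).1)
        rw [this, zero_mul]

theorem quoN_mem (a t : ι → ℕ) : (ratOf fun F => quoN (S F) (X F) a t) ∈ RatFn :=
  (σ.quoN_subN_mem t).1 a

/-- The identity `sum_cycN` is triangular with diagonal coefficient 1: the nonzero terms with c ≠ t
have larger dimension than t, so the induction is on dim b - dim t. -/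
theorem cycN_mem {ε : ∀ F, S F} (hε : ∀ F, IsIdempotentElem (ε F)) {e : ι → ℕ}
    (he : ∀ F i, Nat.card (epart (ε F) (X F i)) = Nat.card F.K ^ e i) (b t : ι → ℕ) :
    (ratOf fun F => cycN (S F) (X F) (ε F) b t) ∈ RatFn := by
  induction hn : wt d b - wt d t using Nat.strong_induction_on generalizing t with
  | _ n ih =>
    obtain ⟨F0, -⟩ := FinField.exists_large.{u} 0
    have h1 : (ratOf fun F => ∑ c ∈ box (wt d b), cycN (S F) (X F) (ε F) b c *
        quoN (S F) (X F) c t) ∈ RatFn := by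
      refine ratOf_cancel (ratOf_pow (wt e t)) ?_
      convert ratOf_mul (σ.quoN_mem b t) (ratOf_pow (wt e b)).mem using 2
      funext F
      rw [mul_comm]
      exact ((σ F).sum_cycN (hε F) (he F) b t).symm
    have h2 := ratOf_sum_of_subset (T := {t}) h1 (fun c _ hc => ?_) (fun c hc hb F => ?_)
    · convert h2 using 2
      funext F
      rw [Finset.sum_singleton, (σ F).quoN_self, mul_one]
    · rw [Finset.mem_singleton] at hc
      by_cases hlt : wt d b - wt d c < n
      · exact ratOf_mul (ih _ hlt c rfl) (σ.quoN_mem c t)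
      · convert ratOf_zero using 2
        funext F
        by_contra h0
        obtain ⟨h3, h4⟩ := Nat.mul_ne_zero_iff.1 h0
        have h5 := (σ F).eq_of_cycN h3
        have h6 := (σ F).eq_of_quoN h4
        exact hc (h6.2 (by omega)).symm
    · rw [Finset.mem_singleton] at hc
      subst hc
      have : cycN (S F) (X F) (ε F) b c = 0 := by
        by_contra h0
        exact hb (mem_box (σ F).d_pos ((σ F).eq_of_cycN h0))
      rw [this, zero_mul]

end FamSys

variable (S X) in
/-- All Hall numbers with submodule of type `a` are rational functions. -/
def Good (a : ι → ℕ) : Prop :=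
  ∀ b c, (ratOf fun F => hall (S F) (X F) a b c) ∈ RatFn

namespace FamSys

/-- If a₁ and a₂ are good, the right side of `hall_assoc` is rational, hence so is the sum over all
middle terms m. Those outside T that occur are good and can be subtracted. -/
theorem hall_mul_mem (σ : FamSys S X d h) {a₁ a₂ : ι → ℕ} (h₁ : Good S X a₁) (h₂ : Good S X a₂)
    (T : Finset (ι → ℕ))
    (hT : ∀ m, m ∉ T → ∀ F, hall (S F) (X F) a₁ m a₂ ≠ 0 → Good S X m) (b c : ι → ℕ) :
    (ratOf fun F => ∑ m ∈ T, hall (S F) (X F) m b c * hall (S F) (X F) a₁ m a₂) ∈ RatFn := by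
  have h3 : (ratOf fun F => ∑ m ∈ box (wt d b),
      hall (S F) (X F) m b c * hall (S F) (X F) a₁ m a₂) ∈ RatFn := by
    have : (ratOf fun F => ∑ n ∈ box (wt d b),
      hall (S F) (X F) a₁ b n * hall (S F) (X F) a₂ n c) ∈ RatFn :=
      ratOf_sum fun n _ => ratOf_mul (h₁ b n) (h₂ n c)
    convert this using 2
    funext F
    exact (σ F).hall_assoc a₁ a₂ b c
  refine ratOf_sum_of_subset h3 (fun m _ hm => ?_) fun m _ hm F => ?_
  · by_cases hex : ∃ F, hall (S F) (X F) a₁ m a₂ ≠ 0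
    · obtain ⟨F, hF⟩ := hex
      exact ratOf_mul (hT m hm F hF b c) (h₁ m a₂)
    · push Not at hex
      convert ratOf_zero using 2
      funext F
      rw [hex, mul_zero]
  · have : hall (S F) (X F) m b c = 0 := by
      by_contra h0
      have := (σ F).dim_of_hall h0
      exact hm (mem_box (σ F).d_pos (by omega))
    rw [this, zero_mul]

/-- In the product of a₁ and a₂ in the Hall algebra every middle term but m₀ is known, so m₀ is
obtained on division by its coefficient. -/
theorem good_of_relation (σ : FamSys S X d h) {a₁ a₂ m₀ : ι → ℕ} (h₁ : Good S X a₁)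
    (h₂ : Good S X a₂) (h₀ : MonicFn (ratOf fun F => hall (S F) (X F) a₁ m₀ a₂))
    (hT : ∀ m, m ≠ m₀ → ∀ F, hall (S F) (X F) a₁ m a₂ ≠ 0 → Good S X m) : Good S X m₀ := by
  intro b c
  refine ratOf_cancel h₀ ?_
  convert σ.hall_mul_mem h₁ h₂ {m₀} (fun m hm => hT m (by simpa using hm)) b c using 2
  funext F
  rw [Finset.sum_singleton, mul_comm]

theorem good_add (σ : FamSys S X d h) {a c : ι → ℕ} (h₁ : Good S X a) (h₂ : Good S X c)
    (hT : ∀ m, m ≠ a + c → ∀ F, hall (S F) (X F) a m c ≠ 0 → Good S X m) : Good S X (a + c) :=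
  σ.good_of_relation h₁ h₂ (σ.hall_add_monic a c) hT

theorem good_zero (σ : FamSys S X d h) : Good S X (0 : ι → ℕ) := by
  intro b c
  by_cases hbc : b = c
  · convert ratOf_one using 2
    funext F
    rw [(σ F).hall_zero, if_pos hbc]
  · convert ratOf_zero using 2
    funext F
    rw [(σ F).hall_zero, if_neg hbc]

/-- If the indecomposables are good then everything is. -/
theorem good_of_single (σ : FamSys S X d h) (hs : ∀ i, Good S X (Pi.single i 1)) (a : ι → ℕ) :
    Good S X a := by
  obtain ⟨F0, -⟩ := FinField.exists_large.{u} 0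
  induction hn : wt d a using Nat.strong_induction_on generalizing a with
  | _ n ih =>
    -- Inner induction on the dimension of the endomorphism ring. The middle terms other than the
    -- direct sum have the same dimension and a smaller endomorphism ring.
    induction hk : wt₂ h a a using Nat.strong_induction_on generalizing a with
    | _ k ih' =>
      by_cases ha : a = 0
      · rw [ha]; exact σ.good_zero
      obtain ⟨i, hi⟩ := Function.ne_iff.1 ha
      have hi : a i ≠ 0 := hi
      obtain ⟨a', rfl⟩ := exists_eq_single_add hi
      have hlt : wt d a' < n := by
        rw [← hn, wt_add, wt_single]
        have := (σ F0).d_pos i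
        omega
      refine σ.good_add (hs i) (ih _ hlt a' rfl) fun m hm F hF => ?_
      have h1 := (σ F).dim_of_hall hF
      rw [← wt_add, hn] at h1
      have h2 := (σ F).end_lt_of_hall hF hm
      rw [hk] at h2
      exact ih' _ h2 m h1 rfl

/-- A cyclic indecomposable that is determined among cyclic modules by its dimension vector is
good. -/
theorem good_of_cyclic (σ : FamSys S X d h) {ε ε' : ∀ F, S F}
    (hε : ∀ F, IsIdempotentElem (ε F)) {e : ι → ℕ}
    (he : ∀ F i, Nat.card (epart (ε F) (X F i)) = Nat.card F.K ^ e i)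
    (hε' : ∀ F, IsIdempotentElem (ε' F)) {e' : ι → ℕ}
    (he' : ∀ F i, Nat.card (epart (ε' F) (X F i)) = Nat.card F.K ^ e' i) (i : ι)
    (hcyc : ∀ F (M : Type u) [AddCommGroup M] [Module (S F) M] [Finite M] (v : M), v ∈ epart (ε F) M →
      Submodule.span (S F) {v} = ⊤ →
      Nat.card (epart (ε F) M) = Nat.card F.K ^ e i →
      Nat.card (epart (ε' F) M) = Nat.card F.K ^ e' i → Nonempty (M ≃ₗ[S F] X F i))
    (hgen : MonicFn (ratOf fun F =>
      Nat.card {v : epart (ε F) (X F i) // Submodule.span (S F) {v.1} = ⊤})) :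
    Good S X (Pi.single i 1) := by
  intro b c
  by_cases hdim : wt e b = e i + wt e c ∧ wt e' b = e' i + wt e' c
  · refine ratOf_cancel hgen ?_
    convert σ.cycN_mem hε he b c using 2
    funext F
    rw [mul_comm]
    -- An element of the ε-part with quotient of type c generates a cyclic module with the dimension
    -- vector of X_i, hence a copy of X_i. So the Hall number times the number of generators of X_i
    -- is the number of such elements.
    refine (σ F).hall_mul_gens i b c fun v hv => ?_
    have := (σ F).finite_mSum b
    let U := Submodule.span (S F) {v.1}
    have hvU : v.1 ∈ U := Submodule.mem_span_singleton_self _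
    have h1 := (σ F).epart_add (hε F) (he F) U
    have h2 := (σ F).epart_add (hε' F) (he' F) U
    rw [(σ F).ty_mSum, (σ F).ty_eq_iff.2 hv] at h1 h2
    refine hcyc F U ⟨v.1, hvU⟩ (Subtype.ext v.2) ?_ ?_ ?_
    · apply Submodule.map_injective_of_injective U.injective_subtype
      rw [Submodule.map_span, Set.image_singleton, Submodule.map_top, Submodule.range_subtype]
      rfl
    · rw [(σ F).card_epart (he F)]
      congr 1
      omega
    · rw [(σ F).card_epart (he' F)]
      congr 1
      omega
  · convert ratOf_zero using 2
    funext F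
    by_contra h0
    have h1 := (σ F).epart_of_hall (hε F) (he F) h0
    have h2 := (σ F).epart_of_hall (hε' F) (he' F) h0
    rw [wt_single] at h1 h2
    exact hdim ⟨h1, h2⟩

end FamSys

end Family

/-! ### Coefficients and ideals in k[x]/(x^m) -/

section Truncated

variable {k : Type u} [Field k]

theorem mk_eq_zero_iff {m : ℕ} (p : k[X]) :
    (Ideal.Quotient.mk (Ideal.span {(X : k[X]) ^ m}) p = 0) ↔ ∀ i < m, p.coeff i = 0 := by
  rw [Ideal.Quotient.eq_zero_iff_mem, Ideal.mem_span_singleton, X_pow_dvd_iff]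

/-- The `i`-th coefficient of an element of `k[x]/(x^m)`, zero for `m ≤ i`. -/
def cf (m i : ℕ) : N k m →ₗ[k] k where
  toFun := Quotient.lift (s := Submodule.quotientRel (Ideal.span {(X : k[X]) ^ m}))
    (fun p => if i < m then p.coeff i else 0) (fun a b hab => by
      have h1 := (Submodule.quotientRel_def _).1 hab
      have h2 := (mk_eq_zero_iff (a - b)).1 (Ideal.Quotient.eq_zero_iff_mem.2 h1)
      split_ifs with hi
      · have := h2 i hi
        rw [coeff_sub] at this
        exact sub_eq_zero.1 this
      · rfl)
  map_add' a b := by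
    obtain ⟨p, rfl⟩ := Ideal.Quotient.mk_surjective a
    obtain ⟨r, rfl⟩ := Ideal.Quotient.mk_surjective b
    change (if i < m then (p + r).coeff i else 0) =
      (if i < m then p.coeff i else 0) + (if i < m then r.coeff i else 0)
    split_ifs <;> simp
  map_smul' c a := by
    obtain ⟨p, rfl⟩ := Ideal.Quotient.mk_surjective a
    change (if i < m then (c • p).coeff i else 0) = c • (if i < m then p.coeff i else 0)
    split_ifs <;> simp

theorem cf_mk {m i : ℕ} (p : k[X]) :
    cf m i (Ideal.Quotient.mk (Ideal.span {(X : k[X]) ^ m}) p) = if i < m then p.coeff i else 0 :=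
  rfl

theorem cf_of_le {m i : ℕ} (h : m ≤ i) (a : N k m) : cf m i a = 0 := by
  obtain ⟨p, rfl⟩ := Ideal.Quotient.mk_surjective a
  rw [cf_mk, if_neg (by omega)]

theorem eq_zero_of_cf {m : ℕ} {a : N k m} (h : ∀ i < m, cf m i a = 0) : a = 0 := by
  obtain ⟨p, rfl⟩ := Ideal.Quotient.mk_surjective a
  rw [mk_eq_zero_iff]
  intro i hi
  have := h i hi
  rwa [cf_mk, if_pos hi] at this

theorem cf_ext {m : ℕ} {a b : N k m} (h : ∀ i < m, cf m i a = cf m i b) : a = b := by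
  rw [← sub_eq_zero]
  refine eq_zero_of_cf fun i hi => ?_
  rw [map_sub, h i hi, sub_self]

theorem cf_X_pow_smul {m i j : ℕ} (a : N k m) :
    cf m i ((X : k[X]) ^ j • a) = if j ≤ i ∧ i < m then cf m (i - j) a else 0 := by
  obtain ⟨p, rfl⟩ := Ideal.Quotient.mk_surjective a
  change cf m i (Ideal.Quotient.mk _ (X ^ j * p)) = _
  rw [cf_mk, cf_mk, coeff_X_pow_mul']
  by_cases h1 : i < m <;> by_cases h2 : j ≤ i
  · rw [if_pos h1, if_pos h2, if_pos ⟨h2, h1⟩, if_pos (by omega)]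
  · rw [if_pos h1, if_neg h2, if_neg (by tauto)]
  · rw [if_neg h1, if_neg (by tauto)]
  · rw [if_neg h1, if_neg (by tauto)]

theorem cf_X_smul {m i : ℕ} (a : N k m) :
    cf m i ((X : k[X]) • a) = if 1 ≤ i ∧ i < m then cf m (i - 1) a else 0 := by
  have := cf_X_pow_smul (i := i) (j := 1) a
  rwa [pow_one] at this

/-- Elements of `k[x]/(x^m)` are given by their coefficients. -/
def cfEquiv (m : ℕ) : N k m ≃ (Fin m → k) where
  toFun a i := cf m i a
  invFun c := Ideal.Quotient.mk _ (∑ i : Fin m, C (c i) * X ^ (i : ℕ))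
  left_inv a := by
    refine cf_ext fun i hi => ?_
    rw [cf_mk, if_pos hi, finsetSum_coeff, Finset.sum_eq_single ⟨i, hi⟩]
    · simp
    · intro j _ hj
      rw [coeff_C_mul_X_pow, if_neg]
      intro h; exact hj (Fin.ext h.symm)
    · simp
  right_inv c := by
    funext i
    change cf m i (Ideal.Quotient.mk _ _) = c i
    rw [cf_mk, if_pos i.2, finsetSum_coeff, Finset.sum_eq_single i]
    · simp
    · intro j _ hj
      rw [coeff_C_mul_X_pow, if_neg]
      intro h; exact hj (Fin.ext h.symm)
    · simp

instance [Finite k] (m : ℕ) : Finite (N k m) := Finite.of_equiv _ (cfEquiv m).symm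

theorem card_N (m : ℕ) : Nat.card (N k m) = Nat.card k ^ m := by
  rw [Nat.card_congr (cfEquiv m), Nat.card_fun, Nat.card_eq_fintype_card (α := Fin m), Fintype.card_fin]

/-- The submodule `x^c k[x]/(x^m)`. -/
def hi (k : Type u) [Field k] (m c : ℕ) : Submodule k[X] (N k m) where
  carrier := {a | ∀ i < c, cf m i a = 0}
  zero_mem' := fun i _ => map_zero _
  add_mem' := fun {a b} ha hb i h => by rw [map_add, ha i h, hb i h, add_zero]
  smul_mem' := fun p a ha => by
    intro i h
    obtain ⟨r, rfl⟩ := Ideal.Quotient.mk_surjective a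
    change cf m i (Ideal.Quotient.mk _ (p * r)) = 0
    rw [cf_mk]
    split_ifs with him
    · rw [coeff_mul]
      refine Finset.sum_eq_zero fun x hx => ?_
      have hx := Finset.HasAntidiagonal.mem_antidiagonal.1 hx
      have := ha x.2 (by omega)
      rw [cf_mk, if_pos (by omega)] at this
      rw [this, mul_zero]
    · rfl

theorem mem_hi {m c : ℕ} {a : N k m} : a ∈ hi k m c ↔ ∀ i < c, cf m i a = 0 := Iff.rfl

theorem mem_hi_iff {m c : ℕ} {a : N k m} : a ∈ hi k m c ↔ ∃ b, a = (X : k[X]) ^ c • b := by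
  constructor
  · intro h
    obtain ⟨p, rfl⟩ := Ideal.Quotient.mk_surjective a
    by_cases hc : c ≤ m
    · have : (X : k[X]) ^ c ∣ p := by
        rw [X_pow_dvd_iff]
        intro i hi
        have := h i hi
        rwa [cf_mk, if_pos (by omega)] at this
      obtain ⟨r, rfl⟩ := this
      exact ⟨Ideal.Quotient.mk _ r, rfl⟩
    · refine ⟨0, ?_⟩
      rw [smul_zero]
      refine eq_zero_of_cf fun i hi => h i (by omega)
  · rintro ⟨b, rfl⟩ i hi
    rw [cf_X_pow_smul, if_neg (by omega)]

/-- The kernel of x^r on N_m is x^{m-r}N_m; the truncated difference covers r ≥ m, where it is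
everything. -/
theorem X_pow_smul_eq_zero_iff {m r : ℕ} {a : N k m} :
    (X : k[X]) ^ r • a = 0 ↔ a ∈ hi k m (m - r) := by
  constructor
  · intro h i hi
    have := congrArg (cf m (i + r)) h
    rwa [cf_X_pow_smul, map_zero, if_pos (by omega), Nat.add_sub_cancel] at this
  · intro h
    refine eq_zero_of_cf fun i hi => ?_
    rw [cf_X_pow_smul]
    split_ifs with h1
    · exact h _ (by omega)
    · rfl

theorem hi_mono {m c c' : ℕ} (h : c ≤ c') : hi k m c' ≤ hi k m c :=
  fun _ ha i hi => ha i (by omega)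

theorem card_hi (m c : ℕ) : Nat.card (hi k m c) = Nat.card k ^ (m - c) := by
  have e : hi k m c ≃ ({i : Fin m // c ≤ i} → k) :=
    { toFun := fun a i => cf m i.1 a.1
      invFun := fun f => ⟨(cfEquiv m).symm fun i => if h : c ≤ i then f ⟨i, h⟩ else 0, by
        intro i hi
        by_cases him : i < m
        · have := congrFun ((cfEquiv m).apply_symm_apply
            fun i : Fin m => if h : c ≤ i then f ⟨i, h⟩ else 0) ⟨i, him⟩
          refine this.trans ?_
          rw [dif_neg (by simpa using hi)]
        · exact cf_of_le (by omega) _⟩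
      left_inv := by
        rintro ⟨a, ha⟩
        refine Subtype.ext ?_
        change (cfEquiv m).symm _ = a
        rw [Equiv.symm_apply_eq]
        funext i
        change (if h : c ≤ i then cf m i a else 0) = cf m i a
        split_ifs with h
        · rfl
        · exact (ha i (by omega)).symm
      right_inv := by
        intro f
        funext i
        have := congrFun ((cfEquiv m).apply_symm_apply
            fun i : Fin m => if h : c ≤ i then f ⟨i, h⟩ else 0) i.1
        refine this.trans ?_
        rw [dif_pos i.2] }
  rw [Nat.card_congr e, Nat.card_fun]
  congr 1
  have e2 : {i : Fin m // c ≤ i} ≃ Fin (m - c) :=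
    { toFun := fun i => ⟨i.1 - c, by have := i.1.2; have := i.2; omega⟩
      invFun := fun i => ⟨⟨i + c, by have := i.2; omega⟩, by simp⟩
      left_inv := fun i => by
        ext; have := i.2; simp only; omega
      right_inv := fun i => by ext; simp }
  rw [Nat.card_congr e2, Nat.card_eq_fintype_card, Fintype.card_fin]

theorem homOfElt_mk {V : Type u} [AddCommGroup V] [Module k[X] V] {r : ℕ}
    (v : V) (hv : (X : k[X]) ^ r • v = 0) (p : k[X]) :
    homOfElt v hv (Ideal.Quotient.mk _ p) = p • v := rfl

theorem homOfElt_one {V : Type u} [AddCommGroup V] [Module k[X] V] {r : ℕ}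
    (v : V) (hv : (X : k[X]) ^ r • v = 0) : homOfElt v hv (1 : N k r) = v := by
  change homOfElt v hv (Ideal.Quotient.mk _ 1) = v
  rw [homOfElt_mk, one_smul]

theorem X_pow_smul_one (m : ℕ) : (X : k[X]) ^ m • (1 : N k m) = 0 := pow_smul_N le_rfl 1

theorem X_pow_smul_one_eq (m j : ℕ) : (X : k[X]) ^ j • (1 : N k m) = xpow k m j := by
  change Ideal.Quotient.mk _ (X ^ j * 1) = _
  rw [mul_one]; rfl

theorem hom_N_ext {V : Type u} [AddCommGroup V] [Module k[X] V] {r : ℕ} {f g : N k r →ₗ[k[X]] V}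
    (h : f 1 = g 1) : f = g := by
  refine LinearMap.ext fun a => ?_
  obtain ⟨p, rfl⟩ := Ideal.Quotient.mk_surjective a
  have : Ideal.Quotient.mk (Ideal.span {(X : k[X]) ^ r}) p = p • (1 : N k r) := by
    change _ = Ideal.Quotient.mk _ (p * 1)
    rw [mul_one]
  rw [this, map_smul, map_smul, h]

theorem cf_homOfElt_xpow {r m i j : ℕ} (hm : m ≤ r + i)
    (hv : (X : k[X]) ^ r • xpow k m i = 0) (a : N k r) :
    cf m j (homOfElt (xpow k m i) hv a) = if i ≤ j ∧ j < m then cf r (j - i) a else 0 := by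
  obtain ⟨p, rfl⟩ := Ideal.Quotient.mk_surjective a
  rw [homOfElt_mk]
  change cf m j (Ideal.Quotient.mk _ (p * X ^ i)) = _
  rw [cf_mk, cf_mk, coeff_mul_X_pow']
  by_cases h1 : j < m <;> by_cases h2 : i ≤ j
  · rw [if_pos h1, if_pos h2, if_pos ⟨h2, h1⟩, if_pos (by omega)]
  · rw [if_pos h1, if_neg h2, if_neg (by tauto)]
  · rw [if_neg h1, if_neg (by tauto)]
  · rw [if_neg h1, if_neg (by tauto)]

end Truncated

/-! ### Orders of fibre products -/

section Count

/-- Over each admissible a the solutions b form a coset of ker ψ, and |ker ψ|·|im ψ| = |B|. -/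
theorem card_fiberProduct {A B V : Type*} [AddCommGroup A] [AddCommGroup B] [AddCommGroup V]
    [Finite A] [Finite B] (φ : A →+ V) (ψ : B →+ V) :
    Nat.card {x : A × B // φ x.1 = ψ x.2} * Nat.card ψ.range =
      Nat.card {a : A // φ a ∈ ψ.range} * Nat.card B := by
  have e : {x : A × B // φ x.1 = ψ x.2} ≃ Σ a : {a : A // φ a ∈ ψ.range}, {b : B // φ a.1 = ψ b} :=
    { toFun := fun x => ⟨⟨x.1.1, x.1.2, x.2.symm⟩, ⟨x.1.2, x.2⟩⟩
      invFun := fun x => ⟨(x.1.1, x.2.1), x.2.2⟩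
      left_inv := fun x => rfl
      right_inv := fun x => rfl }
  rw [Nat.card_congr e, card_sigma_const (Nat.card ψ.ker), mul_assoc, ← AddSubgroup.index_ker,
    AddSubgroup.card_mul_index]
  rintro ⟨a, b, hb⟩
  refine Nat.card_congr
    { toFun := fun b' => ⟨b'.1 - b, by
        rw [AddMonoidHom.mem_ker, map_sub, hb, ← b'.2, sub_self]⟩
      invFun := fun c => ⟨c.1 + b, by
        rw [map_add, hb, (AddMonoidHom.mem_ker).1 c.2, zero_add]⟩
      left_inv := fun b' => by simp
      right_inv := fun c => by simp }

end Count

/-! ### Modules over the triangular algebra as triples -/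

section Triples

variable {k : Type u} [Field k] {w : ℕ} {hw : 2 ≤ w}

namespace Lam

/-- The idempotent `e₁`. -/
def idem₁ (k : Type u) [Field k] (hw : 2 ≤ w) : (Lam k 2 w hw)ᵐᵒᵖ := .op ⟨1, 0, 0⟩

/-- The idempotent `e₂`. -/
def idem₂ (k : Type u) [Field k] (hw : 2 ≤ w) : (Lam k 2 w hw)ᵐᵒᵖ := .op ⟨0, 0, 1⟩

/-- The matrix unit `e₁₂`. -/
def arrow (k : Type u) [Field k] (hw : 2 ≤ w) : (Lam k 2 w hw)ᵐᵒᵖ := .op ⟨0, 1, 0⟩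

theorem isIdempotentElem_idem₁ : IsIdempotentElem (idem₁ k hw) :=
  MulOpposite.unop_injective (by ext1 <;> simp [idem₁])

theorem isIdempotentElem_idem₂ : IsIdempotentElem (idem₂ k hw) :=
  MulOpposite.unop_injective (by ext1 <;> simp [idem₂])

/-- The polynomials, as scalar matrices. -/
def ofPoly (k : Type u) [Field k] (hw : 2 ≤ w) : k[X] →+* (Lam k 2 w hw)ᵐᵒᵖ where
  toFun p := .op ⟨Ideal.Quotient.mk _ p, 0, Ideal.Quotient.mk _ p⟩
  map_one' := rfl
  map_zero' := rfl
  map_add' p q := MulOpposite.unop_injective (by ext1 <;> simp)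
  map_mul' p q := MulOpposite.unop_injective (by ext1 <;> simp [mul_comm])

@[simp] theorem ofPoly_e₁₁ (p : k[X]) : (ofPoly k hw p).unop.e₁₁ = Ideal.Quotient.mk _ p := rfl
@[simp] theorem ofPoly_e₁₂ (p : k[X]) : (ofPoly k hw p).unop.e₁₂ = 0 := rfl
@[simp] theorem ofPoly_e₂₂ (p : k[X]) : (ofPoly k hw p).unop.e₂₂ = Ideal.Quotient.mk _ p := rfl

/-- Scalar matrices are central, so the idempotent parts of a module are k[x]-modules and the arrow
is k[x]-linear between them. -/
theorem ofPoly_comm (p : k[X]) (a : (Lam k 2 w hw)ᵐᵒᵖ) : ofPoly k hw p * a = a * ofPoly k hw p := by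
  refine MulOpposite.unop_injective ?_
  rw [MulOpposite.unop_mul, MulOpposite.unop_mul]
  have hp : proj k hw (Ideal.Quotient.mk _ p) = Ideal.Quotient.mk _ p := rfl
  ext1
  · exact mul_comm _ _
  · change a.unop.e₁₁ * 0 + a.unop.e₁₂ * proj k hw (Ideal.Quotient.mk _ p) =
      Ideal.Quotient.mk _ p * a.unop.e₁₂ + 0 * proj k hw a.unop.e₂₂
    rw [hp, mul_zero, zero_mul, zero_add, add_zero, mul_comm]
  · exact mul_comm _ _

theorem arrow_mul_idem₁ : arrow k hw * idem₁ k hw = arrow k hw :=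
  MulOpposite.unop_injective (by ext1 <;> simp [arrow, idem₁])

theorem idem₂_mul_arrow : idem₂ k hw * arrow k hw = arrow k hw :=
  MulOpposite.unop_injective (by ext1 <;> simp [arrow, idem₂])

theorem idem₁_mul_idem₂ : idem₁ k hw * idem₂ k hw = 0 :=
  MulOpposite.unop_injective (by ext1 <;> simp [idem₂, idem₁])

theorem idem₂_mul_idem₁ : idem₂ k hw * idem₁ k hw = 0 :=
  MulOpposite.unop_injective (by ext1 <;> simp [idem₂, idem₁])

theorem idem_add : idem₁ k hw + idem₂ k hw = 1 :=
  MulOpposite.unop_injective (by ext1 <;> simp [idem₂, idem₁])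

theorem eq_sum (p p' p'' : k[X]) :
    (.op ⟨Ideal.Quotient.mk _ p, Ideal.Quotient.mk _ p', Ideal.Quotient.mk _ p''⟩ :
      (Lam k 2 w hw)ᵐᵒᵖ) =
      ofPoly k hw p * idem₁ k hw + ofPoly k hw p' * arrow k hw + ofPoly k hw p'' * idem₂ k hw := by
  refine MulOpposite.unop_injective ?_
  simp only [MulOpposite.unop_add, MulOpposite.unop_mul]
  have hp : proj k hw (Ideal.Quotient.mk _ p') = Ideal.Quotient.mk _ p' := rfl
  ext1 <;> simp [idem₁, idem₂, arrow, hp]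

theorem exists_eq_sum (a : (Lam k 2 w hw)ᵐᵒᵖ) : ∃ p p' p'' : k[X], a =
    ofPoly k hw p * idem₁ k hw + ofPoly k hw p' * arrow k hw + ofPoly k hw p'' * idem₂ k hw := by
  obtain ⟨p, hp⟩ := Ideal.Quotient.mk_surjective a.unop.e₁₁
  obtain ⟨p', hp'⟩ := Ideal.Quotient.mk_surjective a.unop.e₁₂
  obtain ⟨p'', hp''⟩ := Ideal.Quotient.mk_surjective a.unop.e₂₂
  refine ⟨p, p', p'', ?_⟩
  rw [← eq_sum, hp, hp', hp'']
  rfl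

end Lam

open Lam

namespace Triple

variable (hw) in
/-- The right module of a triple, over the opposite ring. -/
abbrev Hom (T T' : Triple k 2 w) : Type u := T.Carrier →ₗ[(Lam k 2 w hw)ᵐᵒᵖ] T'.Carrier

variable {T T' : Triple k 2 w}

/-- The element of the module of a triple with given components. -/
def el (v₁ : T.V₁) (v₂ : T.V₂) : T.Carrier := (v₁, v₂)

/-- The first component. -/
def p₁ (v : T.Carrier) : T.V₁ := v.1

/-- The second component. -/
def p₂ (v : T.Carrier) : T.V₂ := v.2

@[simp] theorem p₁_el (v₁ : T.V₁) (v₂ : T.V₂) : p₁ (el v₁ v₂) = v₁ := rfl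
@[simp] theorem p₂_el (v₁ : T.V₁) (v₂ : T.V₂) : p₂ (el v₁ v₂) = v₂ := rfl
@[simp] theorem p₁_add (v v' : T.Carrier) : p₁ (v + v') = p₁ v + p₁ v' := rfl
@[simp] theorem p₂_add (v v' : T.Carrier) : p₂ (v + v') = p₂ v + p₂ v' := rfl

theorem el_ext {v v' : T.Carrier} (h₁ : p₁ v = p₁ v') (h₂ : p₂ v = p₂ v') : v = v' := Prod.ext h₁ h₂

theorem el_add (v₁ v₁' : T.V₁) (v₂ v₂' : T.V₂) :
    el (v₁ + v₁') (v₂ + v₂') = el v₁ v₂ + el v₁' v₂' := rfl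

theorem idem₁_smul (v : T.Carrier) : idem₁ k hw • v = el (p₁ v) 0 := by
  refine el_ext ?_ ?_
  · change truncAct T.h₁ 1 v.1 = v.1
    simp
  · change T.f (truncAct T.h₁ 0 v.1) + truncAct T.h₂ 0 v.2 = 0
    simp

theorem idem₂_smul (v : T.Carrier) : idem₂ k hw • v = el 0 (p₂ v) := by
  refine el_ext ?_ ?_
  · change truncAct T.h₁ 0 v.1 = 0
    simp
  · change T.f (truncAct T.h₁ 0 v.1) + truncAct T.h₂ 1 v.2 = v.2
    simp

theorem arrow_smul (v : T.Carrier) : arrow k hw • v = el 0 (T.f (p₁ v)) := by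
  refine el_ext ?_ ?_
  · change truncAct T.h₁ 0 v.1 = 0
    simp
  · change T.f (truncAct T.h₁ 1 v.1) + truncAct T.h₂ 0 v.2 = T.f v.1
    simp

theorem ofPoly_smul (p : k[X]) (v : T.Carrier) : ofPoly k hw p • v = el (p • p₁ v) (p • p₂ v) := by
  refine el_ext ?_ ?_
  · rfl
  · change T.f (truncAct T.h₁ 0 v.1) + p • v.2 = p • v.2
    simp

theorem p₁_sum_smul (p p' p'' : k[X]) (v : T.Carrier) : p₁ ((ofPoly k hw p * idem₁ k hw +
    ofPoly k hw p' * arrow k hw + ofPoly k hw p'' * idem₂ k hw) • v) = p • p₁ v := by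
  simp [add_smul, mul_smul, idem₁_smul, idem₂_smul, arrow_smul, ofPoly_smul]

theorem p₂_sum_smul (p p' p'' : k[X]) (v : T.Carrier) : p₂ ((ofPoly k hw p * idem₁ k hw +
    ofPoly k hw p' * arrow k hw + ofPoly k hw p'' * idem₂ k hw) • v) =
    p' • T.f (p₁ v) + p'' • p₂ v := by
  simp [add_smul, mul_smul, idem₁_smul, idem₂_smul, arrow_smul, ofPoly_smul]

/-- The linear map of a pair of maps that commute with the structure maps. -/
def mkHom (φ₁ : T.V₁ →ₗ[k[X]] T'.V₁) (φ₂ : T.V₂ →ₗ[k[X]] T'.V₂)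
    (h : ∀ v, φ₂ (T.f v) = T'.f (φ₁ v)) : Hom hw T T' where
  toFun v := el (φ₁ (p₁ v)) (φ₂ (p₂ v))
  map_add' v v' := el_ext (φ₁.map_add _ _) (φ₂.map_add _ _)
  map_smul' a v := by
    obtain ⟨p, p', p'', rfl⟩ := exists_eq_sum a
    simp only [add_smul, mul_smul, idem₁_smul, idem₂_smul, arrow_smul, ofPoly_smul, RingHom.id_apply]
    refine el_ext ?_ ?_ <;> simp [h]

theorem hom_apply (φ : Hom hw T T') (v₁ : T.V₁) (v₂ : T.V₂) :
    φ (el v₁ v₂) = el (p₁ (φ (el v₁ 0))) (p₂ (φ (el 0 v₂))) := by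
  refine el_ext ?_ ?_
  · have := congrArg p₁ (φ.map_smul (idem₁ k hw) (el v₁ v₂))
    rw [idem₁_smul, idem₁_smul] at this
    exact this.symm
  · have := congrArg p₂ (φ.map_smul (idem₂ k hw) (el v₁ v₂))
    rw [idem₂_smul, idem₂_smul] at this
    exact this.symm

/-- The first component of a homomorphism. -/
def fst (φ : Hom hw T T') : T.V₁ →ₗ[k[X]] T'.V₁ where
  toFun v := p₁ (φ (el v 0))
  map_add' v v' := by
    rw [← p₁_add, ← map_add, ← el_add, add_zero]
  map_smul' p v := by
    have := congrArg p₁ (φ.map_smul (ofPoly k hw p) (el v 0))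
    rw [ofPoly_smul, ofPoly_smul, p₂_el, smul_zero] at this
    exact this

/-- The second component of a homomorphism. -/
def snd (φ : Hom hw T T') : T.V₂ →ₗ[k[X]] T'.V₂ where
  toFun v := p₂ (φ (el 0 v))
  map_add' v v' := by
    rw [← p₂_add, ← map_add, ← el_add, add_zero]
  map_smul' p v := by
    have := congrArg p₂ (φ.map_smul (ofPoly k hw p) (el 0 v))
    rw [ofPoly_smul, ofPoly_smul, p₁_el, smul_zero] at this
    exact this

theorem hom_apply' (φ : Hom hw T T') (v : T.Carrier) : φ v = el (fst φ (p₁ v)) (snd φ (p₂ v)) :=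
  hom_apply φ (p₁ v) (p₂ v)

theorem snd_f (φ : Hom hw T T') (v : T.V₁) : snd φ (T.f v) = T'.f (fst φ v) := by
  have := congrArg p₂ (φ.map_smul (arrow k hw) (el v 0))
  rw [arrow_smul, arrow_smul] at this
  exact this

theorem hom_ext {φ ψ : Hom hw T T'} (h₁ : fst φ = fst ψ) (h₂ : snd φ = snd ψ) : φ = ψ :=
  LinearMap.ext fun v => by rw [hom_apply', hom_apply', h₁, h₂]

theorem injective_hom_iff (φ : Hom hw T T') :
    Function.Injective φ ↔ Function.Injective (fst φ) ∧ Function.Injective (snd φ) := by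
  constructor
  · intro h
    constructor
    · intro v v' hv
      have : φ (el v 0) = φ (el v' 0) := by
        rw [hom_apply', hom_apply']
        exact el_ext hv rfl
      exact congrArg p₁ (h this)
    · intro v v' hv
      have : φ (el 0 v) = φ (el 0 v') := by
        rw [hom_apply', hom_apply']
        exact el_ext rfl hv
      exact congrArg p₂ (h this)
  · rintro ⟨h₁, h₂⟩ v v' hv
    rw [hom_apply' φ v, hom_apply' φ v'] at hv
    have h3 : fst φ (p₁ v) = fst φ (p₁ v') := by
      have h5 := congrArg p₁ hv
      exact h5
    have h4 : snd φ (p₂ v) = snd φ (p₂ v') := by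
      have h5 := congrArg p₂ hv
      exact h5
    exact el_ext (h₁ h3) (h₂ h4)

/-- Isomorphic triples have isomorphic modules. -/
theorem nonempty_equiv (e₁ : T.V₁ ≃ₗ[k[X]] T'.V₁) (e₂ : T.V₂ ≃ₗ[k[X]] T'.V₂)
    (h : ∀ v, e₂ (T.f v) = T'.f (e₁ v)) :
    Nonempty (T.Carrier ≃ₗ[(Lam k 2 w hw)ᵐᵒᵖ] T'.Carrier) := by
  refine ⟨LinearEquiv.ofBijective (mkHom e₁.toLinearMap e₂.toLinearMap h) ⟨?_, ?_⟩⟩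
  · rw [injective_hom_iff]
    exact ⟨e₁.injective, e₂.injective⟩
  · intro v
    refine ⟨el (e₁.symm (p₁ v)) (e₂.symm (p₂ v)), ?_⟩
    rw [hom_apply']
    exact el_ext (e₁.apply_symm_apply _) (e₂.apply_symm_apply _)

theorem card_epart_idem₁ : Nat.card (epart (idem₁ k hw) T.Carrier) = Nat.card T.V₁ := by
  refine Nat.card_congr
    { toFun := fun v => p₁ v.1
      invFun := fun v => ⟨el v 0, by rw [mem_epart, idem₁_smul]; rfl⟩
      left_inv := ?_
      right_inv := fun v => rfl }
  rintro ⟨v, hv⟩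
  rw [mem_epart, idem₁_smul] at hv
  exact Subtype.ext hv

theorem card_epart_idem₂ : Nat.card (epart (idem₂ k hw) T.Carrier) = Nat.card T.V₂ := by
  refine Nat.card_congr
    { toFun := fun v => p₂ v.1
      invFun := fun v => ⟨el 0 v, by rw [mem_epart, idem₂_smul]; rfl⟩
      left_inv := ?_
      right_inv := fun v => rfl }
  rintro ⟨v, hv⟩
  rw [mem_epart, idem₂_smul] at hv
  exact Subtype.ext hv

end Triple

section OfModule

variable (k hw) (M : Type u) [AddCommGroup M] [Module (Lam k 2 w hw)ᵐᵒᵖ M]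

theorem comm_mem_epart {ε : (Lam k 2 w hw)ᵐᵒᵖ} (p : k[X]) {v : M} (hv : v ∈ epart ε M) :
    ofPoly k hw p • v ∈ epart ε M := by
  rw [mem_epart] at hv ⊢
  rw [← mul_smul, ← ofPoly_comm, mul_smul, hv]

/-- A component of a module, as a module over the polynomials. -/
@[reducible] def epartModule (ε : (Lam k 2 w hw)ᵐᵒᵖ) : Module k[X] (epart ε M) where
  smul p v := ⟨ofPoly k hw p • v.1, comm_mem_epart k hw M p v.2⟩
  one_smul v := Subtype.ext (by
    change ofPoly k hw 1 • v.1 = v.1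
    rw [map_one, one_smul])
  mul_smul p q v := Subtype.ext (by
    change ofPoly k hw (p * q) • v.1 = ofPoly k hw p • ofPoly k hw q • v.1
    rw [map_mul, mul_smul])
  smul_zero p := Subtype.ext (smul_zero _)
  smul_add p v v' := Subtype.ext (smul_add _ _ _)
  add_smul p q v := Subtype.ext (by
    change ofPoly k hw (p + q) • v.1 = ofPoly k hw p • v.1 + ofPoly k hw q • v.1
    rw [map_add, add_smul])
  zero_smul v := Subtype.ext (by
    change ofPoly k hw 0 • v.1 = 0
    rw [map_zero, zero_smul])

/-- The triple of a module. -/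
def tripleOf : Triple k 2 w :=
  letI := epartModule k hw M (idem₁ k hw)
  letI := epartModule k hw M (idem₂ k hw)
  { V₁ := epart (idem₁ k hw) M
    V₂ := epart (idem₂ k hw) M
    f :=
      { toFun := fun v => ⟨arrow k hw • v.1, by
          rw [mem_epart, ← mul_smul, idem₂_mul_arrow]⟩
        map_add' := fun v v' => Subtype.ext (smul_add _ _ _)
        map_smul' := fun p v => Subtype.ext (by
          change arrow k hw • ofPoly k hw p • v.1 = ofPoly k hw p • arrow k hw • v.1
          rw [← mul_smul, ← ofPoly_comm, mul_smul]) }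
    h₁ := fun v => Subtype.ext (by
      change ofPoly k hw (X ^ 2) • v.1 = 0
      rw [← (mem_epart.1 v.2 : idem₁ k hw • v.1 = v.1), ← mul_smul]
      have : ofPoly k hw (X ^ 2) * idem₁ k hw = 0 := by
        refine MulOpposite.unop_injective ?_
        have h : Ideal.Quotient.mk (Ideal.span {(X : k[X]) ^ 2}) (X ^ 2) = 0 :=
          Ideal.Quotient.eq_zero_iff_mem.2 (Ideal.mem_span_singleton_self _)
        rw [MulOpposite.unop_mul]
        ext1 <;> simp only [mul_e₁₁, mul_e₁₂, mul_e₂₂, ofPoly_e₁₁, ofPoly_e₁₂, ofPoly_e₂₂, h] <;> simp [idem₁]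
      rw [this, zero_smul])
    h₂ := fun v => Subtype.ext (by
      change ofPoly k hw (X ^ w) • v.1 = 0
      rw [← (mem_epart.1 v.2 : idem₂ k hw • v.1 = v.1), ← mul_smul]
      have : ofPoly k hw (X ^ w) * idem₂ k hw = 0 := by
        refine MulOpposite.unop_injective ?_
        have h : Ideal.Quotient.mk (Ideal.span {(X : k[X]) ^ w}) (X ^ w) = 0 :=
          Ideal.Quotient.eq_zero_iff_mem.2 (Ideal.mem_span_singleton_self _)
        rw [MulOpposite.unop_mul]
        ext1 <;> simp only [mul_e₁₁, mul_e₁₂, mul_e₂₂, ofPoly_e₁₁, ofPoly_e₁₂, ofPoly_e₂₂, h] <;> simp [idem₂]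
      rw [this, zero_smul]) }

/-- Peirce decomposition M = e₁M ⊕ e₂M, where the matrix unit acts from e₁M to e₂M as the structure
map. All modules can thus be treated as triples. -/
theorem nonempty_equiv_tripleOf :
    Nonempty (M ≃ₗ[(Lam k 2 w hw)ᵐᵒᵖ] (tripleOf k hw M).Carrier) := by
  let g : (tripleOf k hw M).Carrier →ₗ[(Lam k 2 w hw)ᵐᵒᵖ] M :=
    { toFun := fun v => (show epart (idem₁ k hw) M from Triple.p₁ v).1 +
        (show epart (idem₂ k hw) M from Triple.p₂ v).1
      map_add' := fun v v' => add_add_add_comm _ _ _ _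
      map_smul' := by
        intro a z
        obtain ⟨p, p', p'', rfl⟩ := exists_eq_sum a
        rw [Triple.p₁_sum_smul, Triple.p₂_sum_smul, RingHom.id_apply]
        obtain ⟨v, hv0⟩ : {v : epart (idem₁ k hw) M // Triple.p₁ z = v} := ⟨Triple.p₁ z, rfl⟩
        obtain ⟨v', hv0'⟩ : {v : epart (idem₂ k hw) M // Triple.p₂ z = v} := ⟨Triple.p₂ z, rfl⟩
        rw [hv0, hv0']
        have hv : idem₁ k hw • v.1 = v.1 := mem_epart.1 v.2
        have hv' : idem₂ k hw • v'.1 = v'.1 := mem_epart.1 v'.2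
        have h1 : idem₁ k hw • v'.1 = 0 := by rw [← hv', ← mul_smul, idem₁_mul_idem₂, zero_smul]
        have h2 : idem₂ k hw • v.1 = 0 := by rw [← hv, ← mul_smul, idem₂_mul_idem₁, zero_smul]
        have h3 : arrow k hw • v'.1 = 0 := by
          rw [← arrow_mul_idem₁, mul_smul, h1, smul_zero]
        change ofPoly k hw p • v.1 + (ofPoly k hw p' • arrow k hw • v.1 + ofPoly k hw p'' • v'.1) =
          (_ : (Lam k 2 w hw)ᵐᵒᵖ) • (v.1 + v'.1)
        simp only [add_smul, mul_smul, smul_add, h1, h2, h3, hv, hv', smul_zero]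
        abel }
  refine ⟨(LinearEquiv.ofBijective g ⟨?_, ?_⟩).symm⟩
  · rw [← LinearMap.ker_eq_bot, LinearMap.ker_eq_bot']
    rintro ⟨⟨v, hv⟩, ⟨v', hv'⟩⟩ h0
    rw [mem_epart] at hv hv'
    change v + v' = 0 at h0
    have h1 : idem₁ k hw • v' = 0 := by rw [← hv', ← mul_smul, idem₁_mul_idem₂, zero_smul]
    have h4 : v = 0 := by
      have := congrArg (idem₁ k hw • ·) h0
      simpa [h1, hv] using this
    refine Prod.ext (Subtype.ext h4) (Subtype.ext ?_)
    rw [h4, zero_add] at h0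
    exact h0
  · intro m
    refine ⟨(⟨idem₁ k hw • m, ?_⟩, ⟨idem₂ k hw • m, ?_⟩), ?_⟩
    · rw [mem_epart, ← mul_smul, isIdempotentElem_idem₁]
    · rw [mem_epart, ← mul_smul, isIdempotentElem_idem₂]
    · change idem₁ k hw • m + idem₂ k hw • m = m
      rw [← add_smul, idem_add, one_smul]

end OfModule

end Triples

open Lam

/-! ### The modules G(p) and homomorphisms out of them -/

/-- Parameters of the triples `(N_r, N_{m₁} ⊕ N_{m₂}, 1 ↦ (x^{i₁}, x^{i₂}))`. -/
structure Par where
  /-- The length of the first module. -/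
  r : ℕ
  /-- The length of the first summand of the second module. -/
  m₁ : ℕ
  /-- The first exponent of the structure map. -/
  i₁ : ℕ
  /-- The length of the second summand of the second module. -/
  m₂ : ℕ
  /-- The second exponent of the structure map. -/
  i₂ : ℕ

/-- The conditions under which parameters define an indecomposable triple. -/
structure Par.Ok (p : Par) (w : ℕ) : Prop where
  r_le : p.r ≤ 2
  le₁ : p.m₁ ≤ w
  le₂ : p.m₂ ≤ w
  le₁' : p.m₁ ≤ p.r + p.i₁
  le₂' : p.m₂ ≤ p.r + p.i₂
  lt : p.m₂ = 0 ∨ p.m₂ < p.m₁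
  zero : p.r = 0 → 0 < p.m₁ ∧ p.m₂ = 0
  lt₁ : 0 < p.r → 0 < p.m₁ → p.i₁ < p.m₁ ∧ (p.i₂ ≤ p.i₁ → p.i₁ - p.i₂ < p.m₁ - p.m₂)
  lt₂ : 0 < p.r → 0 < p.m₂ → p.i₂ < p.m₂ ∧ p.i₂ < p.i₁

section

variable {k : Type u} [Field k] {w : ℕ} {hw : 2 ≤ w}

/-- The triple `(N_r, N_{m₁} ⊕ N_{m₂}, 1 ↦ (x^{i₁}, x^{i₂}))`. -/
def G (k : Type u) [Field k] {w : ℕ} (p : Par) (hp : p.Ok w) : Triple k 2 w where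
  V₁ := N k p.r
  V₂ := N k p.m₁ × N k p.m₂
  f := (homOfElt (xpow k p.m₁ p.i₁) (pow_smul_xpow hp.le₁')).prod
    (homOfElt (xpow k p.m₂ p.i₂) (pow_smul_xpow hp.le₂'))
  h₁ := pow_smul_N hp.r_le
  h₂ := fun v => Prod.ext (pow_smul_N hp.le₁ v.1) (pow_smul_N hp.le₂ v.2)

theorem cf_zero_hom {m m' : ℕ} (g : N k m' →ₗ[k[X]] N k m) (b : N k m') :
    cf m 0 (g b) = cf m' 0 b * cf m 0 (g 1) ∨ m' = 0 := by
  rcases Nat.eq_zero_or_pos m' with h | h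
  · exact .inr h
  left
  obtain ⟨p, rfl⟩ := Ideal.Quotient.mk_surjective b
  have h1 : Ideal.Quotient.mk (Ideal.span {(X : k[X]) ^ m'}) p = p • (1 : N k m') := by
    change _ = Ideal.Quotient.mk _ (p * 1)
    rw [mul_one]
  rw [cf_mk, if_pos h, h1, map_smul]
  obtain ⟨r, hr⟩ := Ideal.Quotient.mk_surjective (g 1)
  rw [← hr]
  change cf m 0 (Ideal.Quotient.mk _ (p * r)) = _
  rw [cf_mk, cf_mk]
  split_ifs <;> simp [mul_coeff_zero]

theorem exists_eq_of_X_smul_eq_zero {m : ℕ} (y : N k m) (hy : (X : k[X]) • y = 0) :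
    ∃ b : N k m, y = (X : k[X]) ^ (m - 1) • b := by
  exact mem_hi_iff.1 (X_pow_smul_eq_zero_iff.1 ((congrArg (· • y) (pow_one (X : k[X]))).trans hy))

theorem eq_zero_of_top {m : ℕ} {b : N k m} (h : 0 < m → cf m 0 b = 0) :
    (X : k[X]) ^ (m - 1) • b = 0 := by
  refine eq_zero_of_cf fun i hi => ?_
  rw [cf_X_pow_smul]
  split_ifs with h1
  · rw [show i - (m - 1) = 0 by omega]
    exact h (by omega)
  · rfl

theorem cf_zero_of_top {m : ℕ} {b : N k m} (h : (X : k[X]) ^ (m - 1) • b = 0) :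
    cf m 0 b = 0 := by
  rcases Nat.eq_zero_or_pos m with hm | hm
  · exact cf_of_le (by omega) _
  have := congrArg (cf m (m - 1)) h
  rwa [cf_X_pow_smul, if_pos (by omega), map_zero, Nat.sub_self] at this

/-- A homomorphism that is injective on the kernel of a nilpotent operator is injective. -/
theorem injective_of_ker_X {V W : Type*} [AddCommGroup V] [AddCommGroup W] [Module k[X] V]
    [Module k[X] W] {w : ℕ} (hV : ∀ v : V, (X : k[X]) ^ w • v = 0) (g : V →ₗ[k[X]] W)
    (h : ∀ v, (X : k[X]) • v = 0 → g v = 0 → v = 0) : Function.Injective g := by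
  rw [← LinearMap.ker_eq_bot, LinearMap.ker_eq_bot']
  intro v hv
  have : ∀ j, (X : k[X]) ^ (w - j) • v = 0 := by
    intro j
    induction j with
    | zero => exact hV v
    | succ j ih =>
      by_cases hj : j < w
      · refine h _ ?_ (by rw [map_smul, hv, smul_zero])
        rw [← mul_smul, ← pow_succ', show w - (j + 1) + 1 = w - j by omega]
        exact ih
      · rwa [show w - (j + 1) = w - j by omega]
  simpa using this w

variable {p : Par} {hp : p.Ok w}

/-- Since x is nilpotent it is enough to treat the elements killed by x. On those of N_{m₁} ⊕ N_{m₂}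
the map is triangular, because x^{m₁-1} annihilates N_{m₂} when m₂ < m₁, and its diagonal entries
are the given constant coefficients. -/
theorem injective_of_cf (φ : Triple.Hom hw (G k p hp) (G k p hp))
    (h₀ : 0 < p.r → cf p.r 0 (Triple.fst φ (1 : N k p.r)) ≠ 0)
    (h₁ : 0 < p.m₁ → cf p.m₁ 0 (Triple.snd φ ((1, 0) : N k p.m₁ × N k p.m₂)).1 ≠ 0)
    (h₂ : 0 < p.m₂ → cf p.m₂ 0 (Triple.snd φ ((0, 1) : N k p.m₁ × N k p.m₂)).2 ≠ 0) :
    Function.Injective φ := by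
  have key : ∀ {m : ℕ} (g : N k m →ₗ[k[X]] N k m), (0 < m → cf m 0 (g 1) ≠ 0) →
      ∀ b, g ((X : k[X]) ^ (m - 1) • b) = 0 → (X : k[X]) ^ (m - 1) • b = 0 := by
    intro m g hg b hb
    refine eq_zero_of_top fun hm => ?_
    rw [map_smul] at hb
    have h3 := cf_zero_of_top hb
    rcases cf_zero_hom g b with h4 | h4
    · rw [h4] at h3
      exact (mul_eq_zero.1 h3).resolve_right (hg hm)
    · omega
  rw [Triple.injective_hom_iff]
  constructor
  · refine injective_of_ker_X (G k p hp).h₁ _ fun v hv hv' => ?_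
    obtain ⟨b, rfl⟩ := exists_eq_of_X_smul_eq_zero (m := p.r) v hv
    exact key (m := p.r) (Triple.fst φ) h₀ b hv'
  · refine injective_of_ker_X (G k p hp).h₂ _ ?_
    let g : (N k p.m₁ × N k p.m₂) →ₗ[k[X]] (N k p.m₁ × N k p.m₂) := Triple.snd φ
    change ∀ v : N k p.m₁ × N k p.m₂, (X : k[X]) • v = 0 → g v = 0 → v = 0
    rintro ⟨y₁, y₂⟩ hv hv'
    obtain ⟨b₁, rfl⟩ := exists_eq_of_X_smul_eq_zero y₁ (congrArg Prod.fst hv)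
    obtain ⟨b₂, rfl⟩ := exists_eq_of_X_smul_eq_zero y₂ (congrArg Prod.snd hv)
    have hs : (((X : k[X]) ^ (p.m₁ - 1) • b₁, (X : k[X]) ^ (p.m₂ - 1) • b₂) :
        N k p.m₁ × N k p.m₂) = (X : k[X]) ^ (p.m₁ - 1) • (b₁, 0) +
        (X : k[X]) ^ (p.m₂ - 1) • (0, b₂) := by simp
    have h3 : (X : k[X]) ^ (p.m₂ - 1) • b₂ = 0 := by
      refine key ((LinearMap.snd _ _ _ ∘ₗ g) ∘ₗ LinearMap.inr _ _ _) h₂ b₂ ?_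
      have h4 := congrArg Prod.snd hv'
      rw [hs, map_add, map_smul] at h4
      rcases hp.lt with h5 | h5
      · exact eq_zero_of_cf fun i hi => absurd hi (by omega)
      · have h6 : (X : k[X]) ^ (p.m₁ - 1) • (g (b₁, 0)).2 = 0 := pow_smul_N (by omega) _
        rw [Prod.snd_add, Prod.smul_snd, h6, zero_add] at h4
        refine Eq.trans ?_ h4
        rw [map_smul, map_smul]
        rfl
    have h7 : (X : k[X]) ^ (p.m₁ - 1) • b₁ = 0 := by
      refine key ((LinearMap.fst _ _ _ ∘ₗ g) ∘ₗ LinearMap.inl _ _ _) h₁ b₁ ?_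
      have h4 := congrArg Prod.fst hv'
      rw [h3] at h4
      exact h4
    rw [h3, h7]
    rfl

/-- The structure map of `G`. -/
def gMap (k : Type u) [Field k] {w : ℕ} (p : Par) (hp : p.Ok w) :
    N k p.r →ₗ[k[X]] N k p.m₁ × N k p.m₂ :=
  (homOfElt (xpow k p.m₁ p.i₁) (pow_smul_xpow hp.le₁')).prod
    (homOfElt (xpow k p.m₂ p.i₂) (pow_smul_xpow hp.le₂'))

/-- The first component of a homomorphism out of `G`. -/
def fstG {T : Triple k 2 w} (φ : Triple.Hom hw (G k p hp) T) : N k p.r →ₗ[k[X]] T.V₁ :=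
  Triple.fst φ

/-- The second component of a homomorphism out of `G`. -/
def sndG {T : Triple k 2 w} (φ : Triple.Hom hw (G k p hp) T) :
    N k p.m₁ × N k p.m₂ →ₗ[k[X]] T.V₂ :=
  Triple.snd φ

theorem sndG_gMap {T : Triple k 2 w} (φ : Triple.Hom hw (G k p hp) T) (v : N k p.r) :
    sndG φ (gMap k p hp v) = T.f (fstG φ v) := Triple.snd_f φ v

theorem gMap_one : gMap k p hp 1 =
    (X : k[X]) ^ p.i₁ • (1, 0) + (X : k[X]) ^ p.i₂ • (0, 1) := by
  refine Prod.ext ?_ ?_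
  · change homOfElt _ _ (1 : N k p.r) =
      (X : k[X]) ^ p.i₁ • (1 : N k p.m₁) + (X : k[X]) ^ p.i₂ • (0 : N k p.m₁)
    rw [homOfElt_one, smul_zero, add_zero, X_pow_smul_one_eq]
  · change homOfElt _ _ (1 : N k p.r) =
      (X : k[X]) ^ p.i₁ • (0 : N k p.m₂) + (X : k[X]) ^ p.i₂ • (1 : N k p.m₂)
    rw [homOfElt_one, smul_zero, zero_add, X_pow_smul_one_eq]

theorem homG_ext {T : Triple k 2 w} {φ ψ : Triple.Hom hw (G k p hp) T} (h₀ : fstG φ 1 = fstG ψ 1)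
    (h₁ : sndG φ (1, 0) = sndG ψ (1, 0)) (h₂ : sndG φ (0, 1) = sndG ψ (0, 1)) : φ = ψ :=
  Triple.hom_ext (hom_N_ext h₀) (LinearMap.prod_ext (hom_N_ext h₁) (hom_N_ext h₂))

section MkHomG

variable {T : Triple k 2 w} {v : T.V₁} {u₁ u₂ : T.V₂} (hv : (X : k[X]) ^ p.r • v = 0)
  (h₁ : (X : k[X]) ^ p.m₁ • u₁ = 0) (h₂ : (X : k[X]) ^ p.m₂ • u₂ = 0)
  (h : T.f v = (X : k[X]) ^ p.i₁ • u₁ + (X : k[X]) ^ p.i₂ • u₂)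

variable (hw hp) in
/-- The homomorphism out of `G` with given values. -/
def mkHomG : Triple.Hom hw (G k p hp) T :=
  Triple.mkHom (T := G k p hp) (homOfElt v hv) ((homOfElt u₁ h₁).coprod (homOfElt u₂ h₂)) (by
    intro z
    have : (((homOfElt u₁ h₁).coprod (homOfElt u₂ h₂)) ∘ₗ (G k p hp).f :
        N k p.r →ₗ[k[X]] T.V₂) = T.f ∘ₗ homOfElt v hv := by
      refine hom_N_ext ?_
      change homOfElt u₁ h₁ (homOfElt (xpow k p.m₁ p.i₁) (pow_smul_xpow hp.le₁') (1 : N k p.r)) +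
        homOfElt u₂ h₂ (homOfElt (xpow k p.m₂ p.i₂) (pow_smul_xpow hp.le₂') (1 : N k p.r)) =
        T.f (homOfElt v hv 1)
      rw [homOfElt_one, homOfElt_one, homOfElt_one]
      exact h.symm
    exact LinearMap.congr_fun this z)

theorem fstG_mkHomG : fstG (mkHomG hw hp hv h₁ h₂ h) 1 = v := homOfElt_one v hv

theorem sndG_mkHomG_left : sndG (mkHomG hw hp hv h₁ h₂ h) (1, 0) = u₁ := by
  change homOfElt u₁ h₁ (1 : N k p.m₁) + homOfElt u₂ h₂ (0 : N k p.m₂) = _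
  rw [homOfElt_one, map_zero, add_zero]

theorem sndG_mkHomG_right : sndG (mkHomG hw hp hv h₁ h₂ h) (0, 1) = u₂ := by
  change homOfElt u₁ h₁ (0 : N k p.m₁) + homOfElt u₂ h₂ (1 : N k p.m₂) = _
  rw [homOfElt_one, map_zero, zero_add]

end MkHomG

theorem homG_spec {T : Triple k 2 w} (φ : Triple.Hom hw (G k p hp) T) :
    (X : k[X]) ^ p.r • fstG φ 1 = 0 ∧ (X : k[X]) ^ p.m₁ • sndG φ (1, 0) = 0 ∧
      (X : k[X]) ^ p.m₂ • sndG φ (0, 1) = 0 ∧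
      T.f (fstG φ 1) = (X : k[X]) ^ p.i₁ • sndG φ (1, 0) + (X : k[X]) ^ p.i₂ • sndG φ (0, 1) := by
  refine ⟨?_, ?_, ?_, ?_⟩
  · rw [← map_smul, X_pow_smul_one, map_zero]
  · rw [← map_smul, Prod.smul_mk, X_pow_smul_one, smul_zero, Prod.mk_zero_zero, map_zero]
  · rw [← map_smul, Prod.smul_mk, X_pow_smul_one, smul_zero, Prod.mk_zero_zero, map_zero]
  · rw [← map_smul, ← map_smul, ← map_add, ← sndG_gMap, gMap_one]

/-- Homomorphisms out of `G`. -/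
def homGEquiv (hp : p.Ok w) (T : Triple k 2 w) : Triple.Hom hw (G k p hp) T ≃
    {x : T.V₁ × T.V₂ × T.V₂ // (X : k[X]) ^ p.r • x.1 = 0 ∧ (X : k[X]) ^ p.m₁ • x.2.1 = 0 ∧
      (X : k[X]) ^ p.m₂ • x.2.2 = 0 ∧
      T.f x.1 = (X : k[X]) ^ p.i₁ • x.2.1 + (X : k[X]) ^ p.i₂ • x.2.2} where
  toFun φ := ⟨(fstG φ 1, sndG φ (1, 0), sndG φ (0, 1)), homG_spec φ⟩
  invFun x := mkHomG hw hp x.2.1 x.2.2.1 x.2.2.2.1 x.2.2.2.2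
  left_inv _ := homG_ext (fstG_mkHomG _ _ _ _) (sndG_mkHomG_left _ _ _ _)
    (sndG_mkHomG_right _ _ _ _)
  right_inv _ := Subtype.ext (Prod.ext (fstG_mkHomG _ _ _ _)
    (Prod.ext (sndG_mkHomG_left _ _ _ _) (sndG_mkHomG_right _ _ _ _)))

/-- N_n is uniserial, so the sum of x^{i₁}N_n[x^{m₁}] and x^{i₂}N_n[x^{m₂}] is the larger of the two
submodules. -/
theorem exists_add_iff {n m₁ m₂ i₁ i₂ : ℕ} (y : N k n) :
    (∃ a ∈ hi k n (n - m₁), ∃ c ∈ hi k n (n - m₂), (X : k[X]) ^ i₁ • a + (X : k[X]) ^ i₂ • c = y) ↔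
      y ∈ hi k n (min (i₁ + (n - m₁)) (i₂ + (n - m₂))) := by
  constructor
  · rintro ⟨a, ha, c, hc, rfl⟩
    obtain ⟨a, rfl⟩ := mem_hi_iff.1 ha
    obtain ⟨c, rfl⟩ := mem_hi_iff.1 hc
    rw [← mul_smul, ← mul_smul, ← pow_add, ← pow_add]
    exact add_mem (hi_mono (min_le_left _ _) (mem_hi_iff.2 ⟨a, rfl⟩))
      (hi_mono (min_le_right _ _) (mem_hi_iff.2 ⟨c, rfl⟩))
  · intro hy
    obtain ⟨b, rfl⟩ := mem_hi_iff.1 hy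
    rcases min_choice (i₁ + (n - m₁)) (i₂ + (n - m₂)) with h | h
    · exact ⟨_, mem_hi_iff.2 ⟨b, rfl⟩, 0, zero_mem _, by
        rw [h, ← mul_smul, ← pow_add, smul_zero, add_zero]⟩
    · exact ⟨0, zero_mem _, _, mem_hi_iff.2 ⟨b, rfl⟩, by
        rw [h, ← mul_smul, ← pow_add, smul_zero, zero_add]⟩

end

/-! ### The number of homomorphisms between the modules G(p) -/

section

variable {k : Type u} [Field k] {w : ℕ} {hw : 2 ≤ w}

/-- The exponent of the submodule `x^{i₁} N_n[x^{m₁}] + x^{i₂} N_n[x^{m₂}]` of `N_n`. -/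
def Par.e (p : Par) (n : ℕ) : ℕ := min (p.i₁ + (n - p.m₁)) (p.i₂ + (n - p.m₂))

/-- The exponent of the submodule of admissible values in the first module. -/
def Par.c (p p' : Par) : ℕ :=
  max (p'.r - p.r) (max (min (p.e p'.m₁) p'.m₁ - p'.i₁) (min (p.e p'.m₂) p'.m₂ - p'.i₂))

/-- The dimension of the space of homomorphisms between the modules with given parameters. -/
def Par.hom (p p' : Par) : ℕ :=
  (p'.r - p.c p') + (min p.m₁ p'.m₁ + min p.m₁ p'.m₂ + (min p.m₂ p'.m₁ + min p.m₂ p'.m₂)) -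
    ((p'.m₁ - p.e p'.m₁) + (p'.m₂ - p.e p'.m₂))

/-- Multiplication by x^i shifts coefficients by i. The exponent is capped at m, since every
exponent from m on describes the zero submodule of N_m. -/
theorem homOfElt_xpow_mem_hi {r m i e : ℕ} (hm : m ≤ r + i)
    (hv : (X : k[X]) ^ r • xpow k m i = 0) (a : N k r) :
    homOfElt (xpow k m i) hv a ∈ hi k m e ↔ a ∈ hi k r (min e m - i) := by
  simp only [mem_hi, cf_homOfElt_xpow hm]
  constructor
  · intro h j hj
    have := h (j + i) (by omega)
    rwa [if_pos (by omega), Nat.add_sub_cancel] at this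
  · intro h j hj
    split_ifs with h1
    · exact h _ (by omega)
    · rfl

/-- The sum map onto `x^{i₁} N_n[x^{m₁}] + x^{i₂} N_n[x^{m₂}]`. -/
def sumMap (k : Type u) [Field k] (p : Par) (n : ℕ) :
    (hi k n (n - p.m₁) × hi k n (n - p.m₂)) →+ N k n where
  toFun x := (X : k[X]) ^ p.i₁ • x.1.1 + (X : k[X]) ^ p.i₂ • x.2.1
  map_zero' := by simp
  map_add' x y := by
    change _ • (x.1.1 + y.1.1) + _ • (x.2.1 + y.2.1) = _
    rw [smul_add, smul_add]
    exact add_add_add_comm _ _ _ _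

theorem range_sumMap (p : Par) (n : ℕ) :
    (sumMap k p n).range = (hi k n (p.e n)).toAddSubgroup := by
  ext y
  change _ ↔ y ∈ hi k n (min (p.i₁ + (n - p.m₁)) (p.i₂ + (n - p.m₂)))
  rw [← exists_add_iff]
  constructor
  · rintro ⟨⟨⟨a, ha⟩, ⟨b, hb⟩⟩, rfl⟩
    exact ⟨a, ha, b, hb, rfl⟩
  · rintro ⟨a, ha, b, hb, rfl⟩
    exact ⟨⟨⟨a, ha⟩, ⟨b, hb⟩⟩, rfl⟩

theorem card_range_prodMap (p : Par) (n n' : ℕ) :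
    Nat.card ((sumMap k p n).prodMap (sumMap k p n')).range =
      Nat.card k ^ ((n - p.e n) + (n' - p.e n')) := by
  rw [AddMonoidHom.range_prodMap, range_sumMap, range_sumMap,
    Nat.card_congr (AddSubgroup.prodEquiv _ _).toEquiv, Nat.card_prod, pow_add]
  exact congrArg₂ _ (card_hi _ _) (card_hi _ _)

theorem card_dom (p : Par) (n n' : ℕ) :
    Nat.card ((hi k n (n - p.m₁) × hi k n (n - p.m₂)) ×
      (hi k n' (n' - p.m₁) × hi k n' (n' - p.m₂))) =
      Nat.card k ^ (min p.m₁ n + min p.m₁ n' + (min p.m₂ n + min p.m₂ n')) := by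
  rw [Nat.card_prod, Nat.card_prod, Nat.card_prod, card_hi, card_hi, card_hi, card_hi,
      ← pow_add, ← pow_add, ← pow_add]
  congr 1
  omega

theorem mem_hi_c {p p' : Par} (hp' : p'.Ok w) (a : N k p'.r) : a ∈ hi k p'.r (p.c p') ↔
    a ∈ hi k p'.r (p'.r - p.r) ∧
      gMap k p' hp' a ∈ ((sumMap k p p'.m₁).prodMap (sumMap k p p'.m₂)).range := by
  rw [AddMonoidHom.range_prodMap, range_sumMap, range_sumMap]
  change _ ↔ _ ∧ homOfElt (xpow k p'.m₁ p'.i₁) (pow_smul_xpow hp'.le₁') a ∈ hi k _ _ ∧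
        homOfElt (xpow k p'.m₂ p'.i₂) (pow_smul_xpow hp'.le₂') a ∈ hi k _ _
  rw [homOfElt_xpow_mem_hi hp'.le₁', homOfElt_xpow_mem_hi hp'.le₂']
  simp only [mem_hi, Par.c, lt_max_iff]
  constructor
  · intro h
    exact ⟨fun i hi => h i (.inl hi), fun i hi => h i (.inr (.inl hi)),
      fun i hi => h i (.inr (.inr hi))⟩
  · rintro ⟨h, h', h''⟩ i (hi | hi | hi)
    exacts [h i hi, h' i hi, h'' i hi]

theorem Par.sub_e_le (p : Par) (n : ℕ) : n - p.e n ≤ min p.m₁ n + min p.m₂ n := by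
  rw [Par.e]
  omega

/-- The first components v for which the equation is solvable form x^cN_{r'}, and over each of them
the pairs (u₁, u₂) form a coset of the kernel of the sum map. The source parameters p are arbitrary,
so that the count also applies with a shortened m₁ in `card_hom_socle`. -/
theorem card_solutions [Finite k] {p p' : Par} (hp' : p'.Ok w) :
    Nat.card {x : N k p'.r × (N k p'.m₁ × N k p'.m₂) × (N k p'.m₁ × N k p'.m₂) //
      (X : k[X]) ^ p.r • x.1 = 0 ∧ (X : k[X]) ^ p.m₁ • x.2.1 = 0 ∧
      (X : k[X]) ^ p.m₂ • x.2.2 = 0 ∧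
      gMap k p' hp' x.1 = (X : k[X]) ^ p.i₁ • x.2.1 + (X : k[X]) ^ p.i₂ • x.2.2} =
    Nat.card k ^ p.hom p' := by
  have h5 := card_fiberProduct
    ((gMap k p' hp').toAddMonoidHom.comp (hi k p'.r (p'.r - p.r)).subtype.toAddMonoidHom)
    ((sumMap k p p'.m₁).prodMap (sumMap k p p'.m₂))
  have e : {x : N k p'.r × (N k p'.m₁ × N k p'.m₂) × (N k p'.m₁ × N k p'.m₂) //
      (X : k[X]) ^ p.r • x.1 = 0 ∧ (X : k[X]) ^ p.m₁ • x.2.1 = 0 ∧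
      (X : k[X]) ^ p.m₂ • x.2.2 = 0 ∧
      gMap k p' hp' x.1 = (X : k[X]) ^ p.i₁ • x.2.1 + (X : k[X]) ^ p.i₂ • x.2.2} ≃
      {x : hi k p'.r (p'.r - p.r) × ((hi k p'.m₁ (p'.m₁ - p.m₁) × hi k p'.m₁ (p'.m₁ - p.m₂)) ×
        (hi k p'.m₂ (p'.m₂ - p.m₁) × hi k p'.m₂ (p'.m₂ - p.m₂))) //
        ((gMap k p' hp').toAddMonoidHom.comp
          (hi k p'.r (p'.r - p.r)).subtype.toAddMonoidHom) x.1 =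
        ((sumMap k p p'.m₁).prodMap (sumMap k p p'.m₂)) x.2} :=
    { toFun := fun x => ⟨(⟨x.1.1, X_pow_smul_eq_zero_iff.1 x.2.1⟩,
          ((⟨x.1.2.1.1, X_pow_smul_eq_zero_iff.1 (congrArg Prod.fst x.2.2.1)⟩,
            ⟨x.1.2.2.1, X_pow_smul_eq_zero_iff.1 (congrArg Prod.fst x.2.2.2.1)⟩),
           (⟨x.1.2.1.2, X_pow_smul_eq_zero_iff.1 (congrArg Prod.snd x.2.2.1)⟩,
            ⟨x.1.2.2.2, X_pow_smul_eq_zero_iff.1 (congrArg Prod.snd x.2.2.2.1)⟩))), x.2.2.2.2⟩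
      invFun := fun x => ⟨(x.1.1.1, (x.1.2.1.1.1, x.1.2.2.1.1), (x.1.2.1.2.1, x.1.2.2.2.1)),
          X_pow_smul_eq_zero_iff.2 x.1.1.2,
          Prod.ext (X_pow_smul_eq_zero_iff.2 x.1.2.1.1.2) (X_pow_smul_eq_zero_iff.2 x.1.2.2.1.2),
          Prod.ext (X_pow_smul_eq_zero_iff.2 x.1.2.1.2.2) (X_pow_smul_eq_zero_iff.2 x.1.2.2.2.2),
          x.2⟩
      left_inv := fun x => rfl
      right_inv := fun x => rfl }
  have h2 : Nat.card {a : hi k p'.r (p'.r - p.r) //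
      ((gMap k p' hp').toAddMonoidHom.comp (hi k p'.r (p'.r - p.r)).subtype.toAddMonoidHom) a ∈
        ((sumMap k p p'.m₁).prodMap (sumMap k p p'.m₂)).range} = Nat.card k ^ (p'.r - p.c p') := by
    rw [← card_hi]
    exact Nat.card_congr
      { toFun := fun a => ⟨a.1.1, (mem_hi_c hp' _).2 ⟨a.1.2, a.2⟩⟩
        invFun := fun a => ⟨⟨a.1, ((mem_hi_c hp' _).1 a.2).1⟩, ((mem_hi_c hp' _).1 a.2).2⟩
        left_inv := fun a => rfl
        right_inv := fun a => rfl }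
  rw [← Nat.card_congr e, h2, card_range_prodMap, card_dom, ← pow_add] at h5
  refine Nat.eq_of_mul_eq_mul_right (pow_pos Nat.card_pos _) (h5.trans ?_)
  rw [← pow_add]
  congr 1
  -- The truncated subtraction in `Par.hom` is an honest one by `Par.sub_e_le`.
  rw [Par.hom, Nat.sub_add_cancel]
  have h6 := p.sub_e_le p'.m₁
  have h7 := p.sub_e_le p'.m₂
  generalize min p.m₁ p'.m₁ = x₁ at *
  generalize min p.m₁ p'.m₂ = x₂ at *
  generalize min p.m₂ p'.m₁ = x₃ at *
  generalize min p.m₂ p'.m₂ = x₄ at *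
  omega

theorem card_hom_G [Finite k] {p p' : Par} (hp : p.Ok w) (hp' : p'.Ok w) :
    Nat.card (Triple.Hom hw (G k p hp) (G k p' hp')) = Nat.card k ^ p.hom p' :=
  (Nat.card_congr (homGEquiv hp (G k p' hp'))).trans (card_solutions hp')

end

/-! ### Linear functionals and maps into k[x]/(x^m) -/

section Functionals

variable {k : Type u} [Field k]

section

variable {V W : Type*} [AddCommGroup V] [AddCommGroup W] [Module k V] [Module k W] [Module k[X] V]
  [Module k[X] W] [IsScalarTower k k[X] V] [IsScalarTower k k[X] W]

theorem C_smul_eq (a : k) (v : V) : (C a : k[X]) • v = a • v := algebraMap_smul k[X] a v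

/-- A `k`-linear map that commutes with `X` is `k[X]`-linear. -/
def linOfX (g : V →ₗ[k] W) (h : ∀ v, g ((X : k[X]) • v) = (X : k[X]) • g v) : V →ₗ[k[X]] W where
  toFun := g
  map_add' := g.map_add
  map_smul' p v := by
    change g (p • v) = p • g v
    have hX : ∀ (n : ℕ) v, g ((X : k[X]) ^ n • v) = (X : k[X]) ^ n • g v := by
      intro n
      induction n with
      | zero => simp
      | succ n ih =>
        intro v
        rw [pow_succ, mul_smul, ih, h, mul_smul]
    induction p using Polynomial.induction_on' with
    | add p q hp hq => rw [add_smul, map_add, hp, hq, add_smul]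
    | monomial n a =>
      rw [← C_mul_X_pow_eq_monomial, mul_smul, mul_smul, C_smul_eq, C_smul_eq, map_smul, hX]

/-- The element of `k[x]/(x^m)` with given coefficients. -/
def ofCf (m : ℕ) (z : ℕ → k) : N k m := (cfEquiv m).symm fun i => z i

theorem cf_ofCf (m : ℕ) (z : ℕ → k) (i : ℕ) : cf m i (ofCf m z) = if i < m then z i else 0 := by
  split_ifs with h
  · exact congrFun ((cfEquiv m).apply_symm_apply fun i : Fin m => z i) ⟨i, h⟩
  · exact cf_of_le (by omega) _

variable (V) in
/-- The linear map to `k[x]/(x^m)` with given coefficients. -/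
def ofCfLin (m : ℕ) (z : ℕ → V →ₗ[k] k) : V →ₗ[k] N k m where
  toFun v := ofCf m fun i => z i v
  map_add' v v' := by
    refine cf_ext fun i hi => ?_
    rw [map_add, cf_ofCf, cf_ofCf, cf_ofCf, if_pos hi, if_pos hi, if_pos hi, map_add]
  map_smul' a v := by
    refine cf_ext fun i hi => ?_
    rw [RingHom.id_apply, map_smul, cf_ofCf, cf_ofCf, if_pos hi, if_pos hi, map_smul]

omit [Module k[X] V] [IsScalarTower k k[X] V] in
theorem cf_ofCfLin (m : ℕ) (z : ℕ → V →ₗ[k] k) (i : ℕ) (v : V) :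
    cf m i (ofCfLin V m z v) = if i < m then z i v else 0 := cf_ofCf m (fun i => z i v) i

variable (k V) in
/-- The scalar multiplication by `X ^ n` as a linear map over the field. -/
def Xpow (n : ℕ) : V →ₗ[k] V where
  toFun v := (X : k[X]) ^ n • v
  map_add' := smul_add _
  map_smul' _ _ := smul_comm _ _ _

theorem Xpow_apply (n : ℕ) (v : V) : Xpow k V n v = (X : k[X]) ^ n • v := rfl

/-- The map to `k[x]/(x^m)` of a functional that vanishes on the multiples of `x^m`. -/
def toN (m : ℕ) (φ : V →ₗ[k] k) (hφ : ∀ v, φ ((X : k[X]) ^ m • v) = 0) : V →ₗ[k[X]] N k m :=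
  -- φ becomes the coefficient of x^{m-1}; linearity over k[x] then forces the coefficient of x^i to
  -- be φ(x^{m-1-i}v).
  linOfX (ofCfLin V m fun i => φ ∘ₗ Xpow k V (m - 1 - i)) (fun v => by
    refine cf_ext fun i hi => ?_
    rw [cf_X_smul, cf_ofCfLin, cf_ofCfLin, if_pos hi, LinearMap.comp_apply, LinearMap.comp_apply,
      Xpow_apply, Xpow_apply, ← mul_smul, ← pow_succ]
    split_ifs with h1 h2
    · rw [show m - 1 - i + 1 = m - 1 - (i - 1) by omega]
    · omega
    · rw [show m - 1 - i + 1 = m by omega, hφ])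

theorem cf_toN (m : ℕ) (φ : V →ₗ[k] k) (hφ : ∀ v, φ ((X : k[X]) ^ m • v) = 0) (i : ℕ) (v : V) :
    cf m i (toN m φ hφ v) = if i < m then φ ((X : k[X]) ^ (m - 1 - i) • v) else 0 :=
  cf_ofCfLin m (fun i => φ ∘ₗ Xpow k V (m - 1 - i)) i v

omit [Module k[X] V] [Module k[X] W] [IsScalarTower k k[X] V] [IsScalarTower k k[X] W] in
theorem exists_functional_comp (L : V →ₗ[k] W) (χ : V →ₗ[k] k) (h : ∀ v, L v = 0 → χ v = 0) :
    ∃ φ : W →ₗ[k] k, ∀ v, φ (L v) = χ v := by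
  have h1 : χ ∈ LinearMap.range L.dualMap := by
    rw [LinearMap.range_dualMap_eq_dualAnnihilator_ker, Submodule.mem_dualAnnihilator]
    exact fun v hv => h v hv
  obtain ⟨φ, hφ⟩ := h1
  exact ⟨φ, fun v => LinearMap.congr_fun hφ v⟩

omit [Module k[X] V] [IsScalarTower k k[X] V] in
theorem exists_functional (U : Submodule k V) (v : V) (hv : v ∉ U) :
    ∃ φ : V →ₗ[k] k, φ v ≠ 0 ∧ ∀ z ∈ U, φ z = 0 := by
  obtain ⟨φ, h1, h2⟩ := U.exists_le_ker_of_notMem hv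
  exact ⟨φ, h1, fun z hz => h2 hz⟩

end

end Functionals

/-! ### A criterion for G(p) to be a direct summand -/

section Split

variable {k : Type u} [Field k] {w : ℕ} {hw : 2 ≤ w} {p : Par} {hp : p.Ok w} (T : Triple k 2 w)
  [Module k T.V₁] [Module k T.V₂] [IsScalarTower k k[X] T.V₁] [IsScalarTower k k[X] T.V₂]

variable {T}

variable (hw hp) in
/-- The homomorphism to `G` of a triple of functionals. -/
def toG {ψ : T.V₁ →ₗ[k] k} {φ₁ φ₂ : T.V₂ →ₗ[k] k} (hψ : ∀ v, ψ ((X : k[X]) ^ p.r • v) = 0)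
    (h₁ : ∀ v, φ₁ ((X : k[X]) ^ p.m₁ • v) = 0) (h₂ : ∀ v, φ₂ ((X : k[X]) ^ p.m₂ • v) = 0)
    (hc₁ : ∀ v, φ₁ (T.f v) = ψ ((X : k[X]) ^ (p.r + p.i₁ - p.m₁) • v))
    (hc₂ : ∀ v, φ₂ (T.f v) = ψ ((X : k[X]) ^ (p.r + p.i₂ - p.m₂) • v)) :
    Triple.Hom hw T (G k p hp) :=
  -- The coefficient of x^{m-1} in x^i a is that of x^{m-1-i} in a, and m-1-i = (r-1) - (r+i-m).
  -- This is the origin of the exponent r+i-m in the compatibility of ψ with φ.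
  have key : ∀ {m i : ℕ} (_ : m ≤ p.r + i) {φ : T.V₂ →ₗ[k] k} (h : ∀ v, φ ((X : k[X]) ^ m • v) = 0)
      (_ : ∀ v, φ (T.f v) = ψ ((X : k[X]) ^ (p.r + i - m) • v)) (v : T.V₁)
      (hz : (X : k[X]) ^ p.r • xpow k m i = 0),
      toN m φ h (T.f v) = homOfElt (xpow k m i) hz (toN p.r ψ hψ v) := by
    intro m i hm φ h hc v hz
    refine cf_ext fun j hj => ?_
    rw [cf_toN, if_pos hj, ← map_smul, hc, cf_homOfElt_xpow hm, ← mul_smul, ← pow_add]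
    by_cases h1 : i ≤ j
    · rw [if_pos ⟨h1, hj⟩, cf_toN]
      split_ifs with h2
      · congr 3
        omega
      · omega
    · rw [if_neg (by tauto)]
      obtain ⟨t, ht⟩ := Nat.exists_eq_add_of_le (show p.r ≤ p.r + i - m + (m - 1 - j) by omega)
      rw [ht, pow_add, mul_smul, hψ]
  Triple.mkHom (T' := G k p hp) (toN p.r ψ hψ) ((toN p.m₁ φ₁ h₁).prod (toN p.m₂ φ₂ h₂))
    (fun v => Prod.ext (key hp.le₁' h₁ hc₁ v (pow_smul_xpow hp.le₁'))
      (key hp.le₂' h₂ hc₂ v (pow_smul_xpow hp.le₂')))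

variable (hw hp) in
/-- A criterion for `G` to be a direct summand. -/
theorem exists_split_of_data {v : T.V₁} {u₁ u₂ : T.V₂} (hv : (X : k[X]) ^ p.r • v = 0)
    (hu₁ : (X : k[X]) ^ p.m₁ • u₁ = 0) (hu₂ : (X : k[X]) ^ p.m₂ • u₂ = 0)
    (h : T.f v = (X : k[X]) ^ p.i₁ • u₁ + (X : k[X]) ^ p.i₂ • u₂)
    {ψ : T.V₁ →ₗ[k] k} {φ₁ φ₂ : T.V₂ →ₗ[k] k} (hψ : ∀ v, ψ ((X : k[X]) ^ p.r • v) = 0)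
    (h₁ : ∀ v, φ₁ ((X : k[X]) ^ p.m₁ • v) = 0) (h₂ : ∀ v, φ₂ ((X : k[X]) ^ p.m₂ • v) = 0)
    (hc₁ : ∀ v, φ₁ (T.f v) = ψ ((X : k[X]) ^ (p.r + p.i₁ - p.m₁) • v))
    (hc₂ : ∀ v, φ₂ (T.f v) = ψ ((X : k[X]) ^ (p.r + p.i₂ - p.m₂) • v))
    (n₀ : 0 < p.r → ψ ((X : k[X]) ^ (p.r - 1) • v) ≠ 0)
    (n₁ : 0 < p.m₁ → φ₁ ((X : k[X]) ^ (p.m₁ - 1) • u₁) ≠ 0)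
    (n₂ : 0 < p.m₂ → φ₂ ((X : k[X]) ^ (p.m₂ - 1) • u₂) ≠ 0) :
    ∃ (s : Triple.Hom hw (G k p hp) T) (r : Triple.Hom hw T (G k p hp)),
      Function.Injective (r ∘ₗ s) := by
  let s := mkHomG hw hp hv hu₁ hu₂ h
  let r := toG hw hp hψ h₁ h₂ hc₁ hc₂
  refine ⟨s, r, injective_of_cf _ ?_ ?_ ?_⟩
  · intro h0
    change cf p.r 0 (toN p.r ψ hψ (fstG s 1)) ≠ 0
    rw [fstG_mkHomG, cf_toN, if_pos h0]
    exact n₀ h0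
  · intro h0
    change cf p.m₁ 0 (toN p.m₁ φ₁ h₁ (sndG s (1, 0))) ≠ 0
    rw [sndG_mkHomG_left, cf_toN, if_pos h0]
    exact n₁ h0
  · intro h0
    change cf p.m₂ 0 (toN p.m₂ φ₂ h₂ (sndG s (0, 1))) ≠ 0
    rw [sndG_mkHomG_right, cf_toN, if_pos h0]
    exact n₂ h0

end Split

/-- The parameters of the indecomposables. -/
def par {w : ℕ} : Idx w → Par
  | .P0 m _ _ => ⟨0, m, m, 0, 0⟩
  | .P1 m _ _ => ⟨1, m, m - 1, 0, 0⟩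
  | .P2 m _ _ => ⟨2, m, m - 2, 0, 0⟩
  | .B m' m _ _ _ => ⟨2, m', m' - 2, m, m - 1⟩
  | .P10 => ⟨1, 0, 0, 0, 0⟩
  | .P20 => ⟨2, 0, 0, 0, 0⟩
  | .Z m _ _ => ⟨2, m, m - 1, 0, 0⟩

theorem par_ok {w : ℕ} (I : Idx w) : (par I).Ok w := by
  cases I <;> constructor <;> intros <;> simp only [par] at * <;>
    first | omega | trivial

/-! ### Every nonzero triple has a summand in the list -/

section Classification

variable {k : Type u} [Field k] {w : ℕ} {hw : 2 ≤ w}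

section Height

variable {V : Type*} [AddCommGroup V] [Module k V] [Module k[X] V] [IsScalarTower k k[X] V]

theorem mem_range_Xpow_sup {n : ℕ} {U : Submodule k V} {v : V} :
    v ∈ LinearMap.range (Xpow k V n) ⊔ U ↔ ∃ u, ∃ z ∈ U, v = (X : k[X]) ^ n • u + z := by
  rw [Submodule.mem_sup]
  constructor
  · rintro ⟨_, ⟨u, rfl⟩, z, hz, rfl⟩
    exact ⟨u, z, hz, rfl⟩
  · rintro ⟨u, z, hz, rfl⟩
    exact ⟨_, ⟨u, rfl⟩, z, hz, rfl⟩

/-- The height of v modulo U, that is the largest n with v ∈ x^nV + U. It is below w because x^wV =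
0 and v ∉ U. -/
theorem exists_height (hV : ∀ v : V, (X : k[X]) ^ w • v = 0) (U : Submodule k V) {v : V} (hv : v ∉ U) :
    ∃ n < w, v ∈ LinearMap.range (Xpow k V n) ⊔ U ∧ v ∉ LinearMap.range (Xpow k V (n + 1)) ⊔ U := by
  classical
  have hex : ∃ n, v ∉ LinearMap.range (Xpow k V n) ⊔ U := by
    refine ⟨w, fun h => hv ?_⟩
    obtain ⟨u, z, hz, rfl⟩ := mem_range_Xpow_sup.1 h
    rwa [hV, zero_add]
  have h0 : Nat.find hex ≠ 0 := by
    intro h0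
    have := Nat.find_spec hex
    rw [h0] at this
    exact this (mem_range_Xpow_sup.2 ⟨v, 0, zero_mem _, by simp⟩)
  obtain ⟨n, hn⟩ := Nat.exists_eq_succ_of_ne_zero h0
  refine ⟨n, ?_, ?_, ?_⟩
  · by_contra h1
    have h2 := Nat.find_min hex (m := w) (by omega)
    obtain ⟨u, z, hz, rfl⟩ := mem_range_Xpow_sup.1 (not_not.1 h2)
    rw [hV, zero_add] at hv
    exact hv hz
  · exact not_not.1 (Nat.find_min hex (m := n) (by omega))
  · have := Nat.find_spec hex
    rwa [hn] at this

end Height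

/-- The map s from G(p) is given by elements v, u₁, u₂ and the map r to G(p) by functionals ψ, φ₁,
φ₂. Heights are chosen so that u₁ and u₂ exist and some functional separates f(v), or f(xv), from
the next power of x; then r ∘ s has nonzero diagonal coefficients. -/
theorem exists_split (T : Triple k 2 w) [Module k T.V₁] [Module k T.V₂] [IsScalarTower k k[X] T.V₁]
    [IsScalarTower k k[X] T.V₂] (hT : Nontrivial T.V₁ ∨ Nontrivial T.V₂) :
    ∃ (I : Idx w) (s : Triple.Hom hw (G k (par I) (par_ok I)) T)
      (r : Triple.Hom hw T (G k (par I) (par_ok I))), Function.Injective (r ∘ₗ s) := by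
  have hmul : ∀ {V : Type u} [AddCommGroup V] [Module k[X] V] (a b : ℕ) (v : V),
      (X : k[X]) ^ a • (X : k[X]) ^ b • v = (X : k[X]) ^ (a + b) • v := fun a b v => by
    rw [pow_add, mul_smul]
  have hf : ∀ (a : ℕ) v, T.f ((X : k[X]) ^ a • v) = (X : k[X]) ^ a • T.f v := fun a v =>
    map_smul _ _ _
  -- W is the image under f of the elements killed by x: changing v by such an element changes f(v)
  -- within W and leaves xv alone.
  let W : Submodule k T.V₂ := (LinearMap.ker (Xpow k T.V₁ 1)).map (T.f.restrictScalars k)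
  have hW : ∀ z, z ∈ W ↔ ∃ v, (X : k[X]) ^ 1 • v = 0 ∧ T.f v = z := fun z => Iff.rfl
  -- A kernel element v with xv ≠ 0 spans a summand P_2^0.
  by_cases h1 : ∃ v, T.f v = 0 ∧ (X : k[X]) ^ 1 • v ≠ 0
  · obtain ⟨v, hv, hv'⟩ := h1
    obtain ⟨ψ, hψ, -⟩ := exists_functional (⊥ : Submodule k T.V₁) ((X : k[X]) ^ 1 • v) hv'
    refine ⟨.P20, exists_split_of_data hw (par_ok .P20) (p := ⟨2, 0, 0, 0, 0⟩) (v := v) (u₁ := 0)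
      (u₂ := 0) (T.h₁ v) (smul_zero _) (smul_zero _) (by simp [hv]) (ψ := ψ) (φ₁ := 0) (φ₂ := 0)
      (fun v => by rw [T.h₁, map_zero]) (fun _ => rfl) (fun _ => rfl) (fun v => ?_) (fun v => ?_)
      (fun _ => hψ) (fun h => absurd h (lt_irrefl _)) (fun h => absurd h (lt_irrefl _))⟩
    · exact ((congrArg ψ (T.h₁ v)).trans (map_zero ψ)).symm
    · exact ((congrArg ψ (T.h₁ v)).trans (map_zero ψ)).symm
  push Not at h1
  -- Now x annihilates ker f, and a kernel element outside xV₁ spans a summand P_1^0.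
  by_cases h2 : ∃ v, T.f v = 0 ∧ v ∉ LinearMap.range (Xpow k T.V₁ 1)
  · obtain ⟨v, hv, hv'⟩ := h2
    obtain ⟨ψ, hψ, hψ'⟩ := exists_functional _ v hv'
    refine ⟨.P10, exists_split_of_data hw (par_ok .P10) (p := ⟨1, 0, 0, 0, 0⟩) (v := v) (u₁ := 0)
      (u₂ := 0) (h1 v hv) (smul_zero _) (smul_zero _) (by simp [hv]) (ψ := ψ) (φ₁ := 0) (φ₂ := 0)
      (fun v => hψ' _ ⟨v, rfl⟩) (fun _ => rfl) (fun _ => rfl) (fun v => ?_) (fun v => ?_)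
      (fun _ => by simpa using hψ) (fun h => absurd h (lt_irrefl _))
      (fun h => absurd h (lt_irrefl _))⟩
    · exact (hψ' _ ⟨v, rfl⟩).symm
    · exact (hψ' _ ⟨v, rfl⟩).symm
  push Not at h2
  -- Now ker f ⊆ xV₁. If it is nonzero, take v with 0 ≠ xv ∈ ker f, and let n be the height of f(v)
  -- modulo W; this yields Z_2^{n+1}.
  by_cases h3 : ∃ y, T.f y = 0 ∧ y ≠ 0
  · obtain ⟨y, hy, hy0⟩ := h3
    obtain ⟨v, rfl⟩ := h2 y hy
    rw [Xpow_apply] at hy hy0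
    have hvW : T.f v ∉ W := by
      rintro ⟨z, hz, hz'⟩
      refine hy0 ?_
      have h4 := h1 (v - z) (by rw [map_sub, sub_eq_zero]; exact hz'.symm)
      rw [smul_sub] at h4
      have hz0 : (X : k[X]) ^ 1 • z = 0 := hz
      rwa [hz0, sub_zero] at h4
    obtain ⟨n, hn, h4, h5⟩ := exists_height T.h₂ W hvW
    obtain ⟨φ, hφ, hφ'⟩ := exists_functional _ _ h5
    obtain ⟨u, _, ⟨z, hz, rfl⟩, hu⟩ := mem_range_Xpow_sup.1 h4
    have hz0 : (X : k[X]) ^ 1 • z = 0 := hz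
    have hφW : ∀ v, (X : k[X]) ^ 1 • v = 0 → φ (T.f v) = 0 := fun v hv =>
      hφ' _ (mem_range_Xpow_sup.2 ⟨0, T.f v, (hW _).2 ⟨v, hv, rfl⟩, by simp⟩)
    have hφX : ∀ v, φ ((X : k[X]) ^ (n + 1) • v) = 0 := fun v =>
      hφ' _ (mem_range_Xpow_sup.2 ⟨v, 0, zero_mem _, by simp⟩)
    -- ψ(xv) = φ(f(v)) is a consistent prescription because φ vanishes on W.
    obtain ⟨ψ, hψ⟩ := exists_functional_comp (Xpow k T.V₁ 1) (φ ∘ₗ T.f.restrictScalars k) hφW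
    have hvz : T.f (v - z) = (X : k[X]) ^ n • u := by
      rw [map_sub, hu]
      exact add_sub_cancel_right _ _
    have hφv : φ (T.f (v - z)) ≠ 0 := by
      rw [map_sub, map_sub, hφW z hz0, sub_zero]
      exact hφ
    refine ⟨.Z (n + 1) (by omega) (by omega), exists_split_of_data hw (par_ok (.Z (n + 1) (by omega) (by omega)))
      (p := ⟨2, n + 1, n, 0, 0⟩) (v := v - z) (u₁ := u) (u₂ := 0) (T.h₁ _) ?_ (smul_zero _) ?_
      (ψ := ψ) (φ₁ := φ) (φ₂ := 0) (fun v => by rw [T.h₁, map_zero]) hφX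
      (fun _ => rfl) (fun v => ?_) (fun v => ?_) (fun _ => ?_) (fun _ => ?_)
      (fun h => absurd h (lt_irrefl _))⟩
    · change (X : k[X]) ^ (n + 1) • u = 0
      rw [add_comm, ← hmul, ← hvz, ← hf, smul_sub, hz0, sub_zero, hy]
    · change _ = (X : k[X]) ^ n • u + _
      rw [hvz, smul_zero, add_zero]
    · change φ (T.f v) = ψ ((X : k[X]) ^ (2 + n - (n + 1)) • v)
      rw [show 2 + n - (n + 1) = 1 by omega]
      exact (hψ v).symm
    · exact ((congrArg ψ (T.h₁ v)).trans (map_zero ψ)).symm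
    · exact (hψ (v - z)).trans_ne hφv
    · change φ ((X : k[X]) ^ n • u) ≠ 0
      rwa [← hvz]
  push Not at h3
  -- From here on f is injective. If xV₁ = 0 the summand is P_1 (when V₁ ≠ 0) or P_0; otherwise it
  -- is P_2 or B.
  by_cases h4 : ∃ v : T.V₁, (X : k[X]) ^ 1 • v ≠ 0
  swap
  · push Not at h4
    by_cases h5 : ∃ v : T.V₁, v ≠ 0
    · obtain ⟨v, hv⟩ := h5
      obtain ⟨n, hn, h5, h6⟩ := exists_height T.h₂ ⊥ (v := T.f v) fun h => hv (h3 v h)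
      obtain ⟨φ, hφ, hφ'⟩ := exists_functional _ _ h6
      obtain ⟨u, _, rfl, hu⟩ := mem_range_Xpow_sup.1 h5
      rw [add_zero] at hu
      have hφX : ∀ v, φ ((X : k[X]) ^ (n + 1) • v) = 0 := fun v =>
        hφ' _ (mem_range_Xpow_sup.2 ⟨v, 0, zero_mem _, by simp⟩)
      refine ⟨.P1 (n + 1) (by omega) (by omega), exists_split_of_data hw (par_ok (.P1 (n + 1) (by omega) (by omega)))
        (p := ⟨1, n + 1, n, 0, 0⟩) (v := v) (u₁ := u) (u₂ := 0) (h4 _) ?_ (smul_zero _) ?_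
        (ψ := φ ∘ₗ T.f.restrictScalars k) (φ₁ := φ) (φ₂ := 0) (fun v => by rw [h4, map_zero]) hφX
        (fun _ => rfl) (fun v => ?_) (fun v => ?_) (fun _ => ?_) (fun _ => ?_)
        (fun h => absurd h (lt_irrefl _))⟩
      · change (X : k[X]) ^ (n + 1) • u = 0
        rw [add_comm, ← hmul, ← hu, ← hf, h4, map_zero]
      · change _ = (X : k[X]) ^ n • u + _
        rw [hu, smul_zero, add_zero]
      · change φ (T.f v) = φ (T.f ((X : k[X]) ^ (1 + n - (n + 1)) • v))
        rw [show 1 + n - (n + 1) = 0 by omega, pow_zero, one_smul]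
      · change _ = φ (T.f ((X : k[X]) ^ 1 • v))
        rw [h4, map_zero, map_zero]
        rfl
      · change φ (T.f ((X : k[X]) ^ 0 • v)) ≠ 0
        rwa [pow_zero, one_smul]
      · change φ ((X : k[X]) ^ n • u) ≠ 0
        rwa [← hu]
    · push Not at h5
      classical
      have hex : ∃ n, ∀ u : T.V₂, (X : k[X]) ^ n • u = 0 := ⟨w, T.h₂⟩
      have h0 : Nat.find hex ≠ 0 := by
        intro h0
        have h6 := Nat.find_spec hex
        rw [h0] at h6
        rcases hT with hT | hT
        · obtain ⟨v, hv⟩ := exists_ne (0 : T.V₁)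
          exact hv (h5 v)
        · obtain ⟨v, hv⟩ := exists_ne (0 : T.V₂)
          exact hv (by simpa using h6 v)
      obtain ⟨n, hn⟩ := Nat.exists_eq_succ_of_ne_zero h0
      have hnw : n + 1 ≤ w := by
        rw [Nat.succ_eq_add_one] at hn
        rw [← hn]
        exact Nat.find_min' hex T.h₂
      have h6 : ∀ u : T.V₂, (X : k[X]) ^ (n + 1) • u = 0 := by
        have := Nat.find_spec hex
        rwa [hn] at this
      have h7 := Nat.find_min hex (m := n) (by omega)
      push Not at h7
      obtain ⟨u, hu⟩ := h7
      obtain ⟨φ, hφ, -⟩ := exists_functional (⊥ : Submodule k T.V₂) _ hu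
      have hf0 : ∀ v, T.f v = 0 := fun v => by rw [h5 v, map_zero]
      refine ⟨.P0 (n + 1) (by omega) hnw, exists_split_of_data hw (par_ok (.P0 (n + 1) (by omega) (by omega)))
        (p := ⟨0, n + 1, n + 1, 0, 0⟩) (v := 0) (u₁ := u) (u₂ := 0) (smul_zero _) (h6 u)
        (smul_zero _) ?_ (ψ := 0) (φ₁ := φ) (φ₂ := 0) (fun _ => rfl) (fun v => by rw [h6, map_zero])
        (fun _ => rfl) (fun v => ?_) (fun v => rfl) (fun h => absurd h (lt_irrefl _)) (fun _ => hφ)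
        (fun h => absurd h (lt_irrefl _))⟩
      · change _ = (X : k[X]) ^ (n + 1) • u + _
        rw [h6, smul_zero, add_zero, map_zero]
      · rw [hf0, map_zero]
        rfl
  · obtain ⟨v₀, hv₀⟩ := h4
    classical
    -- The heights of the nonzero elements f(xv) are bounded. The vector v is chosen below so that
    -- this height is maximal; it is n + 1 once n has been rewritten as n + 2.
    have hex : ∃ n, ∀ v, T.f ((X : k[X]) ^ 1 • v) ∈ LinearMap.range (Xpow k T.V₂ n) →
        (X : k[X]) ^ 1 • v = 0 := by
      refine ⟨w, ?_⟩
      rintro v ⟨u, hu⟩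
      rw [Xpow_apply, T.h₂] at hu
      exact h3 _ hu.symm
    obtain ⟨n, hn⟩ : ∃ n, Nat.find hex = n := ⟨_, rfl⟩
    have hmax := Nat.find_spec hex
    rw [hn] at hmax
    have hnw : n ≤ w := by
      rw [← hn]
      refine Nat.find_min' hex ?_
      rintro v ⟨u, hu⟩
      rw [Xpow_apply, T.h₂] at hu
      exact h3 _ hu.symm
    -- f(xv₀) = x f(v₀) has height at least 1, so the first excluded height is at least 2.
    have hn2 : 2 ≤ n := by
      by_contra hlt
      refine hv₀ (hmax v₀ ⟨(X : k[X]) ^ (1 - n) • T.f v₀, ?_⟩)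
      rw [Xpow_apply, hmul, show n + (1 - n) = 1 by omega, hf]
    obtain ⟨n, rfl⟩ := Nat.exists_eq_add_of_le' hn2
    have h5 := Nat.find_min hex (m := n + 1) (by omega)
    push Not at h5
    obtain ⟨v, ⟨u, hu⟩, hv⟩ := h5
    rw [Xpow_apply] at hu
    have hvW : T.f v ∉ W := by
      rintro ⟨z, hz, hz'⟩
      refine hv ?_
      have h4 := h3 (v - z) (by rw [map_sub, sub_eq_zero]; exact hz'.symm)
      rw [sub_eq_zero] at h4
      rw [h4]
      exact hz
    -- If f(v) lies in x^nV₂ up to W, one cyclic block suffices and the summand is P_2^{n+2}.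
    -- Otherwise f(v) has height m < n modulo W, and a second block N_{m+1} is needed: the summand
    -- is B_2^{n+2,m+1}.
    by_cases h6 : T.f v ∈ LinearMap.range (Xpow k T.V₂ n) ⊔ W
    · obtain ⟨u', _, ⟨z, hz, rfl⟩, hu'⟩ := mem_range_Xpow_sup.1 h6
      have hz0 : (X : k[X]) ^ 1 • z = 0 := hz
      have hvz : T.f (v - z) = (X : k[X]) ^ n • u' := by
        rw [map_sub, hu']
        exact add_sub_cancel_right _ _
      have hxv : (X : k[X]) ^ 1 • (v - z) = (X : k[X]) ^ 1 • v := by rw [smul_sub, hz0, sub_zero]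
      obtain ⟨φ, hφ, hφ'⟩ := exists_functional (LinearMap.range (Xpow k T.V₂ (n + 2)))
        (T.f ((X : k[X]) ^ 1 • v)) fun h => hv (hmax v h)
      refine ⟨.P2 (n + 2) (by omega) (by omega), exists_split_of_data hw (par_ok (.P2 (n + 2) (by omega) (by omega)))
        (p := ⟨2, n + 2, n, 0, 0⟩) (v := v - z) (u₁ := u') (u₂ := 0) (T.h₁ _) ?_ (smul_zero _) ?_
        (ψ := φ ∘ₗ T.f.restrictScalars k) (φ₁ := φ) (φ₂ := 0) (fun v => by rw [T.h₁, map_zero])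
        (fun v => hφ' _ ⟨v, rfl⟩)
        (fun _ => rfl) (fun v => ?_) (fun v => ?_) (fun _ => ?_) (fun _ => ?_)
        (fun h => absurd h (lt_irrefl _))⟩
      · change (X : k[X]) ^ (n + 2) • u' = 0
        rw [add_comm, ← hmul, ← hvz, ← hf, T.h₁, map_zero]
      · change _ = (X : k[X]) ^ n • u' + _
        rw [hvz, smul_zero, add_zero]
      · change φ (T.f v) = φ (T.f ((X : k[X]) ^ (2 + n - (n + 2)) • v))
        rw [show 2 + n - (n + 2) = 0 by omega, pow_zero, one_smul]
      · change _ = φ (T.f ((X : k[X]) ^ 2 • v))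
        rw [T.h₁, map_zero, map_zero]
        rfl
      · change φ (T.f ((X : k[X]) ^ 1 • (v - z))) ≠ 0
        rwa [hxv]
      · change φ ((X : k[X]) ^ (n + 1) • u') ≠ 0
        rwa [add_comm, ← hmul, ← hvz, ← hf, hxv]
    · obtain ⟨m, -, h7, h8⟩ := exists_height T.h₂ W hvW
      have hmn : m < n := by
        by_contra hlt
        refine h6 ?_
        obtain ⟨u', z, hz, hu'⟩ := mem_range_Xpow_sup.1 h7
        refine mem_range_Xpow_sup.2 ⟨(X : k[X]) ^ (m - n) • u', z, hz, ?_⟩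
        rw [hmul, show n + (m - n) = m by omega, hu']
      obtain ⟨φ₂, hφ, hφ'⟩ := exists_functional _ _ h8
      obtain ⟨u', _, ⟨z, hz, rfl⟩, hu'⟩ := mem_range_Xpow_sup.1 h7
      have hz0 : (X : k[X]) ^ 1 • z = 0 := hz
      have hvz : T.f (v - z) = (X : k[X]) ^ m • u' := by
        rw [map_sub, hu']
        exact add_sub_cancel_right _ _
      have hxv : (X : k[X]) ^ 1 • (v - z) = (X : k[X]) ^ 1 • v := by rw [smul_sub, hz0, sub_zero]
      have hφW : ∀ v, (X : k[X]) ^ 1 • v = 0 → φ₂ (T.f v) = 0 := fun v hv =>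
        hφ' _ (mem_range_Xpow_sup.2 ⟨0, T.f v, (hW _).2 ⟨v, hv, rfl⟩, by simp⟩)
      have hφX : ∀ v, φ₂ ((X : k[X]) ^ (m + 1) • v) = 0 := fun v =>
        hφ' _ (mem_range_Xpow_sup.2 ⟨v, 0, zero_mem _, by simp⟩)
      have hφX' : ∀ a, m + 1 ≤ a → ∀ v, φ₂ ((X : k[X]) ^ a • v) = 0 := fun a ha v => by
        rw [← Nat.add_sub_cancel' ha, ← hmul, hφX]
      -- φ₁ is prescribed by φ₁(f(xa)) = φ₂(f(a)) and φ₁(x^{n+2}b) = 0. Consistency is the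
      -- maximality of the height: f(xa) ∈ x^{n+2}V₂ forces xa = 0, so f(a) ∈ W, where φ₂ vanishes.
      obtain ⟨φ₁, hφ₁⟩ := exists_functional_comp
        (((T.f.restrictScalars k) ∘ₗ Xpow k T.V₁ 1).coprod (Xpow k T.V₂ (n + 2)))
        ((φ₂ ∘ₗ T.f.restrictScalars k) ∘ₗ LinearMap.fst k T.V₁ T.V₂) (by
          rintro ⟨a, b⟩ hab
          change T.f ((X : k[X]) ^ 1 • a) + (X : k[X]) ^ (n + 2) • b = 0 at hab
          change φ₂ (T.f a) = 0
          refine hφW a (hmax a ⟨-b, ?_⟩)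
          rw [Xpow_apply, smul_neg]
          exact (eq_neg_of_add_eq_zero_left hab).symm)
      have hφ₁a : ∀ a, φ₁ (T.f ((X : k[X]) ^ 1 • a)) = φ₂ (T.f a) := fun a => by
        have h9 := hφ₁ (a, 0)
        rw [LinearMap.coprod_apply, map_zero, add_zero] at h9
        exact h9
      have hφ₁b : ∀ b, φ₁ ((X : k[X]) ^ (n + 2) • b) = 0 := fun b => by
        have h9 := hφ₁ (0, b)
        rw [LinearMap.coprod_apply, map_zero, zero_add] at h9
        exact h9.trans (by simp)
      -- The difference u' - x^{n-m}u will generate the second block: x^m times it is f(v-z) - x^nu,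
      -- which x kills because x^{n+1}u = f(xv).
      have hu2 : T.f (v - z) - (X : k[X]) ^ n • u =
          (X : k[X]) ^ m • (u' - (X : k[X]) ^ (n - m) • u) := by
        rw [hvz, smul_sub, hmul, show m + (n - m) = n by omega]
      have hv2 : φ₂ (T.f v) ≠ 0 := hφ
      have hvz2 : φ₂ (T.f (v - z)) = φ₂ (T.f v) := by
        rw [map_sub, map_sub, hφW z hz0, sub_zero]
      refine ⟨.B (n + 2) (m + 1) (by omega) (by omega) (by omega),
        exists_split_of_data hw (par_ok (.B (n + 2) (m + 1) (by omega) (by omega) (by omega)))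
        (p := ⟨2, n + 2, n, m + 1, m⟩) (v := v - z) (u₁ := u)
        (u₂ := u' - (X : k[X]) ^ (n - m) • u) (T.h₁ _) ?_ ?_ ?_
        (ψ := φ₁ ∘ₗ T.f.restrictScalars k) (φ₁ := φ₁) (φ₂ := φ₂) (fun v => by rw [T.h₁, map_zero])
        hφ₁b hφX (fun v => ?_) (fun v => ?_) (fun _ => ?_) (fun _ => ?_) (fun _ => ?_)⟩
      · change (X : k[X]) ^ (n + 2) • u = 0
        rw [show n + 2 = 1 + (n + 1) by omega, ← hmul, hu, ← hf, hmul, T.h₁, map_zero]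
      · change (X : k[X]) ^ (m + 1) • (u' - (X : k[X]) ^ (n - m) • u) = 0
        rw [add_comm, ← hmul, ← hu2, smul_sub, ← hf, hxv, ← hu, hmul, add_comm 1 n, sub_self]
      · change _ = (X : k[X]) ^ n • u + (X : k[X]) ^ m • _
        rw [← hu2, add_sub_cancel]
      · change φ₁ (T.f v) = φ₁ (T.f ((X : k[X]) ^ (2 + n - (n + 2)) • v))
        rw [show 2 + n - (n + 2) = 0 by omega, pow_zero, one_smul]
      · change φ₂ (T.f v) = φ₁ (T.f ((X : k[X]) ^ (2 + m - (m + 1)) • v))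
        rw [show 2 + m - (m + 1) = 1 by omega, hφ₁a]
      · change φ₁ (T.f ((X : k[X]) ^ 1 • (v - z))) ≠ 0
        rwa [hxv, hφ₁a]
      · change φ₁ ((X : k[X]) ^ (n + 1) • u) ≠ 0
        rwa [hu, hφ₁a]
      · change φ₂ ((X : k[X]) ^ m • (u' - (X : k[X]) ^ (n - m) • u)) ≠ 0
        rw [← hu2, map_sub, hφX' n (by omega), sub_zero, hvz2]
        exact hv2

end Classification

/-! ### Local endomorphism rings, completeness and uniqueness of the list -/

section Concrete

variable {k : Type u} [Field k] {w : ℕ} {hw : 2 ≤ w}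

/-- The indecomposable modules in uniform notation. -/
abbrev Ind (k : Type u) [Field k] (I : Idx w) : Type u := (G k (par I) (par_ok I)).Carrier

instance [Finite k] {p : Par} (hp : p.Ok w) : Finite (G k p hp).Carrier :=
  inferInstanceAs (Finite (N k p.r × (N k p.m₁ × N k p.m₂)))

theorem card_G [Finite k] {p : Par} (hp : p.Ok w) :
    Nat.card (G k p hp).Carrier = Nat.card k ^ (p.r + (p.m₁ + p.m₂)) := by
  change Nat.card (N k p.r × (N k p.m₁ × N k p.m₂)) = _
  rw [Nat.card_prod, Nat.card_prod, card_N, card_N, card_N, pow_add, pow_add]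

theorem cf_one {m : ℕ} (hm : 0 < m) : cf m 0 (1 : N k m) = 1 := by
  change cf m 0 (Ideal.Quotient.mk _ 1) = 1
  rw [cf_mk, if_pos hm, coeff_one_zero]

theorem cf_C_smul (m i : ℕ) (c : k) (a : N k m) : cf m i ((C c : k[X]) • a) = c * cf m i a := by
  rw [C_smul_eq, map_smul, smul_eq_mul]

section End

variable {p : Par} {hp : p.Ok w}

/-- Compare the coefficients of x^{i₁} in f(φ(1)) = x^{i₁}φ(1,0) + x^{i₂}φ(0,1). The image of (0,1)
is killed by x^{m₂}, so it lies in degrees ≥ m₁-m₂ and does not contribute, as i₁-i₂ < m₁-m₂ if i₂ ≤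
i₁. -/
theorem cf_fstG_eq_left (φ : Triple.Hom hw (G k p hp) (G k p hp)) (h₀ : 0 < p.r) (h₁ : 0 < p.m₁) :
    cf p.m₁ 0 (sndG φ (1, 0)).1 = cf p.r 0 (fstG φ 1 : N k p.r) := by
  obtain ⟨-, -, h3, h4⟩ := homG_spec φ
  obtain ⟨z, hz⟩ : {z : N k p.r // z = fstG φ 1} := ⟨_, rfl⟩
  rw [← hz] at h4 ⊢
  have h5 : homOfElt (xpow k p.m₁ p.i₁) (pow_smul_xpow hp.le₁') z =
    (X : k[X]) ^ p.i₁ • (sndG φ (1, 0)).1 + (X : k[X]) ^ p.i₂ • (sndG φ (0, 1)).1 :=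
    congrArg Prod.fst h4
  have h6 : (X : k[X]) ^ p.m₂ • (sndG φ (0, 1)).1 = 0 := congrArg Prod.fst h3
  obtain ⟨h7, h8⟩ := hp.lt₁ h₀ h₁
  have h9 := congrArg (cf p.m₁ p.i₁) h5
  rw [cf_homOfElt_xpow hp.le₁', map_add, cf_X_pow_smul, cf_X_pow_smul, if_pos ⟨le_rfl, h7⟩,
    if_pos ⟨le_rfl, h7⟩, Nat.sub_self] at h9
  rw [h9]
  split_ifs with h10
  · rw [X_pow_smul_eq_zero_iff] at h6
    rw [h6 _ (h8 h10.1), add_zero]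
  · rw [add_zero]

/-- Compare the coefficients of x^{i₂}; the image of (1,0) contributes only from x^{i₁} on, and i₂ <
i₁. -/
theorem cf_fstG_eq_right (φ : Triple.Hom hw (G k p hp) (G k p hp)) (h₀ : 0 < p.r) (h₂ : 0 < p.m₂) :
    cf p.m₂ 0 (sndG φ (0, 1)).2 = cf p.r 0 (fstG φ 1 : N k p.r) := by
  obtain ⟨-, -, -, h4⟩ := homG_spec φ
  obtain ⟨z, hz⟩ : {z : N k p.r // z = fstG φ 1} := ⟨_, rfl⟩
  rw [← hz] at h4 ⊢
  have h5 : homOfElt (xpow k p.m₂ p.i₂) (pow_smul_xpow hp.le₂') z =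
    (X : k[X]) ^ p.i₁ • (sndG φ (1, 0)).2 + (X : k[X]) ^ p.i₂ • (sndG φ (0, 1)).2 :=
    congrArg Prod.snd h4
  obtain ⟨h7, h8⟩ := hp.lt₂ h₀ h₂
  have h9 := congrArg (cf p.m₂ p.i₂) h5
  rw [cf_homOfElt_xpow hp.le₂', map_add, cf_X_pow_smul, cf_X_pow_smul, if_pos ⟨le_rfl, h7⟩,
    if_neg (by omega), if_pos ⟨le_rfl, h7⟩, Nat.sub_self, zero_add] at h9
  exact h9.symm

variable (k hw hp) in
/-- The action of an endomorphism of `G` on its top. -/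
def topVal : Triple.Hom hw (G k p hp) (G k p hp) →+ k :=
  if 0 < p.r then
    { toFun := fun φ => cf p.r 0 (fstG φ 1 : N k p.r)
      map_zero' := map_zero (cf p.r 0)
      map_add' := fun φ φ' => map_add (cf p.r 0) (fstG φ 1 : N k p.r) (fstG φ' 1 : N k p.r) }
  else
    { toFun := fun φ => cf p.m₁ 0 (sndG φ (1, 0) : N k p.m₁ × N k p.m₂).1
      map_zero' := map_zero (cf p.m₁ 0)
      map_add' := fun φ φ' => map_add (cf p.m₁ 0) (sndG φ (1, 0) : N k p.m₁ × N k p.m₂).1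
        (sndG φ' (1, 0) : N k p.m₁ × N k p.m₂).1 }

theorem topVal_of_pos (h : 0 < p.r) (φ : Triple.Hom hw (G k p hp) (G k p hp)) :
    topVal k hw hp φ = cf p.r 0 (fstG φ 1 : N k p.r) := by
  rw [topVal, if_pos h]; rfl

theorem topVal_of_eq_zero (h : p.r = 0) (φ : Triple.Hom hw (G k p hp) (G k p hp)) :
    topVal k hw hp φ = cf p.m₁ 0 (sndG φ (1, 0) : N k p.m₁ × N k p.m₂).1 := by
  rw [topVal, if_neg (by omega)]; rfl

/-- All diagonal coefficients of an endomorphism agree with `topVal`. If it is nonzero,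
`injective_of_cf` applies; if it is zero, the socle of N_r (of N_{m₁} when r = 0) is killed. Hence
End G(p) is local with residue field k. -/
theorem topVal_eq_zero_iff [Finite k] (φ : Triple.Hom hw (G k p hp) (G k p hp)) :
    topVal k hw hp φ = 0 ↔ ¬ Function.Bijective φ := by
  constructor
  · intro h0 hb
    have hinj := (Triple.injective_hom_iff φ).1 hb.injective
    rcases Nat.eq_zero_or_pos p.r with h | h
    · rw [topVal_of_eq_zero h] at h0
      obtain ⟨h1, h2⟩ := hp.zero h
      have h3 : sndG φ ((X : k[X]) ^ (p.m₁ - 1) • (1, 0)) = 0 := by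
        rw [map_smul]
        refine Prod.ext (eq_zero_of_top fun _ => h0) (eq_zero_of_cf fun i hi => absurd hi (by omega))
      have h4 : ((X : k[X]) ^ (p.m₁ - 1) • (1, 0) : N k p.m₁ × N k p.m₂) = 0 :=
        hinj.2 (h3.trans (map_zero (sndG φ)).symm)
      have h5 := cf_zero_of_top (congrArg Prod.fst h4)
      rw [cf_one h1] at h5
      exact one_ne_zero h5
    · rw [topVal_of_pos h] at h0
      have h3 : fstG φ ((X : k[X]) ^ (p.r - 1) • 1) = (0 : N k p.r) := by
        rw [map_smul]
        exact eq_zero_of_top fun _ => h0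
      have h4 : ((X : k[X]) ^ (p.r - 1) • 1 : N k p.r) = 0 :=
        hinj.1 (h3.trans (map_zero (fstG φ)).symm)
      have h5 := cf_zero_of_top h4
      rw [cf_one h] at h5
      exact one_ne_zero h5
  · intro hb
    by_contra h0
    refine hb ((Finite.injective_iff_bijective).1 ?_)
    rcases Nat.eq_zero_or_pos p.r with h | h
    · rw [topVal_of_eq_zero h] at h0
      obtain ⟨h1, h2⟩ := hp.zero h
      exact injective_of_cf φ (by omega) (fun _ => h0) (by omega)
    · rw [topVal_of_pos h] at h0
      exact injective_of_cf φ (fun _ => h0) (fun h1 => (cf_fstG_eq_left φ h h1).trans_ne h0)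
        (fun h1 => (cf_fstG_eq_right φ h h1).trans_ne h0)

theorem topVal_surjective : Function.Surjective (topVal k hw hp) := by
  intro c
  refine ⟨Triple.mkHom (LinearMap.lsmul k[X] (G k p hp).V₁ (C c))
    (LinearMap.lsmul k[X] (G k p hp).V₂ (C c)) (fun v => by simp), ?_⟩
  rcases Nat.eq_zero_or_pos p.r with h | h
  · rw [topVal_of_eq_zero h]
    refine (cf_C_smul p.m₁ 0 c 1).trans ?_
    rw [cf_one (hp.zero h).1, mul_one]
  · rw [topVal_of_pos h]
    refine (cf_C_smul p.r 0 c 1).trans ?_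
    rw [cf_one h, mul_one]

theorem card_ker_topVal [Finite k] :
    Nat.card (topVal k hw hp).ker * Nat.card k = Nat.card k ^ p.hom p := by
  rw [← card_hom_G (hw := hw) hp hp, ← AddSubgroup.card_mul_index (topVal k hw hp).ker,
    AddSubgroup.index_ker, AddMonoidHom.range_eq_top.2 topVal_surjective,
    Nat.card_congr (AddSubgroup.topEquiv (G := k)).toEquiv]

end End

/-- Induction on the order: `exists_split` splits off an indecomposable, and the complement is
smaller. -/
theorem exists_equiv_mSum [Finite k] (M : Type u) [AddCommGroup M] [Module (Lam k 2 w hw)ᵐᵒᵖ M]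
    [Finite M] : ∃ a : Idx w → ℕ, Nonempty (M ≃ₗ[(Lam k 2 w hw)ᵐᵒᵖ] MSum (Ind k) a) := by
  classical
  have := Fintype.ofFinite (Idx w)
  induction hn : Nat.card M using Nat.strong_induction_on generalizing M with
  | _ n ih =>
    rcases subsingleton_or_nontrivial M with hM | hM
    · have := subsingleton_mSum_zero (X := fun I : Idx w => Ind k I)
      exact ⟨0, ⟨LinearEquiv.ofSubsingleton _ _⟩⟩
    · obtain ⟨e⟩ := nonempty_equiv_tripleOf k hw M
      set T := tripleOf k hw M
      let _ : Module k T.V₁ := Module.compHom T.V₁ (algebraMap k k[X])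
      let _ : Module k T.V₂ := Module.compHom T.V₂ (algebraMap k k[X])
      have : IsScalarTower k k[X] T.V₁ := ⟨fun a p v => by
        rw [smul_eq_C_mul, mul_smul]; rfl⟩
      have : IsScalarTower k k[X] T.V₂ := ⟨fun a p v => by
        rw [smul_eq_C_mul, mul_smul]; rfl⟩
      have hT : Nontrivial T.V₁ ∨ Nontrivial T.V₂ := by
        by_contra hcon
        rw [not_or, not_nontrivial_iff_subsingleton, not_nontrivial_iff_subsingleton] at hcon
        obtain ⟨h1, h2⟩ := hcon
        have h3 : Subsingleton T.Carrier := inferInstanceAs (Subsingleton (T.V₁ × T.V₂))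
        exact not_subsingleton M e.toEquiv.subsingleton
      obtain ⟨I, s, r, hsr⟩ := exists_split (hw := hw) T hT
      let g : Ind k I ≃ₗ[(Lam k 2 w hw)ᵐᵒᵖ] Ind k I :=
        LinearEquiv.ofBijective (r ∘ₗ s) ((Finite.injective_iff_bijective).1 hsr)
      let s' : Ind k I →ₗ[(Lam k 2 w hw)ᵐᵒᵖ] M := e.symm.toLinearMap ∘ₗ s
      have hs' : Function.Injective s' := e.symm.injective.comp (Function.Injective.of_comp hsr)
      let U := LinearMap.range s'
      let r' : M →ₗ[(Lam k 2 w hw)ᵐᵒᵖ] U :=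
        s'.rangeRestrict ∘ₗ g.symm.toLinearMap ∘ₗ r ∘ₗ e.toLinearMap
      obtain ⟨e₁, -⟩ := nonempty_prod_equiv_of_retraction U r' (by
        rintro ⟨_, x, rfl⟩
        refine Subtype.ext ?_
        change s' (g.symm (r (e (e.symm (s x))))) = s' x
        rw [LinearEquiv.apply_symm_apply]
        congr 1
        exact g.symm_apply_apply x)
      have hcI : 1 < Nat.card (Ind k I) := by
        rw [card_G]
        refine Nat.one_lt_pow ?_ Finite.one_lt_card
        cases I <;> simp only [par] <;> omega
      have hcU : Nat.card (Ind k I) = Nat.card U :=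
        Nat.card_congr (LinearEquiv.ofInjective s' hs').toEquiv
      have hlt : Nat.card (M ⧸ U) < n := by
        have h1 := Submodule.card_eq_card_quotient_mul_card U
        have h2 : 0 < Nat.card (M ⧸ U) := Nat.card_pos
        rw [← hn, h1, ← hcU]
        nlinarith
      obtain ⟨a, ⟨e₂⟩⟩ := ih _ hlt (M ⧸ U) rfl
      obtain ⟨e₃⟩ := nonempty_mSumSingle (S := (Lam k 2 w hw)ᵐᵒᵖ) (X := fun I : Idx w => Ind k I) I
      exact ⟨Pi.single I 1 + a, ⟨e₁.symm.trans
        ((((LinearEquiv.ofInjective s' hs').symm.trans e₃.symm).prodCongr e₂).trans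
          (mSumAdd _ _).symm)⟩⟩

/-- The dimension of an indecomposable module. -/
def dimI (I : Idx w) : ℕ := (par I).r + ((par I).m₁ + (par I).m₂)

/-- The dimension of the space of homomorphisms between indecomposable modules. -/
def homI (I J : Idx w) : ℕ := (par I).hom (par J)

theorem Par.hom_zero_left (m : ℕ) (p : Par) :
    Par.hom ⟨0, m, m, 0, 0⟩ p = min m p.m₁ + min m p.m₂ := by
  simp only [Par.hom, Par.e, Par.c]
  omega

theorem Par.hom_of_two (p : Par) (hp : p.r ≤ 2) :
    Par.hom ⟨2, 0, 0, 0, 0⟩ p = p.r - max (p.m₁ - p.i₁) (p.m₂ - p.i₂) := by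
  simp only [Par.hom, Par.e, Par.c]
  omega

theorem homI_P0 (m : ℕ) (h1 : 1 ≤ m) (h2 : m ≤ w) (J : Idx w) :
    homI (.P0 m h1 h2) J = min m (par J).m₁ + min m (par J).m₂ :=
  Par.hom_zero_left m (par J)

theorem homI_P20 (J : Idx w) : homI .P20 J =
    (par J).r - max ((par J).m₁ - (par J).i₁) ((par J).m₂ - (par J).i₂) :=
  Par.hom_of_two _ (par_ok J).r_le

/-- Maps from P_0^t measure min(t, m₁) + min(t, m₂), which determines m₁ and m₂. The remaining
ambiguity for given r is between P_2^m and Z_2^m, and maps from P_2^0, which measure the kernel of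
the structure map, resolve it. -/
theorem eq_of_homI {I J : Idx w} (hr : (par I).r = (par J).r) (h : ∀ t, homI t I = homI t J) :
    I = J := by
  have hI := par_ok I
  have hJ := par_ok J
  have h0 : ∀ t, min t (par I).m₁ + min t (par I).m₂ = min t (par J).m₁ + min t (par J).m₂ := by
    intro t
    by_cases ht : 1 ≤ t
    · by_cases ht' : t ≤ w
      · simpa only [homI_P0] using h (.P0 t ht ht')
      · by_cases hw : 1 ≤ w
        · have h1 := h (.P0 w hw le_rfl)
          rw [homI_P0, homI_P0] at h1
          have := hI.le₁
          have := hI.le₂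
          have := hJ.le₁
          have := hJ.le₂
          omega
        · have := hI.le₁
          have := hI.le₂
          have := hJ.le₁
          have := hJ.le₂
          omega
    · omega
  have hm : (par I).m₁ = (par J).m₁ ∧ (par I).m₂ = (par J).m₂ := by
    have h1 := h0 (par I).m₁
    have h2 := h0 (par J).m₁
    have h3 := h0 ((par I).m₁ + (par J).m₁)
    have h4 := hI.lt
    have h5 := hJ.lt
    omega
  have h1 := h .P20
  rw [homI_P20, homI_P20] at h1
  obtain ⟨h2, h3⟩ := hm
  clear h h0 hI hJ
  cases I <;> cases J <;> simp only [par] at * <;>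
    first | omega | (subst_vars; rfl)

theorem dimI_pos (I : Idx w) : 0 < dimI I := by
  cases I <;> simp only [dimI, par] <;> omega

instance : Fintype (Idx w) := Fintype.ofFinite _

instance : DecidableEq (Idx w) := Classical.decEq _

theorem card_epart_idem₁_G {p : Par} (hp : p.Ok w) :
    Nat.card (epart (idem₁ k hw) (G k p hp).Carrier) = Nat.card k ^ p.r :=
  Triple.card_epart_idem₁.trans (card_N _)

theorem card_epart_idem₂_G {p : Par} (hp : p.Ok w) :
    Nat.card (epart (idem₂ k hw) (G k p hp).Carrier) = Nat.card k ^ (p.m₁ + p.m₂) := by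
  refine Triple.card_epart_idem₂.trans ?_
  change Nat.card (N k p.m₁ × N k p.m₂) = _
  rw [Nat.card_prod, card_N, card_N, pow_add]

theorem card_epart₁ (I : Idx w) :
    Nat.card (epart (idem₁ k hw) (Ind k I)) = Nat.card k ^ (par I).r :=
  card_epart_idem₁_G _

theorem card_epart₂ (I : Idx w) :
    Nat.card (epart (idem₂ k hw) (Ind k I)) = Nat.card k ^ ((par I).m₁ + (par I).m₂) :=
  card_epart_idem₂_G _

theorem eq_of_equiv_ind [Finite k] {I J : Idx w}
    (h : Nonempty (Ind k I ≃ₗ[(Lam k 2 w hw)ᵐᵒᵖ] Ind k J)) : I = J := by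
  obtain ⟨e⟩ := h
  have hq : 1 < Nat.card k := Finite.one_lt_card
  refine eq_of_homI (Nat.pow_right_injective hq ?_) fun t => Nat.pow_right_injective hq ?_
  · change Nat.card k ^ _ = Nat.card k ^ _
    rw [← card_epart₁ (hw := hw), ← card_epart₁ (hw := hw)]
    exact card_epart_congr _ e
  · change Nat.card k ^ (par t).hom _ = Nat.card k ^ (par t).hom _
    rw [← card_hom_G (hw := hw) (par_ok t) (par_ok I), ← card_hom_G (hw := hw) (par_ok t) (par_ok J)]
    exact homCard_congr (LinearEquiv.refl _ _) e

/-- The projections of a proper decomposition would be nonunits with sum 1, but `topVal` is additive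
and vanishes on nonunits. -/
theorem eq_single_of_equiv [Finite k] {I : Idx w} {a : Idx w → ℕ}
    (h : Nonempty (Ind k I ≃ₗ[(Lam k 2 w hw)ᵐᵒᵖ] MSum (Ind k) a)) : a = Pi.single I 1 := by
  obtain ⟨e⟩ := h
  have hcard : ∀ J : Idx w, 1 < Nat.card (Ind k J) := fun J => by
    rw [card_G]
    exact Nat.one_lt_pow (dimI_pos J).ne' Finite.one_lt_card
  have ha : a ≠ 0 := by
    rintro rfl
    have := subsingleton_mSum_zero (X := fun I : Idx w => Ind k I)
    have h1 := hcard I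
    rw [Nat.card_congr e.toEquiv, Nat.card_of_subsingleton (0 : MSum (fun I => Ind k I) 0)] at h1
    exact lt_irrefl _ h1
  obtain ⟨J, hJ⟩ := Function.ne_iff.1 ha
  obtain ⟨b, rfl⟩ := exists_eq_single_add hJ
  obtain ⟨e₁⟩ := nonempty_mSumSingle (S := (Lam k 2 w hw)ᵐᵒᵖ) (X := fun I : Idx w => Ind k I) J
  let e₂ : Ind k I ≃ₗ[(Lam k 2 w hw)ᵐᵒᵖ] Ind k J × MSum (Ind k) b :=
    (e.trans (mSumAdd _ _)).trans (e₁.prodCongr (LinearEquiv.refl _ _))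
  by_cases hb : b = 0
  · subst hb
    have := subsingleton_mSum_zero (X := fun I : Idx w => Ind k I)
    have h1 : I = J := eq_of_equiv_ind (k := k) (hw := hw)
      ⟨e₂.trans (LinearEquiv.ofBijective (LinearMap.fst _ _ _)
        ⟨fun x y hxy => Prod.ext hxy (Subsingleton.elim _ _), fun x => ⟨(x, 0), rfl⟩⟩)⟩
    rw [h1, add_zero]
  · exfalso
    obtain ⟨J', hJ'⟩ := Function.ne_iff.1 hb
    obtain ⟨b', rfl⟩ := exists_eq_single_add hJ'
    obtain ⟨e₃⟩ := nonempty_mSumSingle (S := (Lam k 2 w hw)ᵐᵒᵖ) (X := fun I : Idx w => Ind k I) J'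
    have hne : Nontrivial (MSum (fun I => Ind k I) (Pi.single J' 1 + b')) := by
      have h2 : Nontrivial (Ind k J') := (Finite.one_lt_card_iff_nontrivial).1 (hcard J')
      exact ((mSumAdd (S := (Lam k 2 w hw)ᵐᵒᵖ) (X := fun I => Ind k I) _ _).trans
        (e₃.prodCongr (LinearEquiv.refl _ _))).toEquiv.nontrivial
    have hne' : Nontrivial (Ind k J) := (Finite.one_lt_card_iff_nontrivial).1 (hcard J)
    obtain ⟨x, hx⟩ := exists_ne (0 : Ind k J)
    obtain ⟨y, hy⟩ := exists_ne (0 : MSum (fun I => Ind k I) (Pi.single J' 1 + b'))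
    let π₁ : Triple.Hom hw (G k (par I) (par_ok I)) (G k (par I) (par_ok I)) :=
      e₂.symm.toLinearMap ∘ₗ (LinearMap.inl _ _ _ ∘ₗ LinearMap.fst _ _ _) ∘ₗ e₂.toLinearMap
    let π₂ : Triple.Hom hw (G k (par I) (par_ok I)) (G k (par I) (par_ok I)) :=
      e₂.symm.toLinearMap ∘ₗ (LinearMap.inr _ _ _ ∘ₗ LinearMap.snd _ _ _) ∘ₗ e₂.toLinearMap
    have h1 : topVal k hw (par_ok I) π₁ = 0 := by
      rw [topVal_eq_zero_iff]
      intro hb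
      have h5 : π₁ (e₂.symm (0, y)) = π₁ (e₂.symm 0) := by simp [π₁]
      exact hy (congrArg Prod.snd (e₂.symm.injective (hb.injective h5)))
    have h2 : topVal k hw (par_ok I) π₂ = 0 := by
      rw [topVal_eq_zero_iff]
      intro hb
      have h5 : π₂ (e₂.symm (x, 0)) = π₂ (e₂.symm 0) := by simp [π₂]
      exact hx (congrArg Prod.fst (e₂.symm.injective (hb.injective h5)))
    have h3 : π₁ + π₂ = LinearMap.id := by
      refine LinearMap.ext fun z => ?_
      change e₂.symm ((e₂ z).1, 0) + e₂.symm (0, (e₂ z).2) = z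
      rw [← map_add, Prod.mk_add_mk, zero_add, add_zero]
      exact e₂.symm_apply_apply z
    have h4 : topVal k hw (par_ok I) LinearMap.id = 0 := by rw [← h3, map_add, h1, h2, add_zero]
    rw [topVal_eq_zero_iff] at h4
    exact h4 Function.bijective_id

/-- The category of modules satisfies the abstract assumptions. -/
theorem sys (w : ℕ) (hw : 2 ≤ w) : FamSys (fun F : FinField.{u} => (Lam F.K 2 w hw)ᵐᵒᵖ)
    (fun F (I : Idx w) => Ind F.K I) dimI homI := fun F =>
  { one_lt := Finite.one_lt_card
    card := fun _ => card_G _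
    d_pos := dimI_pos
    card_hom := fun _ _ => card_hom_G _ _
    complete := fun M => exists_equiv_mSum M
    indec := fun _ _ h => eq_single_of_equiv h
    nonunits := fun I => ⟨(topVal F.K hw (par_ok I)).ker,
      fun φ => AddMonoidHom.mem_ker.trans (topVal_eq_zero_iff φ), card_ker_topVal⟩ }

end Concrete

/-! ### Numerical restrictions on middle terms and counts of special submodules -/

section Tools

variable {S : Type*} [Ring S] {ι : Type} {X : ι → Type u} [∀ i, AddCommGroup (X i)]
  [∀ i, Module S (X i)] [Fintype ι] [DecidableEq ι] {q : ℕ} {d : ι → ℕ} {h : ι → ι → ℕ}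

theorem wt₂_single_right (h : ι → ι → ℕ) (a : ι → ℕ) (j : ι) :
    wt₂ h a (Pi.single j 1) = wt (fun i => h i j) a := by
  simp only [wt₂, wt_single]

namespace Sys

theorem le_add_of_hall (σ : Sys S X q d h) {a b c : ι → ℕ} (hh : hall S X a b c ≠ 0) (t : ι) :
    wt (h t) b ≤ wt (h t) a + wt (h t) c := by
  have := σ.hom_le_of_hall hh (Pi.single t 1)
  simpa only [wt₂_single_left] using this

theorem le_of_hall (σ : Sys S X q d h) {a b c : ι → ℕ} (hh : hall S X a b c ≠ 0) (t : ι) :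
    wt (h t) a ≤ wt (h t) b := by
  have := σ.hom_sub_le_of_hall hh (Pi.single t 1)
  simpa only [wt₂_single_left] using this

theorem quot_le_of_hall (σ : Sys S X q d h) {a b c : ι → ℕ} (hh : hall S X a b c ≠ 0) (t : ι) :
    wt (fun i => h i t) c ≤ wt (fun i => h i t) b := by
  have := σ.quot_hom_le_of_hall hh (Pi.single t 1)
  simpa only [wt₂_single_right] using this

theorem le_add_of_hall' (σ : Sys S X q d h) {a b c : ι → ℕ} (hh : hall S X a b c ≠ 0) (t : ι) :
    wt (fun i => h i t) b ≤ wt (fun i => h i t) a + wt (fun i => h i t) c := by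
  have := σ.finite_mSum b
  have := σ.finite t
  obtain ⟨U, hU, hQ⟩ := σ.hall_ne_zero_iff.1 hh
  have := hom_le_mul' (T := X t) U
  rw [σ.card_hom_ty, σ.card_hom_ty, σ.card_hom_ty, ← pow_add, σ.pow_le, σ.ty_mSum,
    σ.ty_eq_iff.2 hU, σ.ty_eq_iff.2 hQ, σ.ty_X, wt₂_single_right, wt₂_single_right,
    wt₂_single_right] at this
  omega

/-- A submodule does not separate two modules that the ambient module does not separate. -/
theorem eq_of_hall_of_surjective (σ : Sys S X q d h) {a b c : ι → ℕ} (hh : hall S X a b c ≠ 0)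
    {i j : ι} {p : X i →ₗ[S] X j} (hp : Function.Surjective p) (hb : wt (h i) b = wt (h j) b) :
    wt (h i) a = wt (h j) a := by
  have := σ.finite_mSum b
  have := σ.finite
  obtain ⟨U, hU, -⟩ := σ.hall_ne_zero_iff.1 hh
  have h1 := hom_eq_of_surjective (M := MSum X b) hp (by
    rw [σ.card_hom_ty, σ.card_hom_ty, σ.ty_X, σ.ty_X, σ.ty_mSum, wt₂_single_left,
      wt₂_single_left, hb]) U
  rw [σ.card_hom_ty, σ.card_hom_ty, σ.ty_X, σ.ty_X, σ.ty_eq_iff.2 hU, wt₂_single_left,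
      wt₂_single_left] at h1
  exact σ.pow_inj h1

/-- If all homomorphisms from a submodule extend along an embedding into an indecomposable module,
then the cokernel of this embedding maps to the quotient. -/
theorem ne_zero_of_hall_of_extension (σ : Sys S X q d h) {b c : ι → ℕ} {i z : ι}
    (hh : hall S X (Pi.single i 1) b c ≠ 0) {s : X i →ₗ[S] X z} (hs : Function.Injective s)
    (hiz : i ≠ z) {j : ι} (hq : Nonempty ((X z ⧸ LinearMap.range s) ≃ₗ[S] X j))
    (hb : wt (h z) b = wt (h j) b + wt (h i) b) : wt (h j) c ≠ 0 := by
  intro h0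
  have := σ.finite_mSum
  have := σ.finite
  obtain ⟨U, ⟨eU⟩, ⟨eQ⟩⟩ := σ.hall_ne_zero_iff.1 hh
  obtain ⟨ei⟩ := nonempty_mSumSingle (S := S) (X := X) i
  obtain ⟨ez⟩ := hq
  let eR := LinearEquiv.ofInjective s hs
  -- The count `hb` says that every map from X_i to the middle term extends along s, in particular
  -- the inclusion of U ≅ X_i.
  have hsurj := restrictHom_surjective (T := MSum X b) (LinearMap.range s) (by
    rw [homCard_congr ez (LinearEquiv.refl S _), homCard_congr eR.symm (LinearEquiv.refl S _),
      σ.card_hom_ty, σ.card_hom_ty, σ.card_hom_ty, σ.ty_X, σ.ty_X, σ.ty_X, σ.ty_mSum,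
      wt₂_single_left, wt₂_single_left, wt₂_single_left, ← pow_add, hb])
  let g : X i ≃ₗ[S] U := ei.symm ≪≫ₗ eU.symm
  obtain ⟨ψ, hψ⟩ := hsurj (U.subtype ∘ₗ g.toLinearMap ∘ₗ eR.symm.toLinearMap)
  have hψ' : ∀ x, ψ (s x) = g x := fun x => by
    have h1 := LinearMap.congr_fun hψ (eR x)
    have h2 : eR.symm (eR x) = x := eR.symm_apply_apply x
    simp only [LinearMap.comp_apply, LinearEquiv.coe_coe, h2] at h1
    exact h1
  -- The composite X_z → M → M/U vanishes on the image of s, so it factors through X_j and is zero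
  -- if Hom(X_j, M/U) = 0. The extension then has values in U and splits s, against the
  -- indecomposability of X_z.
  have hcard : Nat.card ((X z ⧸ LinearMap.range s) →ₗ[S] (MSum X b ⧸ U)) = 1 := by
    rw [homCard_congr ez eQ, σ.card_hom_ty, σ.ty_X, σ.ty_mSum, wt₂_single_left, h0, pow_zero]
  have hsub := (Nat.card_eq_one_iff_unique.1 hcard).1
  have hle : LinearMap.range s ≤ LinearMap.ker (U.mkQ ∘ₗ ψ) := by
    rintro _ ⟨x, rfl⟩
    rw [LinearMap.mem_ker, LinearMap.comp_apply, hψ']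
    simp
  have hmem : ∀ y, ψ y ∈ U := fun y => by
    have h1 : (LinearMap.range s).liftQ (U.mkQ ∘ₗ ψ) hle = 0 := Subsingleton.elim _ _
    have h2 := LinearMap.congr_fun h1 ((LinearMap.range s).mkQ y)
    simpa using h2
  have hb := σ.eq_of_split s (g.symm.toLinearMap ∘ₗ ψ.codRestrict U hmem) (by
    have h1 : (g.symm.toLinearMap ∘ₗ ψ.codRestrict U hmem) ∘ₗ s = LinearMap.id := by
      refine LinearMap.ext fun x => ?_
      have : ψ.codRestrict U hmem (s x) = g x := Subtype.ext (hψ' x)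
      simp [this]
    rw [h1]
    exact Function.bijective_id)
  exact hiz hb.1

theorem hall_eq_subN (σ : Sys S X q d h) {a b c : ι → ℕ}
    (hc : ∀ c', hall S X a b c' ≠ 0 → c' = c) : hall S X a b c = subN S X b a := by
  have := σ.finite_mSum b
  refine Nat.card_congr (Equiv.subtypeEquivRight fun U => ⟨fun hU => hU.1, fun hU => ⟨hU, ?_⟩⟩)
  refine σ.ty_eq_iff.1 (hc _ ?_)
  exact σ.hall_ne_zero_iff.2 ⟨U, hU, σ.nonempty_equiv_ty⟩

/-- The element s plays the role of a generator of a simple socle: a map into a direct sum fails to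
be injective exactly when each component kills s. -/
theorem card_injective (σ : Sys S X q d h) {i : ι} (s : X i) {g : ι → ℕ}
    (hs : ∀ (b : ι → ℕ) (φ : X i →ₗ[S] MSum X b), Function.Injective φ ↔ φ s ≠ 0)
    (hg : ∀ j, Nat.card {φ : X i →ₗ[S] X j // φ s = 0} = q ^ g j) (b : ι → ℕ) :
    Nat.card {φ : X i →ₗ[S] MSum X b // Function.Injective φ} + q ^ wt g b =
      q ^ wt (h i) b := by
  classical
  have := σ.finite_mSum
  have := σ.finite
  have h1 : Nat.card {φ : X i →ₗ[S] MSum X b // ¬ Function.Injective φ} = q ^ wt g b := by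
    have e : {φ : X i →ₗ[S] MSum X b // ¬ Function.Injective φ} ≃
        ∀ k, Fin (b k) → {φ : X i →ₗ[S] X k // φ s = 0} :=
      { toFun := fun φ k l => ⟨LinearMap.proj l ∘ₗ LinearMap.proj k ∘ₗ φ.1, by
          have := φ.2
          rw [hs, not_not] at this
          simp [this]⟩
        invFun := fun f => ⟨LinearMap.pi fun k => LinearMap.pi fun l => (f k l).1, by
          rw [hs, not_not]
          funext k l
          exact (f k l).2⟩
        left_inv := fun φ => rfl
        right_inv := fun f => rfl }
    rw [Nat.card_congr e, Nat.card_pi, wt, ← Finset.prod_pow_eq_pow_sum]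
    refine Finset.prod_congr rfl fun k _ => ?_
    rw [Nat.card_pi]
    simp [hg, mul_comm (b k), pow_mul]
  rw [← h1, ← Nat.card_sum, Nat.card_congr (Equiv.sumCompl _), σ.card_hom_ty, σ.ty_X, σ.ty_mSum,
    wt₂_single_left]

/-- The number of submodules isomorphic to a module with a simple socle. -/
theorem subN_mul (σ : Sys S X q d h) {i : ι} (s : X i) {g : ι → ℕ}
    (hs : ∀ (b : ι → ℕ) (φ : X i →ₗ[S] MSum X b), Function.Injective φ ↔ φ s ≠ 0)
    (hg : ∀ j, Nat.card {φ : X i →ₗ[S] X j // φ s = 0} = q ^ g j) (b : ι → ℕ) :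
    subN S X b (Pi.single i 1) * (q ^ h i i - q ^ g i) = q ^ wt (h i) b - q ^ wt g b := by
  have := σ.finite_mSum
  have := σ.finite
  obtain ⟨e⟩ := nonempty_mSumSingle (S := S) (X := X) i
  have key : ∀ b : ι → ℕ, subN S X b (Pi.single i 1) * autCard S (X i) =
      q ^ wt (h i) b - q ^ wt g b := fun b => by
    have h1 := card_injWith (S := S) (A := X i) (M := MSum X b) (fun _ => True)
    have h2 := σ.card_injective s hs hg b
    have h3 : subN S X b (Pi.single i 1) =
        Nat.card {U : Submodule S (MSum X b) // Nonempty (U ≃ₗ[S] X i) ∧ True} :=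
      Nat.card_congr (Equiv.subtypeEquivRight fun U => by
        rw [and_true]
        exact ⟨fun ⟨f⟩ => ⟨f ≪≫ₗ e⟩, fun ⟨f⟩ => ⟨f ≪≫ₗ e.symm⟩⟩)
    rw [h3, ← h1]
    simp only [and_true]
    omega
  -- The same count with X_i itself as target gives |Aut X_i|.
  have h4 := key (Pi.single i 1)
  rw [σ.subN_self, one_mul, wt_single, wt_single] at h4
  rw [← h4, key]

theorem subN_eq_one (σ : Sys S X q d h) {i : ι} (s : X i) {g : ι → ℕ}
    (hs : ∀ (b : ι → ℕ) (φ : X i →ₗ[S] MSum X b), Function.Injective φ ↔ φ s ≠ 0)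
    (hg : ∀ j, Nat.card {φ : X i →ₗ[S] X j // φ s = 0} = q ^ g j) {b : ι → ℕ}
    (h₁ : wt (h i) b = h i i) (h₂ : wt g b = g i) (h₃ : g i < h i i) :
    subN S X b (Pi.single i 1) = 1 := by
  have h4 := σ.subN_mul s hs hg b
  rw [h₁, h₂] at h4
  have h5 : q ^ g i < q ^ h i i := Nat.pow_lt_pow_right σ.one_lt h₃
  exact Nat.eq_of_mul_eq_mul_right (by omega) (h4.trans (one_mul _).symm)

/-- The number of generators of a cyclic indecomposable module. -/
theorem card_generators (σ : Sys S X q d h) {i : ι} {ε : S} {g : X i} (hε : g ∈ epart ε (X i))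
    (hg : Submodule.span S {g} = ⊤) (hc : Nat.card (epart ε (X i)) = q ^ h i i) :
    Nat.card {v : epart ε (X i) // Submodule.span S {v.1} = ⊤} = q ^ h i i - q ^ (h i i - 1) := by
  have := σ.finite i
  -- Evaluation at the generator g identifies End X_i with εX_i, by injectivity and equal orders.
  -- The element φ(g) generates exactly when φ is a unit.
  let ev : (X i →ₗ[S] X i) → epart ε (X i) := fun φ => ⟨φ g, by
    rw [mem_epart, ← map_smul, mem_epart.1 hε]⟩
  have hinj : Function.Injective ev := fun φ ψ hφψ => by
    have h1 : φ g = ψ g := congrArg Subtype.val hφψ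
    refine LinearMap.ext_on_range (v := fun _ : Unit => g) (by simpa using hg) fun _ => h1
  have hb : Function.Bijective ev :=
    (Nat.bijective_iff_injective_and_card _).2 ⟨hinj, by rw [σ.card_hom, hc]⟩
  obtain ⟨N, hN, hNc⟩ := σ.nonunits i
  have hspan : ∀ φ : X i →ₗ[S] X i, Submodule.span S {(ev φ).1} = ⊤ ↔ Function.Bijective φ := by
    intro φ
    have h1 : Submodule.span S {(ev φ).1} = LinearMap.range φ := by
      rw [← Submodule.map_top, ← hg, Submodule.map_span, Set.image_singleton]
    rw [h1, LinearMap.range_eq_top]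
    exact Finite.surjective_iff_bijective
  have h1 : Nat.card {v : epart ε (X i) // Submodule.span S {v.1} = ⊤} =
      Nat.card {φ : X i →ₗ[S] X i // ¬ φ ∈ N} := by
    refine (Nat.card_congr ((Equiv.ofBijective ev hb).subtypeEquiv fun φ => ?_)).symm
    rw [hN, not_not]
    exact (hspan φ).symm
  have h2 : Nat.card {φ : X i →ₗ[S] X i // φ ∈ N} +
      Nat.card {φ : X i →ₗ[S] X i // ¬ φ ∈ N} = q ^ h i i := by
    classical
    rw [← Nat.card_sum, Nat.card_congr (Equiv.sumCompl _), σ.card_hom]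
  have h3 : Nat.card {φ : X i →ₗ[S] X i // φ ∈ N} = q ^ (h i i - 1) := by
    refine Nat.eq_of_mul_eq_mul_right σ.q_pos (hNc.trans ?_)
    rw [← pow_succ, Nat.sub_add_cancel (σ.h_self_pos i)]
  omega

end Sys

end Tools

/-! ### Simple socles and cyclic modules -/

section Concrete

variable {k : Type u} [Field k] {w : ℕ} {hw : 2 ≤ w}

section Socle

variable {p : Par} {hp : p.Ok w}

theorem X_pow_pred_smul {m : ℕ} (b : N k m) :
    (X : k[X]) ^ (m - 1) • b = (C (cf m 0 b) : k[X]) • (X : k[X]) ^ (m - 1) • (1 : N k m) := by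
  refine cf_ext fun i hi => ?_
  rw [cf_C_smul, cf_X_pow_smul, cf_X_pow_smul]
  split_ifs with h1
  · rw [show i - (m - 1) = 0 by omega, cf_one (by omega), mul_one]
  · rw [mul_zero]

/-- The socle element of `G`. -/
def socle (k : Type u) [Field k] (p : Par) (hp : p.Ok w) : (G k p hp).Carrier :=
  Triple.el (T := G k p hp) (0 : N k p.r)
    (((X : k[X]) ^ (p.m₁ - 1) • (1, 0) : N k p.m₁ × N k p.m₂))

theorem gMap_injective (h : p.m₁ = p.r + p.i₁) : Function.Injective (gMap k p hp) := by
  rw [← LinearMap.ker_eq_bot, LinearMap.ker_eq_bot']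
  intro z hz
  refine eq_zero_of_cf fun i hi => ?_
  have h1 : homOfElt (xpow k p.m₁ p.i₁) (pow_smul_xpow hp.le₁') z = 0 := congrArg Prod.fst hz
  have h2 := congrArg (cf p.m₁ (i + p.i₁)) h1
  rwa [cf_homOfElt_xpow hp.le₁', if_pos (by omega), map_zero, Nat.add_sub_cancel] at h2

theorem hom_socle {T : Triple k 2 w} (φ : Triple.Hom hw (G k p hp) T) :
    φ (socle k p hp) = Triple.el 0 ((X : k[X]) ^ (p.m₁ - 1) • sndG φ (1, 0)) := by
  rw [Triple.hom_apply']
  refine Triple.el_ext ?_ ?_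
  · exact map_zero (fstG φ)
  · exact map_smul (sndG φ) _ _

theorem hom_socle_eq_zero_iff {T : Triple k 2 w} (φ : Triple.Hom hw (G k p hp) T) :
    φ (socle k p hp) = 0 ↔ (X : k[X]) ^ (p.m₁ - 1) • sndG φ (1, 0) = 0 := by
  rw [hom_socle]
  exact ⟨fun h => congrArg Triple.p₂ h, fun h => Triple.el_ext rfl h⟩

theorem socle_ne_zero (h₁ : 0 < p.m₁) : socle k p hp ≠ 0 := by
  intro h
  have h2 : (X : k[X]) ^ (p.m₁ - 1) • (1 : N k p.m₁) = 0 :=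
    congrArg Prod.fst (congrArg Triple.p₂ h)
  have h3 := cf_zero_of_top h2
  rw [cf_one h₁] at h3
  exact one_ne_zero h3

/-- With m₂ = 0 and m₁ = r + i₁ the structure map is injective, so G(p) has a simple socle, spanned
by x^{m₁-1} in the second component. -/
theorem injective_hom_iff_socle {T : Triple k 2 w} (h₀ : 0 < p.m₁) (h₁ : p.m₁ = p.r + p.i₁)
    (h₂ : p.m₂ = 0) (φ : Triple.Hom hw (G k p hp) T) :
    Function.Injective φ ↔ φ (socle k p hp) ≠ 0 := by
  constructor
  · intro hi h
    exact socle_ne_zero h₀ (hi (h.trans (map_zero φ).symm))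
  · intro h
    have hsnd : Function.Injective (sndG φ) := by
      refine injective_of_ker_X (G k p hp).h₂ _ ?_
      change ∀ v : N k p.m₁ × N k p.m₂, (X : k[X]) • v = 0 → sndG φ v = 0 → v = 0
      rintro ⟨y₁, y₂⟩ hv hv'
      obtain ⟨b, rfl⟩ := exists_eq_of_X_smul_eq_zero y₁ (congrArg Prod.fst hv)
      have hy : y₂ = 0 := eq_zero_of_cf fun i hi => absurd hi (by omega)
      subst hy
      have h3 : (((X : k[X]) ^ (p.m₁ - 1) • b, 0) : N k p.m₁ × N k p.m₂) =
          (C (cf p.m₁ 0 b) : k[X]) • (X : k[X]) ^ (p.m₁ - 1) • (1, 0) := by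
        rw [X_pow_pred_smul b]
        refine Prod.ext rfl ?_
        change (0 : N k p.m₂) = _ • _ • (0 : N k p.m₂)
        rw [smul_zero, smul_zero]
      rw [h3] at hv' ⊢
      by_cases hc : cf p.m₁ 0 b = 0
      · rw [hc, C_0, zero_smul]
      · refine absurd ((hom_socle_eq_zero_iff φ).2 ?_) h
        have h4 := congrArg (fun z => (C (cf p.m₁ 0 b)⁻¹ : k[X]) • z) hv'
        simp only [map_smul, smul_zero, smul_smul, ← mul_assoc, ← C_mul, inv_mul_cancel₀ hc, C_1,
          one_mul] at h4
        exact h4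
    rw [Triple.injective_hom_iff]
    refine ⟨?_, hsnd⟩
    change Function.Injective (fstG φ)
    rw [← LinearMap.ker_eq_bot, LinearMap.ker_eq_bot']
    intro v hv
    refine gMap_injective (hp := hp) h₁ (hsnd ?_)
    rw [sndG_gMap, hv, map_zero, map_zero, map_zero]

theorem injective_iff_socle {M : Type u} [AddCommGroup M] [Module (Lam k 2 w hw)ᵐᵒᵖ M]
    (h₀ : 0 < p.m₁) (h₁ : p.m₁ = p.r + p.i₁) (h₂ : p.m₂ = 0)
    (φ : (G k p hp).Carrier →ₗ[(Lam k 2 w hw)ᵐᵒᵖ] M) :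
    Function.Injective φ ↔ φ (socle k p hp) ≠ 0 := by
  obtain ⟨e⟩ := nonempty_equiv_tripleOf k hw M
  have h := injective_hom_iff_socle (hw := hw) (hp := hp) h₀ h₁ h₂ (e.toLinearMap ∘ₗ φ)
  rw [LinearMap.coe_comp, LinearEquiv.coe_coe, EquivLike.comp_injective] at h
  rw [h]
  simp

/-- Killing the socle element sharpens x^{m₁}u₁ = 0 to x^{m₁-1}u₁ = 0, so these maps are counted by
the formula with m₁ - 1 in place of m₁. -/
theorem card_hom_socle [Finite k] {p' : Par} (hp' : p'.Ok w) :
    Nat.card {φ : Triple.Hom hw (G k p hp) (G k p' hp') // φ (socle k p hp) = 0} =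
      Nat.card k ^ Par.hom ⟨p.r, p.m₁ - 1, p.i₁, p.m₂, p.i₂⟩ p' := by
  rw [← card_solutions hp']
  refine Nat.card_congr
    { toFun := fun φ => ⟨(homGEquiv hp (G k p' hp') φ.1).1,
        (homG_spec φ.1).1, (hom_socle_eq_zero_iff φ.1).1 φ.2, (homG_spec φ.1).2.2.1,
        (homG_spec φ.1).2.2.2⟩
      invFun := fun x => ⟨(homGEquiv hp (G k p' hp')).symm ⟨x.1, x.2.1, ?_, x.2.2.2.1, x.2.2.2.2⟩, ?_⟩
      left_inv := fun φ => Subtype.ext ((homGEquiv hp (G k p' hp')).symm_apply_apply φ.1)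
      right_inv := fun x => Subtype.ext (Prod.ext (fstG_mkHomG _ _ _ x.2.2.2.2)
        (Prod.ext (sndG_mkHomG_left _ _ _ x.2.2.2.2) (sndG_mkHomG_right _ _ _ x.2.2.2.2))) }
  · have h := x.2.2.1
    have h1 : (X : k[X]) ^ p.m₁ = X ^ (p.m₁ - (p.m₁ - 1)) * X ^ (p.m₁ - 1) := by
      rw [← pow_add]; congr 1; omega
    generalize (x.1.2.1 : N k p'.m₁ × N k p'.m₂) = y at h ⊢
    have h' : (X : k[X]) ^ (p.m₁ - 1) • y = 0 := h
    change (X : k[X]) ^ p.m₁ • y = 0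
    rw [h1, mul_smul, h', smul_zero]
  · rw [hom_socle_eq_zero_iff]
    exact (congrArg _ (sndG_mkHomG_left _ _ _ x.2.2.2.2)).trans x.2.2.1

end Socle

section Cyclic

/-- The annihilator of the generator is principal and contains x^m, so it is generated by a power of
the prime x. -/
theorem exists_equiv_N {V : Type*} [AddCommGroup V] [Module k[X] V] {y : V}
    (hy : ∀ v, ∃ p : k[X], v = p • y) {m : ℕ} (hm : (X : k[X]) ^ m • y = 0) :
    ∃ n, Nonempty (V ≃ₗ[k[X]] N k n) := by
  let g : k[X] →ₗ[k[X]] V := LinearMap.toSpanSingleton k[X] V y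
  have hg : Function.Surjective g := fun v => by
    obtain ⟨p, rfl⟩ := hy v
    exact ⟨p, rfl⟩
  obtain ⟨r, hr⟩ := (IsPrincipalIdealRing.principal (LinearMap.ker g)).principal
  have h1 : (X : k[X]) ^ m ∈ LinearMap.ker g := hm
  rw [hr, Submodule.mem_span_singleton] at h1
  obtain ⟨s, hs⟩ := h1
  obtain ⟨n, -, hn⟩ := (dvd_prime_pow prime_X m).1 ⟨s, by rw [mul_comm]; exact hs.symm⟩
  refine ⟨n, ⟨(Submodule.quotEquivOfEq _ _ ?_ ≪≫ₗ g.quotKerEquivOfSurjective hg).symm⟩⟩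
  rw [hr]
  exact (Ideal.span_singleton_eq_span_singleton.2 hn).symm

/-- A generator in e₂M leaves e₁M = 0 and makes e₂M a cyclic k[x]-module, which is determined by its
order. -/
theorem nonempty_equiv_G_right [Finite k] {M : Type u} [AddCommGroup M]
    [Module (Lam k 2 w hw)ᵐᵒᵖ M] {v : M} (hv : v ∈ epart (idem₂ k hw) M)
    (hs : Submodule.span (Lam k 2 w hw)ᵐᵒᵖ {v} = ⊤) {m : ℕ}
    (hc : Nat.card (epart (idem₂ k hw) M) = Nat.card k ^ m) {p : Par} {hp : p.Ok w}
    (hr : p.r = 0) (h₁ : p.m₁ = m) (h₂ : p.m₂ = 0) :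
    Nonempty (M ≃ₗ[(Lam k 2 w hw)ᵐᵒᵖ] (G k p hp).Carrier) := by
  obtain ⟨e⟩ := nonempty_equiv_tripleOf k hw M
  rw [card_epart_congr _ e, Triple.card_epart_idem₂] at hc
  generalize tripleOf k hw M = T at e hc
  have h3 : e v = Triple.el 0 (Triple.p₂ (e v)) := by
    rw [← Triple.idem₂_smul (hw := hw), ← map_smul, mem_epart.1 hv]
  have h4 : ∀ z : T.Carrier, ∃ p : k[X], z = Triple.el 0 (p • Triple.p₂ (e v)) := by
    intro z
    have h5 : e.symm z ∈ Submodule.span (Lam k 2 w hw)ᵐᵒᵖ {v} := by rw [hs]; trivial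
    obtain ⟨a, ha⟩ := Submodule.mem_span_singleton.1 h5
    have h6 : z = a • e v := by rw [← map_smul, ha, LinearEquiv.apply_symm_apply]
    obtain ⟨p, p', p'', rfl⟩ := exists_eq_sum a
    refine ⟨p'', ?_⟩
    rw [h6]
    refine Triple.el_ext ?_ ?_
    · rw [Triple.p₁_sum_smul, h3, Triple.p₁_el, smul_zero, Triple.p₁_el]
    · rw [Triple.p₂_sum_smul, h3]
      simp
  have hV₁ : Subsingleton T.V₁ := subsingleton_of_forall_eq 0 fun z => by
    obtain ⟨p, hp⟩ := h4 (Triple.el z 0)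
    exact congrArg Triple.p₁ hp
  obtain ⟨n, ⟨e₂⟩⟩ := exists_equiv_N (V := T.V₂) (y := Triple.p₂ (e v)) (fun z => by
    obtain ⟨p, hp⟩ := h4 (Triple.el 0 z)
    exact ⟨p, congrArg Triple.p₂ hp⟩) (T.h₂ _)
  have hn : n = m := by
    rw [Nat.card_congr e₂.toEquiv, card_N] at hc
    exact Nat.pow_right_injective Finite.one_lt_card hc
  obtain ⟨r, m₁, i₁, m₂, i₂⟩ := p
  simp only at hr h₁ h₂
  subst hr h₁ h₂ hn
  have hN : Subsingleton (N k 0) := ⟨fun a b => cf_ext fun i hi => absurd hi (by omega)⟩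
  let e₁ : T.V₁ ≃ₗ[k[X]] N k 0 := LinearEquiv.ofSubsingleton _ _
  let e₃ : N k n ≃ₗ[k[X]] N k n × N k 0 := LinearEquiv.ofBijective (LinearMap.inl _ _ _)
    ⟨LinearMap.inl_injective, fun z => ⟨z.1, Prod.ext rfl (Subsingleton.elim _ _)⟩⟩
  obtain ⟨e'⟩ := Triple.nonempty_equiv (hw := hw) (T := T) (T' := G k ⟨0, n, i₁, 0, i₂⟩ hp) e₁
    (e₂ ≪≫ₗ e₃) (fun v => by
      change _ = gMap k _ hp (e₁ v)
      rw [Subsingleton.elim (e₁ v) 0, map_zero, Subsingleton.elim v 0, map_zero, map_zero]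
      rfl)
  exact ⟨e ≪≫ₗ e'⟩

theorem nonempty_equiv_G_left [Finite k] {M : Type u} [AddCommGroup M]
    [Module (Lam k 2 w hw)ᵐᵒᵖ M] {v : M}
    (hs : Submodule.span (Lam k 2 w hw)ᵐᵒᵖ {v} = ⊤) {m : ℕ}
    (hc : Nat.card (epart (idem₁ k hw) M) = Nat.card k ^ m)
    (hc' : Nat.card (epart (idem₂ k hw) M) = 1) {p : Par} {hp : p.Ok w}
    (hr : p.r = m) (h₁ : p.m₁ = 0) (h₂ : p.m₂ = 0) :
    Nonempty (M ≃ₗ[(Lam k 2 w hw)ᵐᵒᵖ] (G k p hp).Carrier) := by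
  obtain ⟨e⟩ := nonempty_equiv_tripleOf k hw M
  rw [card_epart_congr _ e, Triple.card_epart_idem₁] at hc
  rw [card_epart_congr _ e, Triple.card_epart_idem₂] at hc'
  generalize tripleOf k hw M = T at e hc hc'
  have hV₂ : Subsingleton T.V₂ := (Nat.card_eq_one_iff_unique.1 hc').1
  have h4 : ∀ z : T.V₁, ∃ p : k[X], z = p • Triple.p₁ (e v) := by
    intro z
    have h5 : e.symm (Triple.el z 0) ∈ Submodule.span (Lam k 2 w hw)ᵐᵒᵖ {v} := by rw [hs]; trivial
    obtain ⟨a, ha⟩ := Submodule.mem_span_singleton.1 h5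
    have h6 : Triple.el z 0 = a • e v := by rw [← map_smul, ha, LinearEquiv.apply_symm_apply]
    obtain ⟨p, p', p'', rfl⟩ := exists_eq_sum a
    refine ⟨p, ?_⟩
    have h7 := congrArg Triple.p₁ h6
    rwa [Triple.p₁_sum_smul] at h7
  obtain ⟨n, ⟨e₁⟩⟩ := exists_equiv_N (V := T.V₁) (y := Triple.p₁ (e v)) h4 (T.h₁ _)
  have hn : n = m := by
    rw [Nat.card_congr e₁.toEquiv, card_N] at hc
    exact Nat.pow_right_injective Finite.one_lt_card hc
  obtain ⟨r, m₁, i₁, m₂, i₂⟩ := p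
  simp only at hr h₁ h₂
  subst hr h₁ h₂ hn
  have hN : Subsingleton (N k 0) := ⟨fun a b => cf_ext fun i hi => absurd hi (by omega)⟩
  let e₂ : T.V₂ ≃ₗ[k[X]] N k 0 × N k 0 := LinearEquiv.ofSubsingleton _ _
  obtain ⟨e'⟩ := Triple.nonempty_equiv (hw := hw) (T := T) (T' := G k ⟨n, 0, i₁, 0, i₂⟩ hp) e₁ e₂
    (fun v => @Subsingleton.elim (N k 0 × N k 0) _ _ _)
  exact ⟨e ≪≫ₗ e'⟩

theorem exists_smul_one {m : ℕ} (b : N k m) : ∃ p : k[X], b = p • (1 : N k m) := by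
  obtain ⟨p, rfl⟩ := Ideal.Quotient.mk_surjective b
  refine ⟨p, ?_⟩
  change _ = Ideal.Quotient.mk _ (p * 1)
  rw [mul_one]

theorem span_el_right {p : Par} (hp : p.Ok w) (hr : p.r = 0) (h₂ : p.m₂ = 0) :
    Submodule.span (Lam k 2 w hw)ᵐᵒᵖ
      {Triple.el (T := G k p hp) (0 : N k p.r) ((1, 0) : N k p.m₁ × N k p.m₂)} = ⊤ := by
  rw [eq_top_iff]
  rintro z -
  obtain ⟨a, ha⟩ := exists_smul_one (Triple.p₂ z : N k p.m₁ × N k p.m₂).1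
  refine Submodule.mem_span_singleton.2 ⟨ofPoly k hw a, ?_⟩
  rw [Triple.ofPoly_smul]
  refine Triple.el_ext ?_ (Prod.ext ha.symm ?_)
  · exact cf_ext (k := k) (m := p.r) fun i hi => absurd hi (by omega)
  · exact cf_ext (k := k) (m := p.m₂) fun i hi => absurd hi (by omega)

theorem span_el_left {p : Par} (hp : p.Ok w) (h₁ : p.m₁ = 0) (h₂ : p.m₂ = 0) :
    Submodule.span (Lam k 2 w hw)ᵐᵒᵖ
      {Triple.el (T := G k p hp) (1 : N k p.r) (0 : N k p.m₁ × N k p.m₂)} = ⊤ := by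
  rw [eq_top_iff]
  rintro z -
  obtain ⟨a, ha⟩ := exists_smul_one (Triple.p₁ z : N k p.r)
  refine Submodule.mem_span_singleton.2 ⟨ofPoly k hw a, ?_⟩
  rw [Triple.ofPoly_smul]
  refine Triple.el_ext ha.symm (Prod.ext ?_ ?_)
  · exact cf_ext (k := k) (m := p.m₁) fun i hi => absurd hi (by omega)
  · exact cf_ext (k := k) (m := p.m₂) fun i hi => absurd hi (by omega)

end Cyclic

end Concrete

/-! ### The cyclic indecomposables P_0^n, P_1^0 and P_2^0 -/

section Generators

variable {w : ℕ} (hw : 2 ≤ w)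

/-- Goodness for the modules over `Λ_{2,w}`. -/
abbrev GoodI (a : Idx w → ℕ) : Prop :=
  Good.{u} (fun F : FinField.{u} => (Lam F.K 2 w hw)ᵐᵒᵖ) (fun F (I : Idx w) => Ind F.K I) a

theorem monic_card_generators {n : ℕ} (hn : 0 < n) :
    MonicFn (ratOf.{u} fun F => Nat.card F.K ^ n - Nat.card F.K ^ (n - 1)) := by
  convert MonicFn.pow_sub_pow.{u} (m := n - 1) (n := n) (by omega) using 1
  funext F
  have hle : Nat.card F.K ^ (n - 1) ≤ Nat.card F.K ^ n :=
    Nat.pow_le_pow_right (zero_lt_one.trans Finite.one_lt_card) (by omega)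
  simp [ratOf, FinField.q, Nat.cast_sub hle]

theorem good_P0 {n : ℕ} (h1 : 1 ≤ n) (h2 : n ≤ w) : GoodI.{u} hw (Pi.single (.P0 n h1 h2) 1) := by
  refine (sys w hw).good_of_cyclic (ε := fun F => idem₂ F.K hw) (ε' := fun F => idem₁ F.K hw)
    (e := fun I => (par I).m₁ + (par I).m₂) (e' := fun I => (par I).r)
    (fun _ => isIdempotentElem_idem₂) (fun _ _ => card_epart₂ _) (fun _ => isIdempotentElem_idem₁)
    (fun _ _ => card_epart₁ _) _ ?_ ?_
  · intro F M _ _ _ v hv hs hc hc'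
    exact nonempty_equiv_G_right hv hs hc rfl (by simp [par]) rfl
  · convert monic_card_generators.{u} h1 using 2
    funext F
    have h3 : homI (.P0 n h1 h2 : Idx w) (.P0 n h1 h2) = n := by rw [homI_P0]; simp [par]
    have := (sys w hw F).card_generators (i := .P0 n h1 h2) (ε := idem₂ F.K hw) (Triple.idem₂_smul _)
      (span_el_right _ rfl rfl) (by rw [card_epart₂, h3]; rfl)
    rw [h3] at this
    exact this

theorem good_P10 : GoodI.{u} hw (Pi.single .P10 1) := by
  refine (sys w hw).good_of_cyclic (ε := fun F => idem₁ F.K hw) (ε' := fun F => idem₂ F.K hw)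
    (e := fun I => (par I).r) (e' := fun I => (par I).m₁ + (par I).m₂)
    (fun _ => isIdempotentElem_idem₁) (fun _ _ => card_epart₁ _) (fun _ => isIdempotentElem_idem₂)
    (fun _ _ => card_epart₂ _) _ ?_ ?_
  · intro F M _ _ _ v _ hs hc hc'
    exact nonempty_equiv_G_left hs hc hc' rfl rfl rfl
  · convert monic_card_generators.{u} one_pos using 2
    funext F
    exact (sys w hw F).card_generators (i := .P10) (ε := idem₁ F.K hw) (Triple.idem₁_smul _)
      (span_el_left _ rfl rfl) (by rw [card_epart₁]; rfl)

theorem good_P20 : GoodI.{u} hw (Pi.single .P20 1) := by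
  refine (sys w hw).good_of_cyclic (ε := fun F => idem₁ F.K hw) (ε' := fun F => idem₂ F.K hw)
    (e := fun I => (par I).r) (e' := fun I => (par I).m₁ + (par I).m₂)
    (fun _ => isIdempotentElem_idem₁) (fun _ _ => card_epart₁ _) (fun _ => isIdempotentElem_idem₂)
    (fun _ _ => card_epart₂ _) _ ?_ ?_
  · intro F M _ _ _ v _ hs hc hc'
    exact nonempty_equiv_G_left hs hc hc' rfl rfl rfl
  · convert monic_card_generators.{u} two_pos using 2
    funext F
    exact (sys w hw F).card_generators (i := .P20) (ε := idem₁ F.K hw) (Triple.idem₁_smul _)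
      (span_el_left _ rfl rfl) (by rw [card_epart₁]; rfl)

end Generators

/-! ### Additive invariants and the lists of possible middle terms -/

section Enumeration

variable {w : ℕ}

/-- The dimension of the first component. -/
def rk (I : Idx w) : ℕ := (par I).r

/-- The dimension of the second component. -/
def len (I : Idx w) : ℕ := (par I).m₁ + (par I).m₂

/-- The number of cyclic summands of the second component. -/
def blk (I : Idx w) : ℕ := min 1 (par I).m₁ + min 1 (par I).m₂

/-- The number of cyclic summands of the first component. -/
def top (I : Idx w) : ℕ := min 1 (par I).r

/-- The dimension of the kernel of the structure map. -/
def kerd (I : Idx w) : ℕ := (par I).r - max ((par I).m₁ - (par I).i₁) ((par I).m₂ - (par I).i₂)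

/-- The number of cyclic summands of the kernel of the structure map. -/
def soc (I : Idx w) : ℕ := min 1 (kerd I)

theorem homI_one (h1 : 1 ≤ 1) (h2 : 1 ≤ w) : homI (.P0 1 h1 h2) = (blk : Idx w → ℕ) :=
  funext fun J => homI_P0 1 h1 h2 J

theorem homI_P10_right : (fun I : Idx w => homI I .P10) = top := by
  funext I
  cases I <;> simp [homI, par, Par.hom, Par.e, Par.c, top]

theorem homI_P20_left : (homI .P20 : Idx w → ℕ) = kerd := funext homI_P20

theorem homI_P10_left : (homI .P10 : Idx w → ℕ) = soc := by
  funext I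
  cases I <;> simp [homI, par, Par.hom, Par.e, Par.c, soc, kerd] <;> omega

/-- The numerical restrictions on the middle term of an extension. -/
structure Bounds (a b c : Idx w → ℕ) : Prop where
  rk : wt rk b = wt rk a + wt rk c
  len : wt len b = wt len a + wt len c
  blk : wt blk b ≤ wt blk a + wt blk c
  top : wt top b ≤ wt top a + wt top c
  top' : wt HallPoly.top c ≤ wt HallPoly.top b
  kerd : wt kerd b ≤ wt kerd a + wt kerd c
  kerd' : wt HallPoly.kerd a ≤ wt HallPoly.kerd b
  soc : wt soc b ≤ wt soc a + wt soc c
  soc' : wt HallPoly.soc a ≤ wt HallPoly.soc b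

theorem bounds_of_hall {hw : 2 ≤ w} {F : FinField.{u}} {a b c : Idx w → ℕ}
    (hh : hall (Lam F.K 2 w hw)ᵐᵒᵖ (fun I : Idx w => Ind F.K I) a b c ≠ 0) : Bounds a b c := by
  have σ := sys w hw F
  have h1 := σ.le_add_of_hall hh (.P0 1 le_rfl (by omega))
  have h2 := σ.le_add_of_hall' hh .P10
  have h3 := σ.quot_le_of_hall hh .P10
  have h4 := σ.le_add_of_hall hh .P20
  have h5 := σ.le_of_hall hh .P20
  have h6 := σ.le_add_of_hall hh .P10
  have h7 := σ.le_of_hall hh .P10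
  rw [homI_one] at h1
  rw [homI_P10_right] at h2 h3
  rw [homI_P20_left] at h4 h5
  rw [homI_P10_left] at h6 h7
  exact
    { rk := σ.epart_of_hall isIdempotentElem_idem₁ (fun _ => card_epart₁ _) hh
      len := σ.epart_of_hall isIdempotentElem_idem₂ (fun _ => card_epart₂ _) hh
      blk := h1
      top := h2
      top' := h3
      kerd := h4
      kerd' := h5
      soc := h6
      soc' := h7 }

theorem exists_single_add_of_wt_ne_zero {g : Idx w → ℕ} {a : Idx w → ℕ} (h : wt g a ≠ 0) :
    ∃ (I : Idx w) (a' : Idx w → ℕ), a = Pi.single I 1 + a' ∧ g I ≠ 0 := by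
  obtain ⟨I, -, hI⟩ := Finset.exists_ne_zero_of_sum_ne_zero h
  obtain ⟨h1, h2⟩ := Nat.mul_ne_zero_iff.1 hI
  obtain ⟨a', ha⟩ := exists_eq_single_add h1
  exact ⟨I, a', ha, h2⟩

theorem len_eq_zero_of_blk {a : Idx w → ℕ} (h : wt blk a = 0) : wt len a = 0 := by
  by_contra h0
  obtain ⟨I, a', rfl, hI⟩ := exists_single_add_of_wt_ne_zero h0
  rw [wt_add, wt_single, blk] at h
  rw [len] at hI
  omega

theorem rk_eq_zero_of_top {a : Idx w → ℕ} (h : wt top a = 0) : wt rk a = 0 := by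
  by_contra h0
  obtain ⟨I, a', rfl, hI⟩ := exists_single_add_of_wt_ne_zero h0
  rw [wt_add, wt_single, top] at h
  rw [rk] at hI
  omega

theorem eq_zero_of_rk_len {a : Idx w → ℕ} (h₁ : wt rk a = 0) (h₂ : wt len a = 0) : a = 0 := by
  by_contra h0
  obtain ⟨I, hI⟩ := Function.ne_iff.1 h0
  obtain ⟨a', rfl⟩ := exists_eq_single_add hI
  rw [wt_add, wt_single] at h₁ h₂
  have h3 := dimI_pos I
  simp only [dimI, rk, len] at h₁ h₂ h3
  omega

theorem eq_of_len_eq_zero {I : Idx w} (h : len I = 0) : I = .P10 ∨ I = .P20 := by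
  cases I <;> simp only [len, par, reduceCtorEq, or_true, true_or] at h ⊢ <;> omega

theorem eq_of_rk_eq_zero {I : Idx w} (h : rk I = 0) : ∃ n h1 h2, I = .P0 n h1 h2 := by
  cases I <;> simp only [rk, par] at h <;> first | omega | exact ⟨_, _, _, rfl⟩

theorem eq_single_P10_of_rk {a : Idx w → ℕ} (h₁ : wt rk a = 1) (h₂ : wt len a = 0) :
    a = Pi.single .P10 1 := by
  obtain ⟨I, a', rfl, hI⟩ := exists_single_add_of_wt_ne_zero (g := rk) (by omega : wt rk a ≠ 0)
  rw [wt_add, wt_single] at h₁ h₂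
  rw [eq_zero_of_rk_len (a := a') (by omega) (by omega), add_zero]
  rcases eq_of_len_eq_zero (I := I) (by omega) with rfl | rfl
  · rfl
  · simp only [rk, par] at h₁
    omega

theorem eq_of_rk_eq_two {a : Idx w → ℕ} (h₁ : wt rk a = 2) (h₂ : wt len a = 0) :
    a = Pi.single .P10 1 + Pi.single .P10 1 ∨ a = Pi.single .P20 1 := by
  obtain ⟨I, a', rfl, hI⟩ := exists_single_add_of_wt_ne_zero (g := rk) (by omega : wt rk a ≠ 0)
  rw [wt_add, wt_single] at h₁ h₂
  rcases eq_of_len_eq_zero (I := I) (by omega) with rfl | rfl <;>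
    simp only [rk, par] at h₁
  · rw [eq_single_P10_of_rk (a := a') (by omega) (by omega)]
    exact .inl rfl
  · rw [eq_zero_of_rk_len (a := a') (by omega) (by omega), add_zero]
    exact .inr rfl

theorem eq_single_P0 {a : Idx w → ℕ} {n : ℕ} (hr : wt rk a = 0) (hl : wt len a = n)
    (hb : wt blk a ≤ 1) (hn : 1 ≤ n) : ∃ h, a = Pi.single (.P0 n hn h) 1 := by
  obtain ⟨I, a', rfl, hI⟩ := exists_single_add_of_wt_ne_zero (g := len) (by omega : wt len a ≠ 0)
  rw [wt_add, wt_single] at hr hl hb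
  obtain ⟨m, h1, h2, rfl⟩ := eq_of_rk_eq_zero (I := I) (by omega)
  have h3 := len_eq_zero_of_blk (a := a') (by simp only [blk, par] at hb; omega)
  rw [eq_zero_of_rk_len (a := a') (by omega) (by omega), add_zero]
  rw [h3] at hl
  simp only [len, par, add_zero] at hl
  subst hl
  exact ⟨h2, rfl⟩

/-- With a single block, the second component lies entirely in one indecomposable summand. -/
theorem exists_eq_add_of_blk {a : Idx w → ℕ} {n : ℕ} (hl : wt len a = n)
    (hb : wt blk a ≤ 1) (hn : 1 ≤ n) : ∃ (I : Idx w) (a' : Idx w → ℕ), a = Pi.single I 1 + a' ∧ wt len a' = 0 ∧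
      ((∃ h1 h2, I = .P0 n h1 h2) ∨ (∃ h1 h2, I = .P1 n h1 h2) ∨ (∃ h1 h2, I = .P2 n h1 h2) ∨
        (∃ h1 h2, I = .Z n h1 h2)) := by
  obtain ⟨I, a', rfl, hI⟩ := exists_single_add_of_wt_ne_zero (g := len) (by omega : wt len a ≠ 0)
  rw [wt_add, wt_single] at hl hb
  have h3 := len_eq_zero_of_blk (a := a') (by simp only [blk, len] at hb hI; omega)
  refine ⟨I, a', rfl, h3, ?_⟩
  rw [h3, add_zero] at hl
  cases I <;> simp only [blk, len, par, add_zero] at hb hI hl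
  · subst hl
    exact .inl ⟨_, _, rfl⟩
  · subst hl
    exact .inr (.inl ⟨_, _, rfl⟩)
  · subst hl
    exact .inr (.inr (.inl ⟨_, _, rfl⟩))
  · omega
  · omega
  · omega
  · subst hl
    exact .inr (.inr (.inr ⟨_, _, rfl⟩))

theorem eq_of_rk_one_of_blk {a : Idx w → ℕ} {n : ℕ} (hr : wt rk a = 1) (hl : wt len a = n)
    (hb : wt blk a ≤ 1) (h1 : 1 ≤ n) (h2 : n ≤ w) :
    a = Pi.single .P10 1 + Pi.single (.P0 n h1 h2) 1 ∨ a = Pi.single (.P1 n h1 h2) 1 := by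
  obtain ⟨I, a', rfl, h3, h4⟩ := exists_eq_add_of_blk hl hb h1
  rw [wt_add, wt_single] at hr
  rcases h4 with ⟨_, _, rfl⟩ | ⟨_, _, rfl⟩ | ⟨_, _, rfl⟩ | ⟨_, _, rfl⟩ <;>
    simp only [rk, par] at hr
  · left
    rw [eq_single_P10_of_rk (a := a') (by omega) h3, add_comm]
  · right
    rw [eq_zero_of_rk_len (a := a') (by omega) h3, add_zero]
  · omega
  · omega

theorem eq_of_rk_two_of_blk {a : Idx w → ℕ} {n : ℕ} (hr : wt rk a = 2) (hl : wt len a = n)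
    (hb : wt blk a ≤ 1) (h1 : 1 ≤ n) (h2 : n ≤ w) :
    a = (Pi.single .P10 1 + Pi.single .P10 1) + Pi.single (.P0 n h1 h2) 1 ∨
    a = Pi.single .P20 1 + Pi.single (.P0 n h1 h2) 1 ∨
    a = Pi.single .P10 1 + Pi.single (.P1 n h1 h2) 1 ∨
    (∃ h, a = Pi.single (.P2 n h h2) 1) ∨ a = Pi.single (.Z n h1 h2) 1 := by
  obtain ⟨I, a', rfl, h3, h4⟩ := exists_eq_add_of_blk hl hb h1
  rw [wt_add, wt_single] at hr
  rcases h4 with ⟨_, _, rfl⟩ | ⟨_, _, rfl⟩ | ⟨_, _, rfl⟩ | ⟨_, _, rfl⟩ <;>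
    simp only [rk, par] at hr
  · rcases eq_of_rk_eq_two (a := a') (by omega) h3 with rfl | rfl
    · exact .inl (add_comm _ _)
    · exact .inr (.inl (add_comm _ _))
  · right; right; left
    rw [eq_single_P10_of_rk (a := a') (by omega) h3, add_comm]
  · right; right; right; left
    rw [eq_zero_of_rk_len (a := a') (by omega) h3, add_zero]
    exact ⟨_, rfl⟩
  · right; right; right; right
    rw [eq_zero_of_rk_len (a := a') (by omega) h3, add_zero]

end Enumeration

/-! ### Types with at most one block: P_1^n, P_2^n and Z_2^n -/

section OneBlock

variable {w : ℕ} {hw : 2 ≤ w}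

theorem subN_eq_one_of_hom {F : FinField.{u}} {I : Idx w} {b : Idx w → ℕ} (h₀ : 0 < (par I).m₁)
    (h₁ : (par I).m₁ = (par I).r + (par I).i₁) (h₂ : (par I).m₂ = 0)
    (h₃ : wt (homI I) b = homI I I)
    (h₄ : wt (fun J => Par.hom ⟨(par I).r, (par I).m₁ - 1, (par I).i₁, (par I).m₂, (par I).i₂⟩
      (par J)) b = Par.hom ⟨(par I).r, (par I).m₁ - 1, (par I).i₁, (par I).m₂, (par I).i₂⟩ (par I))
    (h₅ : Par.hom ⟨(par I).r, (par I).m₁ - 1, (par I).i₁, (par I).m₂, (par I).i₂⟩ (par I) <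
      homI I I) :
    subN (Lam F.K 2 w hw)ᵐᵒᵖ (fun I : Idx w => Ind F.K I) b (Pi.single I 1) = 1 :=
  (sys w hw F).subN_eq_one (socle F.K (par I) (par_ok I))
    (fun _ φ => injective_iff_socle h₀ h₁ h₂ φ) (fun J => card_hom_socle (par_ok J)) h₃ h₄ h₅

/-- The cancellation of a term with coefficient one. -/
theorem good_of_relation_one {a c m : Idx w → ℕ} (h₁ : GoodI.{u} hw a) (h₂ : GoodI.{u} hw c)
    (h₀ : ∀ F : FinField.{u}, subN (Lam F.K 2 w hw)ᵐᵒᵖ (fun I : Idx w => Ind F.K I) m a = 1)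
    (hc : ∀ c', Bounds a m c' → c' = c)
    (hT : ∀ m', m' ≠ m → ∀ F : FinField.{u},
      hall (Lam F.K 2 w hw)ᵐᵒᵖ (fun I : Idx w => Ind F.K I) a m' c ≠ 0 → Bounds a m' c →
      GoodI.{u} hw m') : GoodI.{u} hw m := by
  refine (sys w hw).good_of_relation h₁ h₂ ?_ fun m' hm F hF => hT m' hm F hF (bounds_of_hall hF)
  convert MonicFn.pow.{u} 0 using 1
  funext F
  rw [ratOf, (sys w hw F).hall_eq_subN fun c' hc' => hc c' (bounds_of_hall hc'), h₀]
  simp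

theorem good_add_of_bounds {a c : Idx w → ℕ} (h₁ : GoodI.{u} hw a) (h₂ : GoodI.{u} hw c)
    (hT : ∀ m, m ≠ a + c → Bounds a m c → GoodI.{u} hw m) : GoodI.{u} hw (a + c) :=
  (sys w hw).good_add h₁ h₂ fun m hm _ hF => hT m hm (bounds_of_hall hF)

variable (hw)

theorem good_P10_add_P10 : GoodI.{u} hw (Pi.single .P10 1 + Pi.single .P10 1) := by
  refine good_add_of_bounds (good_P10 hw) (good_P10 hw) fun m hm hb => ?_
  have h1 := hb.rk
  have h2 := hb.len
  simp only [wt_single] at h1 h2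
  rcases eq_of_rk_eq_two h1 h2 with rfl | rfl
  · exact absurd rfl hm
  · exact good_P20 hw

variable {n : ℕ} (h1 : 1 ≤ n) (h2 : n ≤ w)

/-- The other candidate P_1^n has an injective structure map, so P_1^0 is not a submodule of it. -/
theorem good_P10_add_P0 : GoodI.{u} hw (Pi.single .P10 1 + Pi.single (.P0 n h1 h2) 1) := by
  refine good_add_of_bounds (good_P10 hw) (good_P0 hw h1 h2) fun m hm hb => ?_
  obtain ⟨h3, h4, h5, -, -, -, -, -, h6⟩ := hb
  simp only [wt_single, rk, len, blk, par] at h3 h4 h5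
  rcases eq_of_rk_one_of_blk (n := n) (by omega) (by omega) (by omega) h1 h2 with
    rfl | rfl
  · exact absurd rfl hm
  · simp only [wt_single, soc, kerd, par] at h6
    omega

/-- P_1^n has exactly one submodule P_0^n, with quotient P_1^0, and the only other possible middle
term is the direct sum. -/
theorem good_P1 : GoodI.{u} hw (Pi.single (.P1 n h1 h2) 1) := by
  refine good_of_relation_one (good_P0 hw h1 h2) (good_P10 hw) (fun F => ?_) (fun c hb => ?_)
    fun m hm F hF hb => ?_
  · refine subN_eq_one_of_hom h1 ?_ rfl ?_ ?_ ?_ <;>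
      simp [wt_single, homI, par, Par.hom, Par.e, Par.c] <;> omega
  · have h3 := hb.rk
    have h4 := hb.len
    simp only [wt_single, rk, len, par] at h3 h4
    exact eq_single_P10_of_rk (by omega) (by omega)
  · obtain ⟨h3, h4, h5, -⟩ := hb
    simp only [wt_single, rk, len, blk, par] at h3 h4 h5
    rcases eq_of_rk_one_of_blk (n := n) h3 (by omega) (by omega) h1 h2 with rfl | rfl
    · exact good_P10_add_P0 hw h1 h2
    · exact absurd rfl hm

/-- A submodule P_2^0 needs a kernel of dimension 2, and the top of the first component is too small
for P_1^0 ⊕ P_1^0 ⊕ P_0^n. -/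
theorem good_P20_add_P0 : GoodI.{u} hw (Pi.single .P20 1 + Pi.single (.P0 n h1 h2) 1) := by
  refine good_add_of_bounds (good_P20 hw) (good_P0 hw h1 h2) fun m hm hb => ?_
  obtain ⟨h3, h4, h5, h6, -, -, h7, -, -⟩ := hb
  simp only [wt_single, rk, len, blk, top, kerd, par] at h3 h4 h5 h6 h7
  rcases eq_of_rk_two_of_blk (n := n) h3 (by omega) (by omega) h1 h2 with
    rfl | rfl | rfl | ⟨_, rfl⟩ | rfl
  · simp only [wt_add, wt_single, top, par] at h6
    omega
  · exact absurd rfl hm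
  all_goals
    simp only [wt_add, wt_single, kerd, par] at h7
    omega

/-- Among the candidates only the direct sum has a kernel whose socle has dimension 2. -/
theorem good_P10_add_P10_add_P0 :
    GoodI.{u} hw ((Pi.single .P10 1 + Pi.single .P10 1) + Pi.single (.P0 n h1 h2) 1) := by
  refine good_add_of_bounds (good_P10_add_P10 hw) (good_P0 hw h1 h2) fun m hm hb => ?_
  obtain ⟨h3, h4, h5, -, -, -, -, -, h6⟩ := hb
  simp only [wt_add, wt_single, rk, len, blk, soc, kerd, par] at h3 h4 h5 h6
  rcases eq_of_rk_two_of_blk (n := n) h3 (by omega) (by omega) h1 h2 with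
    rfl | rfl | rfl | ⟨_, rfl⟩ | rfl
  · exact absurd rfl hm
  all_goals
    simp only [wt_add, wt_single, soc, kerd, par] at h6
    omega

/-- The extension has submodule P_0^n, unique in P_1^0 ⊕ P_1^n, and quotient P_1^0 ⊕ P_1^0. The
noncyclic first component of the quotient excludes P_2^n and Z_2^n as middle terms. -/
theorem good_P10_add_P1 : GoodI.{u} hw (Pi.single .P10 1 + Pi.single (.P1 n h1 h2) 1) := by
  refine good_of_relation_one (good_P0 hw h1 h2) (good_P10_add_P10 hw) (fun F => ?_)
    (fun c hb => ?_) fun m hm F hF hb => ?_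
  · refine subN_eq_one_of_hom h1 ?_ rfl ?_ ?_ ?_ <;>
      simp [wt_add, wt_single, homI, par, Par.hom, Par.e, Par.c] <;> omega
  · obtain ⟨h3, h4, -, h5, -⟩ := hb
    simp only [wt_add, wt_single, rk, len, top, par] at h3 h4 h5
    rcases eq_of_rk_eq_two (a := c) (by omega) (by omega) with rfl | rfl
    · rfl
    · simp only [wt_single, top, par] at h5
      omega
  · obtain ⟨h3, h4, h5, -, h6, -⟩ := hb
    simp only [wt_add, wt_single, rk, len, blk, top, par] at h3 h4 h5 h6
    rcases eq_of_rk_two_of_blk (n := n) h3 (by omega) (by omega) h1 h2 with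
      rfl | rfl | rfl | ⟨_, rfl⟩ | rfl
    · exact good_P10_add_P10_add_P0 hw h1 h2
    · exact good_P20_add_P0 hw h1 h2
    · exact absurd rfl hm
    all_goals
      simp only [wt_single, top, par] at h6
      omega

theorem exists_surjective_P1_P10 {F : FinField.{u}} (h : 1 ≤ w) :
    ∃ p : Ind F.K (.P1 1 le_rfl h) →ₗ[(Lam F.K 2 w hw)ᵐᵒᵖ] Ind F.K (.P10 : Idx w),
      Function.Surjective p := by
  have hN : Subsingleton (N F.K 0 × N F.K 0) := by
    have : Subsingleton (N F.K 0) := ⟨fun a b => cf_ext fun i hi => absurd hi (by omega)⟩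
    infer_instance
  refine ⟨mkHomG hw (T := G F.K (par .P10) (par_ok (w := w) .P10)) (par_ok (.P1 1 le_rfl h))
    (v := (1 : N F.K 1)) (u₁ := 0) (u₂ := 0) (X_pow_smul_one 1) (smul_zero _) (smul_zero _)
    (@Subsingleton.elim _ hN _ _), ?_⟩
  rw [← LinearMap.range_eq_top, eq_top_iff, ← span_el_left (hw := hw) (par_ok .P10) rfl rfl,
    Submodule.span_singleton_le_iff_mem]
  refine ⟨Triple.el (T := G F.K _ _) (1 : N F.K 1) 0, ?_⟩
  rw [Triple.hom_apply']
  refine Triple.el_ext ?_ (@Subsingleton.elim _ hN _ _)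
  exact fstG_mkHomG _ _ _ _

/-- P_2^n has exactly one submodule P_1^n, with quotient P_1^0. All other candidates are good except
Z_2^n, which does not contain P_1^n. -/
theorem good_P2 (h1 : 2 ≤ n) (h2 : n ≤ w) : GoodI.{u} hw (Pi.single (.P2 n h1 h2) 1) := by
  have h0 : 1 ≤ n := by omega
  refine good_of_relation_one (good_P1 hw h0 h2) (good_P10 hw) (fun F => ?_) (fun c hb => ?_)
    fun m hm F hF hb => ?_
  · refine subN_eq_one_of_hom (by simp only [par]; omega) ?_ rfl ?_ ?_ ?_ <;>
      simp [wt_single, homI, par, Par.hom, Par.e, Par.c] <;> omega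
  · have h3 := hb.rk
    have h4 := hb.len
    simp only [wt_single, rk, len, par] at h3 h4
    exact eq_single_P10_of_rk (by omega) (by omega)
  · obtain ⟨h3, h4, h5, -⟩ := hb
    simp only [wt_single, rk, len, blk, par] at h3 h4 h5
    rcases eq_of_rk_two_of_blk (n := n) h3 (by omega) (by omega) h0 h2 with
      rfl | rfl | rfl | ⟨_, rfl⟩ | rfl
    · exact good_P10_add_P10_add_P0 hw h0 h2
    · exact good_P20_add_P0 hw h0 h2
    · exact good_P10_add_P1 hw h0 h2
    · exact absurd rfl hm
    -- Maps from P_1^1 correspond to elements of V₁ killed by x, maps from P_1^0 to those also in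
    -- ker f. The two numbers agree for Z_2^n, hence for its submodules, but they differ for P_1^n.
    · obtain ⟨p, hp⟩ := exists_surjective_P1_P10 hw (F := F) (by omega)
      have h6 := (sys w hw F).eq_of_hall_of_surjective hF hp (by
        simp only [wt_single, homI, par, Par.hom, Par.e, Par.c]; omega)
      simp only [wt_single, homI, par, Par.hom, Par.e, Par.c] at h6
      omega

/-- Z_2^n has exactly one submodule P_0^n, with quotient P_2^0, and every other candidate, P_2^n
included, is already good. -/
theorem good_Z : GoodI.{u} hw (Pi.single (.Z n h1 h2) 1) := by
  refine good_of_relation_one (good_P0 hw h1 h2) (good_P20 hw) (fun F => ?_)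
    (fun c hb => ?_) fun m hm F hF hb => ?_
  · refine subN_eq_one_of_hom h1 ?_ rfl ?_ ?_ ?_ <;>
      simp [wt_single, homI, par, Par.hom, Par.e, Par.c] <;> omega
  · obtain ⟨h3, h4, -, -, h5, -⟩ := hb
    simp only [wt_single, rk, len, top, par] at h3 h4 h5
    rcases eq_of_rk_eq_two (a := c) (by omega) (by omega) with rfl | rfl
    · simp only [wt_add, wt_single, top, par] at h5
      omega
    · rfl
  · obtain ⟨h3, h4, h5, -⟩ := hb
    simp only [wt_single, rk, len, blk, par] at h3 h4 h5
    rcases eq_of_rk_two_of_blk (n := n) h3 (by omega) (by omega) h1 h2 with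
      rfl | rfl | rfl | ⟨h, rfl⟩ | rfl
    · exact good_P10_add_P10_add_P0 hw h1 h2
    · exact good_P20_add_P0 hw h1 h2
    · exact good_P10_add_P1 hw h1 h2
    · exact good_P2 hw h h2
    · exact absurd rfl hm

end OneBlock

/-! ### Explicit embeddings and their cokernels -/

section Pivot

variable {k : Type u} [Field k] {w : ℕ} {hw : 2 ≤ w}

theorem exists_smul_eq_of_cf {m : ℕ} {u : N k m} (hu : 0 < m → cf m 0 u ≠ 0) (y : N k m) :
    ∃ p : k[X], y = p • u := by
  obtain ⟨p, rfl⟩ := Ideal.Quotient.mk_surjective u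
  rcases Nat.eq_zero_or_pos m with h0 | h0
  · exact ⟨0, cf_ext fun i hi => absurd hi (by omega)⟩
  · have h1 := hu h0
    rw [cf_mk, if_pos h0] at h1
    have hcop : IsCoprime p (X ^ m) := by
      refine IsCoprime.pow_right (((irreducible_X (R := k)).coprime_iff_not_dvd.2 ?_).symm)
      rwa [X_dvd_iff]
    obtain ⟨a, b, hab⟩ := hcop
    obtain ⟨s, rfl⟩ := Ideal.Quotient.mk_surjective y
    refine ⟨s * a, ?_⟩
    change Ideal.Quotient.mk _ s = Ideal.Quotient.mk _ ((s * a) * p)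
    rw [Ideal.Quotient.eq, Ideal.mem_span_singleton]
    refine ⟨s * b, ?_⟩
    linear_combination (-s) * hab

theorem cf_fstG_ne_zero {p p' : Par} {hp : p.Ok w} {hp' : p'.Ok w} (hr : p'.r = p.r) (h₀ : 0 < p.r)
    {φ : Triple.Hom hw (G k p hp) (G k p' hp')} (hφ : Function.Injective φ) :
    cf p'.r 0 (fstG φ 1 : N k p'.r) ≠ 0 := by
  intro h0
  have h3 : fstG φ ((X : k[X]) ^ (p.r - 1) • 1) = (0 : N k p'.r) := by
    rw [map_smul, show p.r - 1 = p'.r - 1 by rw [hr]]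
    exact eq_zero_of_top fun _ => h0
  have h4 : ((X : k[X]) ^ (p.r - 1) • 1 : N k p.r) = 0 :=
    ((Triple.injective_hom_iff φ).1 hφ).1 (h3.trans (map_zero (fstG φ)).symm)
  have h5 := cf_zero_of_top h4
  rw [cf_one h₀] at h5
  exact one_ne_zero h5

/-- The cokernel of an embedding that hits a generator of the second summand. -/
theorem nonempty_quotient_equiv [Finite k] {p p' p'' : Par} {hp : p.Ok w} {hp' : p'.Ok w} {hp'' : p''.Ok w}
    (hr : p'.r = p.r) (h₀ : 0 < p.r) (h₂ : p.m₂ = 0) (hi : p.i₁ = p'.i₂) (h₂' : 0 < p'.m₂)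
    (hr'' : p''.r = 0) (h₁'' : p.m₁ + p''.m₁ = p'.m₁ + p'.m₂) (h₂'' : p''.m₂ = 0)
    {φ : Triple.Hom hw (G k p hp) (G k p' hp')} (hφ : Function.Injective φ) :
    Nonempty (((G k p' hp').Carrier ⧸ LinearMap.range φ) ≃ₗ[(Lam k 2 w hw)ᵐᵒᵖ]
      (G k p'' hp'').Carrier) := by
  let e : (G k p' hp').Carrier :=
    Triple.el (T := G k p' hp') (0 : N k p'.r) ((1, 0) : N k p'.m₁ × N k p'.m₂)
  obtain ⟨v, hv⟩ : ∃ v : N k p'.r, v = fstG φ 1 := ⟨_, rfl⟩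
  obtain ⟨u, hu⟩ : ∃ u : N k p'.m₁ × N k p'.m₂, u = sndG φ (1, 0) := ⟨_, rfl⟩
  have hv0 : cf p'.r 0 v ≠ 0 := by
    rw [hv]
    exact cf_fstG_ne_zero hr h₀ hφ
  -- Comparing coefficients of x^{i₂'} shows that the component of φ(1,0) in N_{m₂'} has the same
  -- constant coefficient as φ(1), so it generates that block.
  have hu0 : cf p'.m₂ 0 u.2 = cf p'.r 0 v := by
    have h7 : sndG φ (0, 1) = (0 : N k p'.m₁ × N k p'.m₂) := by
      have h8 : ((0, 1) : N k p.m₁ × N k p.m₂) = 0 :=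
        Prod.ext rfl (cf_ext fun i hi => absurd hi (by omega))
      rw [h8]
      exact map_zero (sndG φ)
    obtain ⟨u', hu'⟩ : ∃ u' : N k p'.m₁ × N k p'.m₂, u' = sndG φ (0, 1) := ⟨_, rfl⟩
    have h5 : gMap k p' hp' v = (X : k[X]) ^ p.i₁ • u + (X : k[X]) ^ p.i₂ • u' := by
      rw [hv, hu, hu']
      exact (homG_spec φ).2.2.2
    rw [hu', h7, smul_zero, add_zero, hi] at h5
    have h6 : homOfElt (xpow k p'.m₂ p'.i₂) (pow_smul_xpow hp'.le₂') v =
      (X : k[X]) ^ p'.i₂ • u.2 := congrArg Prod.snd h5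
    have h8 := congrArg (cf p'.m₂ p'.i₂) h6
    have h9 := (hp'.lt₂ (by omega) h₂').1
    rw [cf_homOfElt_xpow hp'.le₂', cf_X_pow_smul, if_pos ⟨le_rfl, h9⟩, if_pos ⟨le_rfl, h9⟩,
      Nat.sub_self] at h8
    exact h8.symm
  let g₁ : (G k p hp).Carrier := Triple.el (T := G k p hp) (1 : N k p.r) (0 : N k p.m₁ × N k p.m₂)
  let g₂ : (G k p hp).Carrier :=
    Triple.el (T := G k p hp) (0 : N k p.r) ((1, 0) : N k p.m₁ × N k p.m₂)
  have hφ1 : φ g₁ = Triple.el (T := G k p' hp') v (0 : N k p'.m₁ × N k p'.m₂) :=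
    (Triple.hom_apply' φ g₁).trans (Triple.el_ext hv.symm (map_zero (sndG φ)))
  have hφ2 : φ g₂ = Triple.el (T := G k p' hp') (0 : N k p'.r) u :=
    (Triple.hom_apply' φ g₂).trans (Triple.el_ext (map_zero (fstG φ)) hu.symm)
  -- The image of φ absorbs the first component and the block N_{m₂'}; what is left over is a
  -- multiple of the generator e of the other block, which therefore generates the cokernel.
  have hmem : ∀ z : (G k p' hp').Carrier, ∃ (a : k[X]) (y : (G k p hp).Carrier),
      z = ofPoly k hw a • e + φ y := by
    intro z
    obtain ⟨z₁, hz₁⟩ : ∃ z₁ : N k p'.r, z₁ = Triple.p₁ z := ⟨_, rfl⟩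
    obtain ⟨z₂, hz₂⟩ : ∃ z₂ : N k p'.m₁ × N k p'.m₂, z₂ = Triple.p₂ z := ⟨_, rfl⟩
    obtain ⟨a, ha⟩ := exists_smul_eq_of_cf (fun _ => hv0) z₁
    obtain ⟨b, hb⟩ := exists_smul_eq_of_cf (fun _ => hu0.trans_ne hv0) z₂.2
    obtain ⟨c, hc⟩ := exists_smul_one (z₂.1 - b • u.1)
    refine ⟨c, ofPoly k hw a • g₁ + ofPoly k hw b • g₂, ?_⟩
    rw [map_add, map_smul, map_smul, hφ1, hφ2, Triple.ofPoly_smul, Triple.ofPoly_smul,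
      Triple.ofPoly_smul]
    refine Triple.el_ext ?_ ?_
    · rw [← hz₁]
      change z₁ = c • (0 : N k p'.r) + (a • v + b • (0 : N k p'.r))
      rw [← ha, smul_zero, smul_zero, zero_add, add_zero]
    · rw [← hz₂]
      change z₂ = c • ((1, 0) : N k p'.m₁ × N k p'.m₂) +
        (a • (0 : N k p'.m₁ × N k p'.m₂) + b • u)
      rw [smul_zero, zero_add]
      refine Prod.ext ?_ ?_
      · change z₂.1 = c • (1 : N k p'.m₁) + b • u.1
        rw [← hc, sub_add_cancel]
      · change z₂.2 = c • (0 : N k p'.m₂) + b • u.2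
        rw [← hb, smul_zero, zero_add]
  refine nonempty_equiv_G_right (v := (LinearMap.range φ).mkQ e) (m := p''.m₁) ?_ ?_ ?_ hr'' rfl h₂''
  · rw [mem_epart, ← map_smul]
    exact congrArg _ (Triple.idem₂_smul e)
  · rw [eq_top_iff]
    rintro z -
    obtain ⟨z, rfl⟩ := (LinearMap.range φ).mkQ_surjective z
    obtain ⟨a, y, rfl⟩ := hmem z
    refine Submodule.mem_span_singleton.2 ⟨ofPoly k hw a, ?_⟩
    have hy : (LinearMap.range φ).mkQ (φ y) = 0 := (Submodule.Quotient.mk_eq_zero _).2 ⟨y, rfl⟩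
    rw [map_add, map_smul, hy, add_zero]
  · have h4 := card_epart_submodule (ε := idem₂ k hw) isIdempotentElem_idem₂ (LinearMap.range φ)
    rw [← card_epart_congr _ (LinearEquiv.ofInjective φ hφ), card_epart_idem₂_G,
      card_epart_idem₂_G, ← h₁'', h₂, add_zero, pow_add] at h4
    exact (Nat.eq_of_mul_eq_mul_left (pow_pos Nat.card_pos _) h4).symm

/-- The second component of a triple with two cyclic components, and its cokernel. -/
theorem exists_injective_snd [Finite k] {p p' p'' : Par} {hp : p.Ok w} {hp' : p'.Ok w} {hp'' : p''.Ok w}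
    (hr : p.r = 0) (hi : p.i₁ = p.m₁) (h₂ : p.m₂ = 0) (h₁' : p'.m₁ = p.m₁) (h₂' : p'.m₂ = 0)
    (hr'' : p''.r = p'.r) (h₁'' : p''.m₁ = 0) (h₂'' : p''.m₂ = 0) :
    ∃ s : Triple.Hom hw (G k p hp) (G k p' hp'), Function.Injective s ∧
      Nonempty (((G k p' hp').Carrier ⧸ LinearMap.range s) ≃ₗ[(Lam k 2 w hw)ᵐᵒᵖ]
        (G k p'' hp'').Carrier) := by
  have hm : 0 < p.m₁ := (hp.zero hr).1
  have hN : ∀ y : N k p'.m₂, y = 0 := fun y => cf_ext fun i hi => absurd hi (by omega)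
  let u : N k p'.m₁ × N k p'.m₂ := (1, 0)
  have hu : (X : k[X]) ^ p.m₁ • u = 0 := by
    refine Prod.ext ?_ (hN _)
    change (X : k[X]) ^ p.m₁ • (1 : N k p'.m₁) = 0
    rw [← h₁', X_pow_smul_one]
  have hf : gMap k p' hp' 0 =
      (X : k[X]) ^ p.i₁ • u + (X : k[X]) ^ p.i₂ • (0 : N k p'.m₁ × N k p'.m₂) := by
    rw [hi, hu, map_zero, smul_zero, add_zero]
  let s := mkHomG hw (T := G k p' hp') hp (v := (0 : N k p'.r)) (u₁ := u)
    (u₂ := (0 : N k p'.m₁ × N k p'.m₂)) (smul_zero (A := N k p'.r) _) hu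
    (smul_zero (A := N k p'.m₁ × N k p'.m₂) _) hf
  have hsu : sndG s (1, 0) = u := sndG_mkHomG_left _ _ _ hf
  have hs : Function.Injective s := by
    refine (injective_hom_iff_socle hm (by omega) h₂ s).2 fun h0 => ?_
    rw [hom_socle_eq_zero_iff, hsu] at h0
    have h4 : (X : k[X]) ^ (p.m₁ - 1) • (1 : N k p'.m₁) = 0 := congrArg Prod.fst h0
    rw [← h₁'] at h4
    have h5 := cf_zero_of_top h4
    rw [cf_one (by omega)] at h5
    exact one_ne_zero h5
  refine ⟨s, hs, ?_⟩
  let e : (G k p' hp').Carrier := Triple.el (T := G k p' hp') (1 : N k p'.r) (0 : N k p'.m₁ × N k p'.m₂)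
  let g : (G k p hp).Carrier :=
    Triple.el (T := G k p hp) (0 : N k p.r) ((1, 0) : N k p.m₁ × N k p.m₂)
  have hg : s g = Triple.el (T := G k p' hp') (0 : N k p'.r) u :=
    (Triple.hom_apply' s g).trans (Triple.el_ext (map_zero (fstG s)) hsu)
  have hmem : ∀ z : (G k p' hp').Carrier, ∃ (a : k[X]) (y : (G k p hp).Carrier),
      z = ofPoly k hw a • e + s y := by
    intro z
    obtain ⟨z₁, hz₁⟩ : ∃ z₁ : N k p'.r, z₁ = Triple.p₁ z := ⟨_, rfl⟩
    obtain ⟨z₂, hz₂⟩ : ∃ z₂ : N k p'.m₁ × N k p'.m₂, z₂ = Triple.p₂ z := ⟨_, rfl⟩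
    obtain ⟨a, ha⟩ := exists_smul_one z₁
    obtain ⟨c, hc⟩ := exists_smul_one z₂.1
    refine ⟨a, ofPoly k hw c • g, ?_⟩
    rw [map_smul, hg, Triple.ofPoly_smul, Triple.ofPoly_smul]
    refine Triple.el_ext ?_ ?_
    · rw [← hz₁]
      change z₁ = a • (1 : N k p'.r) + c • (0 : N k p'.r)
      rw [← ha, smul_zero, add_zero]
    · rw [← hz₂]
      change z₂ = a • (0 : N k p'.m₁ × N k p'.m₂) + c • u
      rw [smul_zero, zero_add]
      exact Prod.ext hc ((hN _).trans (hN _).symm)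
  have h6 := card_epart_submodule (ε := idem₁ k hw) isIdempotentElem_idem₁ (LinearMap.range s)
  rw [← card_epart_congr _ (LinearEquiv.ofInjective s hs), card_epart_idem₁_G,
    card_epart_idem₁_G, hr, pow_zero, one_mul] at h6
  have h7 := card_epart_submodule (ε := idem₂ k hw) isIdempotentElem_idem₂ (LinearMap.range s)
  rw [← card_epart_congr _ (LinearEquiv.ofInjective s hs), card_epart_idem₂_G,
    card_epart_idem₂_G, h₁', h₂, h₂'] at h7
  refine nonempty_equiv_G_left (v := (LinearMap.range s).mkQ e) (m := p'.r) ?_ h6.symm ?_ hr''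
    h₁'' h₂''
  · rw [eq_top_iff]
    rintro z -
    obtain ⟨z, rfl⟩ := (LinearMap.range s).mkQ_surjective z
    obtain ⟨a, y, rfl⟩ := hmem z
    refine Submodule.mem_span_singleton.2 ⟨ofPoly k hw a, ?_⟩
    have hy : (LinearMap.range s).mkQ (s y) = 0 := (Submodule.Quotient.mk_eq_zero _).2 ⟨y, rfl⟩
    rw [map_add, map_smul, hy, add_zero]
  · exact Nat.eq_of_mul_eq_mul_left (pow_pos (Nat.card_pos (α := k)) (p.m₁ + 0))
      (h7.symm.trans (mul_one _).symm)

end Pivot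

/-! ### Types with two blocks: P_0^b ⊕ P_2^l and B_2^{l,b} -/

section TwoBlocks

variable {w : ℕ}

/-- A cyclic first component of dimension 2 sits in one summand, which is P_2 or B since the
structure map is injective. The rest has no first component, and it is at most one P_0. -/
theorem eq_of_kerd_eq_zero {a : Idx w → ℕ} {n : ℕ} (hr : wt rk a = 2) (hl : wt len a = n)
    (hb : wt blk a ≤ 2) (ht : wt top a ≤ 1) (hk : wt kerd a = 0) :
    (∃ h1 h2, a = Pi.single (.P2 n h1 h2) 1) ∨
    (∃ b l h1 h2 h3 h4, b + l = n ∧ a = Pi.single (.P0 b h1 h2) 1 + Pi.single (.P2 l h3 h4) 1) ∨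
    (∃ b l h1 h2 h3, b + l = n ∧ a = Pi.single (.B l b h1 h2 h3) 1) := by
  obtain ⟨I, a', rfl, hI⟩ := exists_single_add_of_wt_ne_zero (g := rk) (by omega : wt rk a ≠ 0)
  rw [wt_add, wt_single] at hr hl hb ht hk
  have h5 := rk_eq_zero_of_top (a := a') (by simp only [top, rk] at ht hI; omega)
  cases I with
  | P0 m h1 h2 => simp only [rk, par] at hI; omega
  | P1 m h1 h2 => simp only [rk, par] at hr; omega
  | P10 => simp only [rk, par] at hr; omega
  | P20 => simp only [kerd, par] at hk; omega
  | Z m h1 h2 => simp only [kerd, par] at hk; omega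
  | P2 m h1 h2 =>
    simp only [len, blk, par, add_zero] at hl hb
    rcases Nat.eq_zero_or_pos (wt len a') with h6 | h6
    · have ha := eq_zero_of_rk_len h5 h6
      rw [h6, add_zero] at hl
      subst ha hl
      exact .inl ⟨h1, h2, add_zero _⟩
    · obtain ⟨h, ha⟩ := eq_single_P0 h5 rfl (by omega) h6
      exact .inr (.inl ⟨_, m, h6, h, h1, h2, by omega, by rw [add_comm, ← ha]⟩)
  | B l b h1 h2 h3 =>
    simp only [len, blk, par] at hl hb
    have h6 := len_eq_zero_of_blk (a := a') (by omega)
    have ha := eq_zero_of_rk_len h5 h6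
    subst ha
    exact .inr (.inr ⟨b, l, h1, h2, h3, by omega, add_zero _⟩)

theorem Par.e_right (r m i n : ℕ) : Par.e ⟨r, m, i, 0, 0⟩ n = min (i + (n - m)) n := by
  simp only [Par.e]
  omega

theorem homI_Z_P0 {b c : ℕ} (h1 : 1 ≤ b) (h2 : b ≤ w) (h3 : 1 ≤ c) (h4 : c ≤ w) (h : c < b) :
    homI (.Z b h1 h2) (.P0 c h3 h4) = c := by
  have e₁ : Par.e ⟨2, b, b - 1, 0, 0⟩ c = c := by rw [Par.e_right]; omega
  have e₂ : Par.e ⟨2, b, b - 1, 0, 0⟩ 0 = 0 := by rw [Par.e_right]; omega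
  simp only [homI, par, Par.hom, Par.c, e₁, e₂]
  omega

theorem homI_Z_P2 {b l : ℕ} (h1 : 1 ≤ b) (h2 : b ≤ w) (h3 : 2 ≤ l) (h4 : l ≤ w) :
    homI (.Z b h1 h2) (.P2 l h3 h4) = min b l := by
  have e₂ : Par.e ⟨2, b, b - 1, 0, 0⟩ 0 = 0 := by rw [Par.e_right]; omega
  rcases Nat.lt_or_ge l b with h | h
  · have e₁ : Par.e ⟨2, b, b - 1, 0, 0⟩ l = l := by rw [Par.e_right]; omega
    simp only [homI, par, Par.hom, Par.c, e₁, e₂]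
    omega
  · have e₁ : Par.e ⟨2, b, b - 1, 0, 0⟩ l = l - 1 := by rw [Par.e_right]; omega
    simp only [homI, par, Par.hom, Par.c, e₁, e₂]
    omega

theorem homI_Z_B {b l c : ℕ} (h1 : 1 ≤ b) (h2 : b ≤ w) (h3 : 3 ≤ c + 2) (h4 : c + 2 ≤ l)
    (h5 : l ≤ w) (h : c < b) : homI (.Z b h1 h2) (.B l c h3 h4 h5) = min b l + c := by
  have e₂ : Par.e ⟨2, b, b - 1, 0, 0⟩ c = c := by rw [Par.e_right]; omega
  rcases Nat.lt_or_ge l b with h | h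
  · have e₁ : Par.e ⟨2, b, b - 1, 0, 0⟩ l = l := by rw [Par.e_right]; omega
    simp only [homI, par, Par.hom, Par.c, e₁, e₂]
    omega
  · have e₁ : Par.e ⟨2, b, b - 1, 0, 0⟩ l = l - 1 := by rw [Par.e_right]; omega
    simp only [homI, par, Par.hom, Par.c, e₁, e₂]
    omega

theorem homI_P2_P0 {b c : ℕ} (h1 : 2 ≤ b + 2) (h2 : b + 2 ≤ w) (h3 : 1 ≤ c) (h4 : c ≤ w) :
    homI (.P2 (b + 2) h1 h2) (.P0 c h3 h4) = min b c := by
  have e₂ : Par.e ⟨2, b + 2, b + 2 - 2, 0, 0⟩ 0 = 0 := by rw [Par.e_right]; omega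
  have e₁ : Par.e ⟨2, b + 2, b + 2 - 2, 0, 0⟩ c = min (b + (c - (b + 2))) c := by
    rw [Par.e_right]; omega
  simp only [homI, par, Par.hom, Par.c, e₁, e₂]
  omega

theorem homI_P2_P2 {b l : ℕ} (h1 : 2 ≤ b + 2) (h2 : b + 2 ≤ w) (h3 : 2 ≤ l) (h4 : l ≤ w) :
    homI (.P2 (b + 2) h1 h2) (.P2 l h3 h4) = min (b + 2) l := by
  have e₂ : Par.e ⟨2, b + 2, b + 2 - 2, 0, 0⟩ 0 = 0 := by rw [Par.e_right]; omega
  have e₁ : Par.e ⟨2, b + 2, b + 2 - 2, 0, 0⟩ l = min (b + (l - (b + 2))) l := by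
    rw [Par.e_right]; omega
  simp only [homI, par, Par.hom, Par.c, e₁, e₂]
  omega

theorem homI_P2_B {b l c : ℕ} (h1 : 2 ≤ b + 2) (h2 : b + 2 ≤ w) (h3 : 3 ≤ c + 2) (h4 : c + 2 ≤ l)
    (h5 : l ≤ w) (h : b < c) : homI (.P2 (b + 2) h1 h2) (.B l c h3 h4 h5) = 2 * b + 2 := by
  have e₁ : Par.e ⟨2, b + 2, b + 2 - 2, 0, 0⟩ l = l - 2 := by rw [Par.e_right]; omega
  have e₂ : Par.e ⟨2, b + 2, b + 2 - 2, 0, 0⟩ c = b + (c - (b + 2)) := by rw [Par.e_right]; omega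
  simp only [homI, par, Par.hom, Par.c, e₁, e₂]
  omega

variable (hw : 2 ≤ w)

/-- The submodule `P_0^b` in the middle term of an extension of `P_2^l` by `P_0^b`. -/
theorem hom_Z_ne {F : FinField.{u}} {b l : ℕ} (h1 : 1 ≤ b) (h2 : b ≤ w) (h3 : 2 ≤ l) (h4 : l ≤ w)
    {m : Idx w → ℕ} (hh : hall (Lam F.K 2 w hw)ᵐᵒᵖ (fun I : Idx w => Ind F.K I)
      (Pi.single (.P0 b h1 h2) 1) m (Pi.single (.P2 l h3 h4) 1) ≠ 0) :
    wt (homI (.Z b h1 h2)) m ≠ wt kerd m + wt (homI (.P0 b h1 h2)) m := by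
  intro h0
  -- Z_2^b contains P_0^b with cokernel P_2^0. Equality would extend the inclusion of P_0^b to Z_2^b
  -- and force Hom(P_2^0, P_2^l) ≠ 0, although P_2^l has an injective structure map.
  obtain ⟨s, hs, hq⟩ := exists_injective_snd (k := F.K) (hw := hw) (hp := par_ok (.P0 b h1 h2))
    (hp' := par_ok (.Z b h1 h2)) (hp'' := par_ok .P20) rfl rfl rfl rfl rfl rfl rfl rfl
  rw [← homI_P20_left] at h0
  refine (sys w hw F).ne_zero_of_hall_of_extension hh hs (by simp) hq h0 ?_
  rw [wt_single, homI_P20_left]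
  simp only [kerd, par]
  omega

/-- The other middle terms are P_2^{b+l}, P_0^{b'} ⊕ P_2^{l'} and B_2^{l',b'} with b' + l' = b + l.
For b' < b, `hom_Z_ne` excludes them: x^{b-1} maps the annihilator of x^b into the image of f. As l
≤ b + 1, this covers all B_2^{l',b'}; for b' > b the sum has l' < l, which is the induction. -/
theorem good_P0_add_P2_of_le {b l : ℕ} (h1 : 1 ≤ b) (h2 : b ≤ w) (h3 : 2 ≤ l) (h4 : l ≤ w)
    (hbl : l ≤ b + 1) :
    GoodI.{u} hw (Pi.single (.P0 b h1 h2) 1 + Pi.single (.P2 l h3 h4) 1) := by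
  induction l using Nat.strong_induction_on generalizing b with
  | _ l ih =>
    refine (sys w hw).good_add (good_P0 hw h1 h2) (good_P2 hw h3 h4) fun m hm F hF => ?_
    have hZ := hom_Z_ne hw h1 h2 h3 h4 hF
    obtain ⟨h5, h6, h7, h8, -, h9, -⟩ := bounds_of_hall hF
    simp only [wt_single, rk, len, blk, top, kerd, par] at h5 h6 h7 h8 h9
    rcases eq_of_kerd_eq_zero (n := b + l) h5 (by omega) (by omega) (by omega) (by omega) with
      ⟨_, _, rfl⟩ | ⟨b', l', _, _, _, _, h10, rfl⟩ | ⟨b', l', _, _, _, h10, rfl⟩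
    · exact good_P2 hw _ _
    · rcases lt_trichotomy b' b with hb | rfl | hb
      · refine absurd ?_ hZ
        rw [wt_add, wt_add, wt_add, wt_single, wt_single, wt_single, wt_single, wt_single, wt_single,
          homI_Z_P0 _ _ _ _ hb, homI_Z_P2, homI_P0, homI_P0]
        simp only [kerd, par]
        omega
      · obtain rfl : l' = l := by omega
        exact absurd rfl hm
      · exact ih l' (by omega) _ _ _ _ (by omega)
    · refine absurd ?_ hZ
      rw [wt_single, wt_single, wt_single, homI_Z_B _ _ _ _ _ (by omega), homI_P0]
      simp only [kerd, par]
      omega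

/-- Candidates with b' < b are again excluded by `hom_Z_ne`, and maps from P_0^{b+1} limit those
with b' > b to sums covered by `good_P0_add_P2_of_le`. Only B_2^{l,b} remains, which is assumed to
be good. -/
theorem good_P0_add_P2_of_B {b l : ℕ} (h1 : 1 ≤ b) (h2 : b ≤ w) (h3 : 2 ≤ l) (h4 : l ≤ w)
    (hbl : b + 2 ≤ l) (hB : GoodI.{u} hw (Pi.single (.B l b (by omega) hbl h4) 1)) :
    GoodI.{u} hw (Pi.single (.P0 b h1 h2) 1 + Pi.single (.P2 l h3 h4) 1) := by
  refine (sys w hw).good_add (good_P0 hw h1 h2) (good_P2 hw h3 h4) fun m hm F hF => ?_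
  have hZ := hom_Z_ne hw h1 h2 h3 h4 hF
  have ht := (sys w hw F).le_add_of_hall hF (.P0 (b + 1) (by omega) (by omega))
  obtain ⟨h5, h6, h7, h8, -, h9, -⟩ := bounds_of_hall hF
  simp only [wt_single, rk, len, blk, top, kerd, par] at h5 h6 h7 h8 h9
  rcases eq_of_kerd_eq_zero (n := b + l) h5 (by omega) (by omega) (by omega) (by omega) with
    ⟨_, _, rfl⟩ | ⟨b', l', _, _, _, _, h10, rfl⟩ | ⟨b', l', _, _, _, h10, rfl⟩
  · exact good_P2 hw _ _
  · rcases lt_trichotomy b' b with hb | rfl | hb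
    · refine absurd ?_ hZ
      rw [wt_add, wt_add, wt_add, wt_single, wt_single, wt_single, wt_single, wt_single, wt_single,
        homI_Z_P0 _ _ _ _ hb, homI_Z_P2, homI_P0, homI_P0]
      simp only [kerd, par]
      omega
    · obtain rfl : l' = l := by omega
      exact absurd rfl hm
    · refine good_P0_add_P2_of_le hw _ _ _ _ ?_
      simp only [wt_add, wt_single, homI_P0, par] at ht
      omega
  · rcases lt_trichotomy b' b with hb | rfl | hb
    · refine absurd ?_ hZ
      rw [wt_single, wt_single, wt_single, homI_Z_B _ _ _ _ _ hb, homI_P0]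
      simp only [kerd, par]
      omega
    · obtain rfl : l' = l := by omega
      exact hB
    · simp only [wt_single, homI_P0, par] at ht
      omega

/-- Every quotient of B_2^{l,b} by a copy of P_2^{b+1} is P_0^{l-1} (`nonempty_quotient_equiv`), so
it is enough to count submodules: (q^{2b} - q^{2b-1})/(q^{b+1} - q^b) = q^{b-1}. -/
theorem hall_P2_B {F : FinField.{u}} {b l : ℕ} (h1 : 3 ≤ b + 2) (h2 : b + 2 ≤ l) (h3 : l ≤ w) :
    hall (Lam F.K 2 w hw)ᵐᵒᵖ (fun I : Idx w => Ind F.K I)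
      (Pi.single (.P2 (b + 1) (by omega) (by omega)) 1) (Pi.single (.B l b h1 h2 h3) 1)
      (Pi.single (.P0 (l - 1) (by omega) (by omega)) 1) = Nat.card F.K ^ (b - 1) := by
  have σ := sys w hw F
  have := σ.finite_mSum
  rw [σ.hall_eq_subN fun c hc => ?_]
  · have h4 := σ.subN_mul (i := .P2 (b + 1) (by omega) (by omega)) (socle F.K _ (par_ok _))
      (fun _ φ => injective_iff_socle (Nat.succ_pos b)
        (by simp only [par]; omega) rfl φ) (fun J => card_hom_socle (par_ok J))
      (Pi.single (.B l b h1 h2 h3) 1)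
    rw [wt_single, wt_single] at h4
    have h5 : homI (.P2 (b + 1) (by omega) (by omega)) (.B l b h1 h2 h3) = (b - 1) + (b + 1) := by
      simp [homI, par, Par.hom, Par.e, Par.c]
      omega
    have h6 : homI (.P2 (b + 1) (by omega) (by omega) : Idx w)
        (.P2 (b + 1) (by omega) (by omega)) = b + 1 := by
      simp [homI, par, Par.hom, Par.e, Par.c]
      omega
    have h7 : Par.hom ⟨2, b + 1 - 1, b + 1 - 2, 0, 0⟩ (par (.B l b h1 h2 h3)) = (b - 1) + b := by
      simp [par, Par.hom, Par.e, Par.c]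
      omega
    have h8 : Par.hom ⟨2, b + 1 - 1, b + 1 - 2, 0, 0⟩
        (par (.P2 (b + 1) (by omega) (by omega) : Idx w)) = b := by
      simp [par, Par.hom, Par.e, Par.c]
      omega
    have h9 : (par (.P2 (b + 1) (by omega) (by omega) : Idx w)) = ⟨2, b + 1, b + 1 - 2, 0, 0⟩ := rfl
    rw [h5, h6] at h4
    simp only [h9] at h4 h8
    rw [h7, h8, pow_add _ (b - 1) (b + 1), pow_add _ (b - 1) b, ← Nat.mul_sub] at h4
    refine Nat.eq_of_mul_eq_mul_right ?_ h4
    exact Nat.sub_pos_of_lt (Nat.pow_lt_pow_right σ.one_lt (Nat.lt_succ_self b))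
  · obtain ⟨U, ⟨eU⟩, ⟨eQ⟩⟩ := σ.hall_ne_zero_iff.1 hc
    obtain ⟨e₁⟩ := nonempty_mSumSingle (S := (Lam F.K 2 w hw)ᵐᵒᵖ) (X := fun I : Idx w => Ind F.K I)
      (.P2 (b + 1) (by omega) (by omega))
    obtain ⟨e₂⟩ := nonempty_mSumSingle (S := (Lam F.K 2 w hw)ᵐᵒᵖ) (X := fun I : Idx w => Ind F.K I)
      (.B l b h1 h2 h3)
    let φ : Ind F.K (.P2 (b + 1) (by omega) (by omega) : Idx w) →ₗ[(Lam F.K 2 w hw)ᵐᵒᵖ]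
        Ind F.K (.B l b h1 h2 h3) :=
      e₂.toLinearMap ∘ₗ U.subtype ∘ₗ (e₁.symm ≪≫ₗ eU.symm).toLinearMap
    have hφ : Function.Injective φ :=
      e₂.injective.comp (U.injective_subtype.comp (e₁.symm ≪≫ₗ eU.symm).injective)
    have hφU : LinearMap.range φ = U.map e₂.toLinearMap := by
      rw [LinearMap.range_comp, LinearMap.range_comp, LinearEquiv.range, Submodule.map_top,
        Submodule.range_subtype]
    obtain ⟨e₃⟩ := nonempty_quot_map_equiv e₂ U
    have q₁ : (par (.P2 (b + 1) (by omega) (by omega) : Idx w)).i₁ =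
        (par (.B l b h1 h2 h3)).i₂ := by simp only [par]; omega
    have q₂ : 0 < (par (.B l b h1 h2 h3)).m₂ := by simp only [par]; omega
    have q₃ : (par (.P2 (b + 1) (by omega) (by omega) : Idx w)).m₁ +
        (par (.P0 (l - 1) (by omega) (by omega) : Idx w)).m₁ =
        (par (.B l b h1 h2 h3)).m₁ + (par (.B l b h1 h2 h3)).m₂ := by simp only [par]; omega
    obtain ⟨e₄⟩ := nonempty_quotient_equiv (k := F.K) (hw := hw)
      (p := par (.P2 (b + 1) (by omega) (by omega))) (p' := par (.B l b h1 h2 h3))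
      (p'' := par (.P0 (l - 1) (by omega) (by omega))) (hp := par_ok _) (hp' := par_ok _)
      (hp'' := par_ok _) rfl Nat.zero_lt_two rfl q₁ q₂ rfl q₃ rfl hφ
    refine σ.indec _ _ ⟨e₄.symm ≪≫ₗ Submodule.quotEquivOfEq _ _ hφU ≪≫ₗ e₃.symm ≪≫ₗ eQ⟩

/-- In the extension with submodule P_2^{b+1} and quotient P_0^{l-1}, the other middle terms are
P_2^{b+l}, terms B_2^{l',b'} with b' < b, and sums P_0^{b'} ⊕ P_2^{l'}. A sum is good by
`good_P0_add_P2_of_B` and induction if b' < b, and by `good_P0_add_P2_of_le` if b' ≥ b. -/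
theorem good_B {b l : ℕ} (h1 : 3 ≤ b + 2) (h2 : b + 2 ≤ l) (h3 : l ≤ w) :
    GoodI.{u} hw (Pi.single (.B l b h1 h2 h3) 1) := by
  induction b using Nat.strong_induction_on generalizing l with
  | _ b ih =>
    refine (sys w hw).good_of_relation (good_P2 hw (n := b + 1) (by omega) (by omega))
      (good_P0 hw (n := l - 1) (by omega) (by omega)) ?_ fun m hm F hF => ?_
    · convert ratOf_pow (b - 1) using 2
      funext F
      exact hall_P2_B hw h1 h2 h3
    -- P_2^{b+2} has Hom spaces of total dimension 2b + 1 to the two ends. This excludes B_2^{l',b'}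
    -- with b' > b, where the dimension is 2b + 2, and forces l' ≤ b + 1 for the sums with b' ≥ b.
    · have ht := (sys w hw F).le_add_of_hall hF (.P2 (b + 2) (by omega) (by omega))
      obtain ⟨h5, h6, h7, h8, -, h9, -⟩ := bounds_of_hall hF
      simp only [wt_single, rk, len, blk, top, kerd, par] at h5 h6 h7 h8 h9
      rcases eq_of_kerd_eq_zero (n := b + l) h5 (by omega) (by omega) (by omega) (by omega) with
        ⟨_, _, rfl⟩ | ⟨b', l', _, _, _, _, h10, rfl⟩ | ⟨b', l', _, _, _, h10, rfl⟩
      · exact good_P2 hw _ _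
      · by_cases hb : b' < b
        · exact good_P0_add_P2_of_B hw _ _ _ _ (by omega) (ih b' hb _ _ _)
        · refine good_P0_add_P2_of_le hw _ _ _ _ ?_
          rw [wt_add, wt_single, wt_single, wt_single, wt_single, homI_P2_P0, homI_P2_P0,
            homI_P2_P2, homI_P2_P2] at ht
          omega
      · rcases lt_trichotomy b' b with hb | rfl | hb
        · exact ih b' hb _ _ _
        · obtain rfl : l' = l := by omega
          exact absurd rfl hm
        · rw [wt_single, wt_single, wt_single, homI_P2_P0, homI_P2_P2,
            homI_P2_B _ _ _ _ _ hb] at ht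
          omega

theorem good (a : Idx w → ℕ) : GoodI.{u} hw a := by
  refine (sys w hw).good_of_single (fun I => ?_) a
  cases I with
  | P0 m h1 h2 => exact good_P0 hw h1 h2
  | P1 m h1 h2 => exact good_P1 hw h1 h2
  | P2 m h1 h2 => exact good_P2 hw h1 h2
  | B m' m h1 h2 h3 => exact good_B hw h1 h2 h3
  | P10 => exact good_P10 hw
  | P20 => exact good_P20 hw
  | Z m h1 h2 => exact good_Z hw h1 h2

end TwoBlocks

/-! ### The listed modules in the uniform description G(p) -/

section Comparison

variable (k : Type u) [Field k] {w : ℕ} (hw : 2 ≤ w)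

theorem subsingleton_N_zero : Subsingleton (N k 0) :=
  Submodule.Quotient.subsingleton_iff.2 (by simp)

/-- The linear equivalence of two zero modules. -/
def equivOfSubsingleton (A B : Type*) [AddCommGroup A] [Module k[X] A] [AddCommGroup B]
    [Module k[X] B] [Subsingleton A] [Subsingleton B] : A ≃ₗ[k[X]] B :=
  { (0 : A →ₗ[k[X]] B) with
    invFun := 0
    left_inv := fun _ => Subsingleton.elim _ _
    right_inv := fun _ => Subsingleton.elim _ _ }

attribute [local instance] subsingleton_N_zero

/-- The direct sum of a module and the zero module. -/
def prodNZero (m : ℕ) : N k m ≃ₗ[k[X]] N k m × N k 0 :=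
  { LinearMap.inl k[X] (N k m) (N k 0) with
    invFun := Prod.fst
    left_inv := fun _ => rfl
    right_inv := fun _ => Prod.ext rfl (Subsingleton.elim _ _) }

/-- The two descriptions of the indecomposable modules agree. -/
theorem nonempty_indec_equiv (I : Idx w) :
    Nonempty ((indec k I).Carrier ≃ₗ[(Lam k 2 w hw)ᵐᵒᵖ] Ind k I) := by
  cases I with
  | P0 m h1 h2 =>
    refine Triple.nonempty_equiv (T := indec k (.P0 m h1 h2)) (T' := G k _ (par_ok (.P0 m h1 h2)))
      (equivOfSubsingleton k PUnit (N k 0)) (prodNZero k m) fun v => ?_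
    have hv : v = 0 := Subsingleton.elim (α := PUnit) _ _
    subst hv
    exact (map_zero (prodNZero k m)).trans ((congrArg _ (map_zero _)).trans (map_zero _)).symm
  | P10 =>
    exact Triple.nonempty_equiv (T := indec k .P10) (T' := G k _ (par_ok .P10))
      (LinearEquiv.refl _ (N k 1)) (equivOfSubsingleton k PUnit (N k 0 × N k 0))
      fun v => Subsingleton.elim (α := N k 0 × N k 0) _ _
  | P20 =>
    exact Triple.nonempty_equiv (T := indec k .P20) (T' := G k _ (par_ok .P20))
      (LinearEquiv.refl _ (N k 2)) (equivOfSubsingleton k PUnit (N k 0 × N k 0))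
      fun v => Subsingleton.elim (α := N k 0 × N k 0) _ _
  | P1 m h1 h2 =>
    exact Triple.nonempty_equiv (T := indec k (.P1 m h1 h2)) (T' := G k _ (par_ok (.P1 m h1 h2)))
      (LinearEquiv.refl _ (N k 1)) (prodNZero k m)
      fun v => Prod.ext rfl (Subsingleton.elim (α := N k 0) _ _)
  | P2 m h1 h2 =>
    exact Triple.nonempty_equiv (T := indec k (.P2 m h1 h2)) (T' := G k _ (par_ok (.P2 m h1 h2)))
      (LinearEquiv.refl _ (N k 2)) (prodNZero k m)
      fun v => Prod.ext rfl (Subsingleton.elim (α := N k 0) _ _)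
  | Z m h1 h2 =>
    exact Triple.nonempty_equiv (T := indec k (.Z m h1 h2)) (T' := G k _ (par_ok (.Z m h1 h2)))
      (LinearEquiv.refl _ (N k 2)) (prodNZero k m)
      fun v => Prod.ext rfl (Subsingleton.elim (α := N k 0) _ _)
  | B l m h1 h2 h3 =>
    refine Triple.nonempty_equiv (T := indec k (.B l m h1 h2 h3))
      (T' := G k _ (par_ok (.B l m h1 h2 h3)))
      (LinearEquiv.refl _ (N k 2)) (LinearEquiv.refl _ (N k l × N k m)) fun v => ?_
    obtain ⟨p, rfl⟩ := Ideal.Quotient.mk_surjective v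
    rfl

/-- The two descriptions of the modules `a(k)` agree. -/
theorem nonempty_dSum_equiv (a : Idx w → ℕ) :
    Nonempty (DSum k a ≃ₗ[(Lam k 2 w hw)ᵐᵒᵖ] MSum (fun I : Idx w => Ind k I) a) :=
  ⟨LinearEquiv.piCongrRight fun I => LinearEquiv.piCongrRight fun _ =>
    (nonempty_indec_equiv k hw I).some⟩

theorem hallNumber_eq_hall (a b c : Idx w → ℕ) :
    hallNumber (Lam k 2 w hw) (DSum k a) (DSum k b) (DSum k c) =
      hall (Lam k 2 w hw)ᵐᵒᵖ (fun I : Idx w => Ind k I) a b c := by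
  rw [hall, ← hallCard_congr (nonempty_dSum_equiv k hw b).some (nonempty_dSum_equiv k hw a).some
    (nonempty_dSum_equiv k hw c).some, hallCard, hallNumber, ← Nat.card_coe_set_eq]
  rfl

end Comparison

end HallPoly

end

theorem theorem2p3 (w : ℕ) (hw : 2 ≤ w) (a b c : HallPoly.Idx w → ℕ) :
    ∃ φ : Polynomial ℤ, ∀ (k : Type*) [Field k] [Finite k],
      (HallPoly.hallNumber (HallPoly.Lam k 2 w hw)
          (HallPoly.DSum k a) (HallPoly.DSum k b) (HallPoly.DSum k c) : ℤ) =
        φ.eval (Nat.card k : ℤ) := by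
  obtain ⟨φ, hφ⟩ := HallPoly.exists_polynomial_of_mem_ratFn (HallPoly.good hw a b c)
    fun F => ⟨_, (Int.cast_natCast _).symm⟩
  refine ⟨φ, fun k _ _ => ?_⟩
  rw [HallPoly.hallNumber_eq_hall]
  exact Int.cast_injective (α := ℚ) ((Int.cast_natCast _).trans (hφ ⟨k⟩))
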